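/- **Conventions.** An $N\times N$ compact matrix quantum group $G$ is given by a unital $C^*$-algebra $A=C(G)$ and a unitary matrix $u=(u_{ij})\in M_N(A)$ whose entries generate a dense $*$-subalgebra $\mathcal A$, with a comultiplication $\Delta(u_{ij})=\sum_ku_{ik}\otimes u_{kj}$, a counit $\varepsilon(u_{ij})=\delta_{ij}$ and an antipode $S(u_{ij})=u_{ji}^*$ (morphisms of $*$-algebras $\mathcal A\to\mathcal A\otimes\mathcal A$, $\mathcal A\to\mathbb C$, $\mathcal A\to\mathcal A^{opp}$). We write $G\subset H$ when there is a morphism of $*$-algebras $\mathcal A_H\to\mathcal A_G$ mapping $u_{ij}\mapsto u_{ij}$, and $G=H$ when there is an isomorphism of $*$-algebras with this property. The group $O_N$ has the algebra $C(O_N)$ with $u_{ij}(g)=g_{ij}$; $C(O_N^+)$ is the universal $C^*$-algebra with $u=\bar u$, $u^t=u^{-1}$; $C(O_N^*)$ is the universal $C^*$-algebra with the further relations $abc=cba$ for all $a,b,c\in\{u_{ij}\}$. For colored integers $k,l$ (words in $\circ,\bullet$), let $P(k,l)$ be the set of partitions between an upper row of $|k|$ points and a lower row of $|l|$ points, colored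 by $k,l$. A category of partitions is a collection $D(k,l)\subset P(k,l)$ stable under horizontal concatenation, vertical concatenation (with matching middle words, the closed components being erased) and upside-down turning, containing the identity of each $P(k,k)$ and the semicircles in $P(\emptyset,\circ\bullet)$ and $P(\emptyset,\bullet\circ)$. Let $u^{\otimes k}$ be the tensor product of copies of $u$ (for $\circ$) and $\bar u=(u_{ij}^*)$ (for $\bullet$), $Hom(u^{\otimes k},u^{\otimes l})=\{T\,|\,Tu^{\otimes k}=u^{\otimes l}T\}$, and $T_\pi(e_{i_1}\otimes\cdots\otimes e_{i_{|k|}})=\sum_j\delta_\pi(i,j)\,e_{j_1}\otimes\cdots\otimes e_{j_{|l|}}$, with $\delta_\pi(i,j)=1$ if all blocks of $\pi$ join equal indices, and $0$ otherwise. Then $G$ is easy, coming from the category of partitions $D$, when $Hom(u^{\otimes k},u^{\otimes l})=span(T_\pi\,|\,\pi\in D(k,l))$ for all $k,l$; it is easy if it comes in this way from some $D$. Let $P_2$ be the collection of all pairings, $NC_2$ that of the noncrossing pairings, and $P_2^*$ that of the pairings such that, when the legs are relabelled clockwise $\circ\bullet\circ\bullet\ldots$, each string joins a $\circ$ to a $\bullet$.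 (In all three cases, all colorings of the rows by $k,l$ are allowed.) **Theorem.** 1. $P_2^*$ is a category of partitions with $NC_2\subsetneq P_2^*\subsetneq P_2$, and it is the only category of partitions strictly between $NC_2$ and $P_2$. 2. For any $N\geq1$, $O_N^*$ is an easy quantum group, coming from the category $P_2^*$, and $O_N\subset O_N^*\subset O_N^+$. For $N\geq3$ both inclusions are proper. 3. For any $N\geq1$, if $G$ is an easy quantum group with $O_N\subset G\subset O_N^+$, $G\neq O_N$ and $G\neq O_N^+$, then $G=O_N^*$. So, for $N\geq3$, $O_N^*$ is the only proper intermediate easy quantum group. 4. The family $(O_N^*)$ is not uniform: it is not true that $O_{N-1}^*=O_N^*\cap U_{N-1}^+$ for all $N\geq2$, where $U_{N-1}^+\subset U_N^+$ is given by $u\mapsto diag(u,1)$ and $C(O_N^*\cap U_{N-1}^+)$ is the universal $C^*$-algebra generated by the entries of a biunitary $(N-1)\times(N-1)$ matrix $w$ (that is, $w$ and $\bar w$ are unitary) such that $diag(w,1)$ satisfies all the $*$-polynomial relations between the coordinates of $O_N^*$. Also, $P_2^*$ is not stable under the operation of removing blocks. -/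

import Mathlib

open scoped ENNReal TensorProduct Matrix

universe u v

namespace EasyQG

/-! ### Partitions and categories of partitions -/

/-- `Part m n` is the set of partitions between an upper row of `m` points and a lower row of
`n` points; upper points are `Sum.inl i`, lower points are `Sum.inr j`. -/
abbrev Part (m n : ℕ) := Setoid (Fin m ⊕ Fin n)

/-- A colored integer of length `m`: `false` is the white color, `true` is the black color. -/
abbrev Word (m : ℕ) := Fin m → Bool

/-- A collection of subsets `D(k,l) ⊂ P(k,l)`, with `k,l` ranging over the colored integers. -/
abbrev PartFamily := ∀ m n : ℕ, Word m → Word n → Set (Part m n)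

/-- Horizontal concatenation `[πσ]`. -/
@[reducible]
def Part.tensor {m n m' n' : ℕ} (π : Part m n) (σ : Part m' n') : Part (m + m') (n + n') :=
  Setoid.map π (Sum.map (Fin.castAdd m') (Fin.castAdd n')) ⊔
    Setoid.map σ (Sum.map (Fin.natAdd m) (Fin.natAdd n))

/-- Vertical concatenation, with `π` above `σ`: on the three rows of points, glue `π` (rows 1, 2)
and `σ` (rows 2, 3), then restrict to rows 1 and 3. Components inside row 2 are erased. -/
@[reducible]
def Part.comp {m n p : ℕ} (π : Part m n) (σ : Part n p) : Part m p :=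
  Setoid.comap (Sum.map id Sum.inr : Fin m ⊕ Fin p → Fin m ⊕ (Fin n ⊕ Fin p))
    (Setoid.map π (Sum.map id Sum.inl) ⊔ Setoid.map σ Sum.inr)

/-- Upside-down turning `π*`. -/
@[reducible]
def Part.flip {m n : ℕ} (π : Part m n) : Part n m := Setoid.comap Sum.swap π

/-- The identity partition, joining each upper point to the lower point below it. -/
@[reducible]
def Part.idPart (m : ℕ) : Part m m := Setoid.ker (Sum.elim id id)

/-- Categories of partitions. In the last axiom, `⊤` is the one-block partition (the semicircle)
in `P(∅, ○●)` and in `P(∅, ●○)`. -/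
structure IsCategory (D : PartFamily) : Prop where
  tensor : ∀ {m n m' n' : ℕ} {k : Word m} {l : Word n} {k' : Word m'} {l' : Word n'}
    {π : Part m n} {σ : Part m' n'}, π ∈ D m n k l → σ ∈ D m' n' k' l' →
    π.tensor σ ∈ D (m + m') (n + n') (Fin.append k k') (Fin.append l l')
  comp : ∀ {m n p : ℕ} {k : Word m} {l : Word n} {r : Word p} {π : Part m n} {σ : Part n p},
    π ∈ D m n k l → σ ∈ D n p l r → π.comp σ ∈ D m p k r
  flip : ∀ {m n : ℕ} {k : Word m} {l : Word n} {π : Part m n},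
    π ∈ D m n k l → π.flip ∈ D n m l k
  one : ∀ {m : ℕ} (k : Word m), Part.idPart m ∈ D m m k k
  cap : ∀ c : Bool, (⊤ : Part 0 2) ∈ D 0 2 ![] ![c, !c]

/-- All blocks have exactly two elements. -/
def IsPairing {m n : ℕ} (π : Part m n) : Prop := ∀ a, ∃! b, b ≠ a ∧ π a b

/-- The position (from `0` to `m + n - 1`) of a point when the points are numbered clockwise:
the upper row from left to right, then the lower row from right to left. -/
def cpos {m n : ℕ} : Fin m ⊕ Fin n → ℕ :=
  Sum.elim (fun i => (i : ℕ)) (fun j => m + (Fin.rev j : ℕ))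

/-- `P₂`: all pairings. -/
def P2 : PartFamily := fun _ _ _ _ => {π | IsPairing π}

/-- `NC₂`: the noncrossing pairings. -/
def NC2 : PartFamily := fun _ _ _ _ =>
  {π | IsPairing π ∧ ∀ a b c d, cpos a < cpos b → cpos b < cpos c → cpos c < cpos d →
    ¬(π a c ∧ π b d)}

/-- `P₂*`: the pairings such that, when the legs are relabelled clockwise `○●○●…`, each string
joins a `○` to a `●`, that is, joins positions of different parities. -/
def P2star : PartFamily := fun _ _ _ _ =>
  {π | IsPairing π ∧ ∀ a b, a ≠ b → π a b → Odd (cpos a + cpos b)}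

/-- Stability under the removal of blocks: if the increasing maps `f, g` enumerate the points
outside the block of `a`, the restriction of `π` to these points is again in `D`. -/
def StableUnderBlockRemoval (D : PartFamily) : Prop :=
  ∀ {m n m' n' : ℕ} (k : Word m) (l : Word n) (π : Part m n), π ∈ D m n k l →
    ∀ (a : Fin m ⊕ Fin n) (f : Fin m' → Fin m) (g : Fin n' → Fin n),
      StrictMono f → StrictMono g → Set.range (Sum.map f g) = {b | ¬ π a b} →
      Setoid.comap (Sum.map f g) π ∈ D m' n' (k ∘ f) (l ∘ g)

/-! ### `C*`-algebras with a distinguished matrix, and compact quantum groups -/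

/-- A pair `(A, u)`: a unital `C*`-algebra `A` with a matrix `u ∈ M_N(A)`. -/
structure QMat (N : ℕ) where
  /-- the `C*`-algebra, playing the role of `C(G)` -/
  A : Type u
  [cstar : CStarAlgebra A]
  /-- the matrix of standard coordinates -/
  u : Matrix (Fin N) (Fin N) A

attribute [instance] QMat.cstar

namespace QMat

variable {N : ℕ}

/-- The `*`-algebra `𝒜 ⊂ A` generated by the standard coordinates. -/
def coordAlg (G : QMat.{u} N) : StarSubalgebra ℂ G.A :=
  StarAlgebra.adjoin ℂ (Set.range fun p : Fin N × Fin N => G.u p.1 p.2)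

/-- The standard coordinates, as elements of `𝒜`. -/
def x (G : QMat.{u} N) (i j : Fin N) : G.coordAlg :=
  ⟨G.u i j, StarAlgebra.subset_adjoin ℂ _ ⟨(i, j), rfl⟩⟩

/-- The inclusion `G ⊂ H`: a morphism of `*`-algebras from the coordinate algebra of `H` to the
one of `G`, mapping standard coordinates to standard coordinates. -/
def Sub (G : QMat.{u} N) (H : QMat.{v} N) : Prop :=
  ∃ Φ : H.coordAlg →⋆ₐ[ℂ] G.coordAlg, ∀ i j, Φ (H.x i j) = G.x i j

/-- The identification `G = H`: an isomorphism between the `*`-algebras generated by the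
coordinates, mapping standard coordinates to standard coordinates. (Different completions of the
same `*`-algebra, such as the full and the reduced one, define the same quantum group.) -/
def Same (G : QMat.{u} N) (H : QMat.{v} N) : Prop :=
  ∃ Φ : G.coordAlg ≃⋆ₐ[ℂ] H.coordAlg, ∀ i j, Φ (G.x i j) = H.x i j

/-- `(A, u)` is the algebra of continuous functions on a compact matrix quantum group: `u` is
unitary, its coefficients generate `A`, and there are a comultiplication, a counit and an
antipode. Since quantum groups are identified as soon as their `*`-algebras `𝒜` agree, these
morphisms are asked on the dense `*`-algebra `𝒜`; they extend to the full completion of `𝒜`. -/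
structure IsQuantumGroup (G : QMat.{u} N) : Prop where
  unitary : G.u * G.uᴴ = 1 ∧ G.uᴴ * G.u = 1
  dense : Dense (G.coordAlg : Set G.A)
  comul : ∃ Δ : G.coordAlg →⋆ₐ[ℂ] G.coordAlg ⊗[ℂ] G.coordAlg,
    ∀ i j, Δ (G.x i j) = ∑ k, G.x i k ⊗ₜ[ℂ] G.x k j
  counit : ∃ ε : G.coordAlg →⋆ₐ[ℂ] ℂ, ∀ i j, ε (G.x i j) = if i = j then 1 else 0
  antipode : ∃ S : G.coordAlg →⋆ₐ[ℂ] (G.coordAlg)ᵐᵒᵖ,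
    ∀ i j, S (G.x i j) = MulOpposite.op (star (G.x j i))

/-! ### Intertwiners and easiness -/

/-- The Peter-Weyl corepresentation `u^{⊗k}`, for a colored integer `k`; a white letter gives `u`,
a black letter gives the conjugate matrix `(u_{ij}^*)`. -/
noncomputable def tensorPow (G : QMat.{u} N) {m : ℕ} (k : Word m) :
    Matrix (Fin m → Fin N) (Fin m → Fin N) G.A :=
  Matrix.of fun I J =>
    (List.ofFn fun a => if k a then star (G.u (I a) (J a)) else G.u (I a) (J a)).prod

/-- `Hom(u^{⊗k}, u^{⊗l}) = {T | T u^{⊗k} = u^{⊗l} T}`, linear maps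
`(ℂ^N)^{⊗m} → (ℂ^N)^{⊗n}` being written as matrices in the standard bases. -/
def Hom (G : QMat.{u} N) {m n : ℕ} (k : Word m) (l : Word n) :
    Set (Matrix (Fin n → Fin N) (Fin m → Fin N) ℂ) :=
  {T | T.map (algebraMap ℂ G.A) * G.tensorPow k = G.tensorPow l * T.map (algebraMap ℂ G.A)}

end QMat

open Classical in
/-- The linear map `T_π`, whose `(J, I)` entry is the Kronecker symbol `δ_π(I, J)`. -/
noncomputable def Tmap (N : ℕ) {m n : ℕ} (π : Part m n) :
    Matrix (Fin n → Fin N) (Fin m → Fin N) ℂ :=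
  Matrix.of fun J I => if ∀ a b, π a b → Sum.elim I J a = Sum.elim I J b then 1 else 0

/-- `G` is easy, coming from the category of partitions `D`. -/
def QMat.IsEasyFrom {N : ℕ} (G : QMat.{u} N) (D : PartFamily) : Prop :=
  IsCategory D ∧ ∀ (m n : ℕ) (k : Word m) (l : Word n),
    G.Hom k l = (Submodule.span ℂ (Tmap N '' D m n k l) : Set _)

/-- `G` is easy. -/
def QMat.IsEasy {N : ℕ} (G : QMat.{u} N) : Prop := ∃ D, G.IsEasyFrom D

/-! ### Universal `C*`-algebras -/

/-- Noncommutative `*`-polynomials in `N²` variables: `(i, j, false)` stands for `u_{ij}`, and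
`(i, j, true)` for `u_{ij}^*`. -/
abbrev StarPoly (N : ℕ) := FreeAlgebra ℂ (Fin N × Fin N × Bool)

/-- Evaluation of `*`-polynomials on a matrix with entries in a `C*`-algebra. -/
noncomputable def evalPoly {N : ℕ} {B : Type u} [CStarAlgebra B] (w : Matrix (Fin N) (Fin N) B) :
    StarPoly N →ₐ[ℂ] B :=
  FreeAlgebra.lift ℂ fun p => if p.2.2 then star (w p.1 p.2.1) else w p.1 p.2.1

/-- Conditions on `N × N` matrices over `C*`-algebras. -/
abbrev MatRel (N : ℕ) := ∀ (B : Type) [CStarAlgebra B], Matrix (Fin N) (Fin N) B → Prop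

/-- A nonzero `C*`-algebra with a matrix of contractions which satisfies the condition `R`. For
relations which force `u` to be biunitary, the entries are automatically contractions. -/
structure Model {N : ℕ} (R : MatRel N) where
  /-- the algebra -/
  B : Type
  [cstar : CStarAlgebra B]
  [nontriv : Nontrivial B]
  /-- the matrix -/
  w : Matrix (Fin N) (Fin N) B
  contr : ∀ i j, ‖w i j‖ ≤ 1
  rel : R B w

attribute [instance] Model.cstar Model.nontriv

/-- The (small) set of `C*`-seminorms on the `*`-polynomials which come from the models of `R`. -/
def SeminormIdx {N : ℕ} (R : MatRel N) : Type :=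
  {s : StarPoly N → ℝ // ∃ M : Model R, ∀ p, s p = ‖evalPoly M.w p‖}

/-- A model realizing a given seminorm. -/
noncomputable def SeminormIdx.model {N : ℕ} {R : MatRel N} (s : SeminormIdx R) : Model R :=
  s.2.choose

/-- The bounded families of elements of the models, one model for each seminorm. -/
noncomputable abbrev BigProd {N : ℕ} (R : MatRel N) := lp (fun s : SeminormIdx R => s.model.B) ∞

noncomputable instance {N : ℕ} (R : MatRel N) : CStarAlgebra (BigProd R) where

/-- The matrix of the universal model, inside the product of all the models. -/
noncomputable def bigMat {N : ℕ} (R : MatRel N) : Matrix (Fin N) (Fin N) (BigProd R) :=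
  Matrix.of fun i j => ⟨fun s => s.model.w i j,
    memℓp_infty ⟨1, by rintro _ ⟨s, rfl⟩; exact s.model.contr i j⟩⟩

/-- The closed `*`-subalgebra generated by the entries of `bigMat`. -/
noncomputable def univAlg {N : ℕ} (R : MatRel N) : StarSubalgebra ℂ (BigProd R) :=
  (StarAlgebra.adjoin ℂ
    (Set.range fun p : Fin N × Fin N => bigMat R p.1 p.2)).topologicalClosure

instance {N : ℕ} (R : MatRel N) : IsClosed (univAlg R : Set (BigProd R)) :=
  StarSubalgebra.isClosed_topologicalClosure _

/-- The universal `C*`-algebra `C*((u_ij) | R)`: it is generated by the `u_ij`, and the norm of a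
`*`-polynomial in the `u_ij` is the supremum of its norms over all the models of `R`. -/
noncomputable def universalQ {N : ℕ} (R : MatRel N) : QMat.{0} N where
  A := univAlg R
  u := Matrix.of fun i j => ⟨bigMat R i j,
    StarSubalgebra.le_topologicalClosure _ (StarAlgebra.subset_adjoin ℂ _ ⟨(i, j), rfl⟩)⟩

/-! ### The quantum groups `O_N`, `O_N^*`, `O_N^+` -/

instance (N : ℕ) : CompactSpace (Matrix.orthogonalGroup (Fin N) ℝ) := by
  suffices h : IsCompact ((Matrix.orthogonalGroup (Fin N) ℝ :
      Submonoid (Matrix (Fin N) (Fin N) ℝ)) : Set (Matrix (Fin N) (Fin N) ℝ)) from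
    isCompact_iff_compactSpace.1 h
  have hb : ∀ g : Matrix (Fin N) (Fin N) ℝ, g ∈ Matrix.orthogonalGroup (Fin N) ℝ →
      ∀ i j, g i j ∈ Set.Icc (-1 : ℝ) 1 := by
    intro g hg i j
    have h := congrFun (congrFun (Matrix.mem_orthogonalGroup_iff (Fin N) ℝ |>.1 hg) i) i
    rw [Matrix.mul_apply, Matrix.one_apply_eq] at h
    have h2 : g i j * gᵀ j i ≤ ∑ k, g i k * gᵀ k i :=
      Finset.single_le_sum (f := fun k => g i k * gᵀ k i)
        (fun k _ => by simpa using mul_self_nonneg (g i k)) (Finset.mem_univ j)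
    rw [h, Matrix.transpose_apply] at h2
    exact abs_le.1 (abs_le_one_iff_mul_self_le_one.2 h2)
  have hc : IsCompact (Set.pi Set.univ fun _ : Fin N => Set.pi Set.univ
      fun _ : Fin N => Set.Icc (-1 : ℝ) 1) :=
    isCompact_univ_pi fun _ => isCompact_univ_pi fun _ => isCompact_Icc
  refine hc.of_isClosed_subset ?_ fun g hg i _ j _ => hb g hg i j
  have : ((Matrix.orthogonalGroup (Fin N) ℝ : Submonoid _) : Set (Matrix (Fin N) (Fin N) ℝ)) =
      {g | g * gᵀ = 1} := by
    ext g; exact Matrix.mem_orthogonalGroup_iff (Fin N) ℝ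
  rw [this]
  exact isClosed_eq (by fun_prop) continuous_const

/-- The orthogonal group `O_N`: the algebra `C(O_N)` with the coordinates `u_ij(g) = g_ij`. -/
noncomputable def qO (N : ℕ) : QMat.{0} N where
  A := C(Matrix.orthogonalGroup (Fin N) ℝ, ℂ)
  u := Matrix.of fun i j => ⟨fun g => ((g.1 i j : ℝ) : ℂ),
    Complex.continuous_ofReal.comp ((continuous_apply_apply i j).comp continuous_subtype_val)⟩

/-- The relations `u = ū`, `uᵗ = u⁻¹`. -/
def IsOrth {N : ℕ} {B : Type u} [CStarAlgebra B] (w : Matrix (Fin N) (Fin N) B) : Prop :=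
  (∀ i j, star (w i j) = w i j) ∧ w * wᵀ = 1 ∧ wᵀ * w = 1

/-- The half-commutation relations `abc = cba`, for the entries of a matrix (together with their
adjoints, which are the entries themselves in the orthogonal case). -/
def HalfCommutes {N : ℕ} {B : Type u} [CStarAlgebra B] (w : Matrix (Fin N) (Fin N) B) : Prop :=
  ∀ i₁ j₁ i₂ j₂ i₃ j₃, w i₁ j₁ * w i₂ j₂ * w i₃ j₃ = w i₃ j₃ * w i₂ j₂ * w i₁ j₁

/-- The free orthogonal quantum group `O_N^+`. -/
noncomputable def qOplus (N : ℕ) : QMat.{0} N := universalQ fun _ _ w => IsOrth w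

/-- The half-liberated orthogonal quantum group `O_N^*`. -/
noncomputable def qOstar (N : ℕ) : QMat.{0} N := universalQ fun _ _ w => IsOrth w ∧ HalfCommutes w

/-! ### Uniformity -/

/-- `w` and its conjugate `(w_{ij}^*)` are unitary. -/
def IsBiunitary {N : ℕ} {B : Type u} [CStarAlgebra B] (w : Matrix (Fin N) (Fin N) B) : Prop :=
  (w * wᴴ = 1 ∧ wᴴ * w = 1) ∧ (w.map star * wᵀ = 1 ∧ wᵀ * w.map star = 1)

/-- The matrix `diag(w, 1)`. -/
def diagOne {N : ℕ} {B : Type u} [CStarAlgebra B] (w : Matrix (Fin N) (Fin N) B) :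
    Matrix (Fin (N + 1)) (Fin (N + 1)) B :=
  Matrix.reindex finSumFinEquiv finSumFinEquiv
    (Matrix.fromBlocks w 0 0 (1 : Matrix (Fin 1) (Fin 1) B))

/-- The intersection `G ∩ U_N^+` for `G ⊂ U_{N+1}^+`, via the embedding `U_N^+ ⊂ U_{N+1}^+` given
by `u ↦ diag(u, 1)`: the universal `C*`-algebra generated by the entries of a biunitary `w` such
that `diag(w, 1)` satisfies all the `*`-polynomial relations between the coordinates of `G`. -/
noncomputable def interU {N : ℕ} (G : QMat.{u} (N + 1)) : QMat.{0} N :=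
  universalQ fun _ _ w => IsBiunitary w ∧
    ∀ p : StarPoly (N + 1), evalPoly G.u p = 0 → evalPoly (diagOne w) p = 0

/-- A family `G = (G_N)` is uniform when `G_{N-1} = G_N ∩ U_{N-1}^+` for all `N ≥ 2`. -/
def IsUniform (G : ∀ N : ℕ, QMat.{u} N) : Prop :=
  ∀ N : ℕ, 1 ≤ N → (G N).Same (interU (G (N + 1)))

end EasyQG

/-! The combinatorial half. Once a category of pairings contains the identity strings with arbitrary
colors, colors can be changed at will, and Frobenius rotation (`PairCat.rotate_iff`) leaves only a
pairing of the positions `0, …, p - 1` read clockwise. Capping neighboring positions that avoid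
chosen strings shrinks any pairing to a small one. A string joining positions of equal parity
shrinks to the crossing on 4 points (`PairCat.crossing_mem`). If all strings respect parity but two
of them cross, they shrink to the half-liberated crossing on 6 points (`PairCat.halfCrossing_mem`).
Conversely, semicircles generate the noncrossing pairings, and reversals of intervals of length 2 or
3 generate all pairings, respectively the parity-respecting ones (`PairCat.noncrossing_mem`,
`PairCat.mem_of_revPart_mem`). Hence there are only three possibilities, collected in
`eq_NC2_or_eq_P2star_or_eq_P2`.

The analytic half rests on an explicit model of `O_N^*`. For half-commuting orthogonal coordinates,
products of two coordinates commute, and a character of the algebra they generate sends `u_a u_b` to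
a rank one Gram matrix `v_a v̄_b` with `v` unitary. So the relations of `O_N^*` are exactly those of
the antidiagonal `2 × 2` matrices `halfMat v`, for `v ∈ U_N` (`evalPoly_qOstar_eq_zero`). An
intertwiner of `O_N^*` therefore intertwines the alternating words in `v` and `v̄`. As a fixed
vector, its legs may be sorted freely, which turns it into an operator commuting with all the
`v^{⊗h}`, and Schur-Weyl duality (`mem_span_permOp`) expresses it through permutations, that is,
through parity-respecting pairings (`Hom_qOstar`). Schur-Weyl duality follows from a
finite-dimensional double commutant theorem and from the density of `U_N` for polynomials. The same
models separate points, which yields the comultiplication, and the category axioms for `P2star` are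
read off from the intertwiners of `O_2^*` instead of being checked on partitions.

For the classification, if `O_N ⊂ G ⊂ O_N^+` is easy with `N ≥ 2`, the maps `T_π` intertwine `O_N`,
which forces `π` to be a pairing (`isPairing_of_intertwines`), so one of the three categories
occurs. A Tannakian argument, `QMat.IsQuantumGroup.sub_of_Hom_subset`, recovers inclusions of
quantum groups from inclusions of intertwiner spaces and settles `NC2` and `P2star`. For `P2` the
crossing makes the coordinates commute, and Gelfand duality gives `O_N`.

The remaining claims are witnessed concretely: `diag(i, 1, …)` shows `O_N^* ≠ O_N`, the Pauli
matrices show `O_N^* ≠ O_N^+`, and setting one coordinate to `1` in `abc = cba` yields `ab = ba`,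
which destroys uniformity. -/

namespace EasyQG

set_option linter.unusedSectionVars false

/-! ### Evaluation of `*`-polynomials and morphisms between coordinate algebras -/

section Eval

variable {N : ℕ} {C : Type*} [Ring C] [StarRing C] [Algebra ℂ C]

/-- Evaluation of `*`-polynomials on a matrix with entries in a `*`-algebra. -/
noncomputable def evalGen (y : Matrix (Fin N) (Fin N) C) : StarPoly N →ₐ[ℂ] C :=
  FreeAlgebra.lift ℂ fun p => if p.2.2 then star (y p.1 p.2.1) else y p.1 p.2.1

theorem evalPoly_eq_evalGen {B : Type*} [CStarAlgebra B] (w : Matrix (Fin N) (Fin N) B) :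
    evalPoly w = evalGen w := rfl

@[simp] theorem evalGen_ι (y : Matrix (Fin N) (Fin N) C) (p : Fin N × Fin N × Bool) :
    evalGen y (FreeAlgebra.ι ℂ p) = if p.2.2 then star (y p.1 p.2.1) else y p.1 p.2.1 := by
  simp [evalGen]

theorem evalGen_algHom {C' : Type*} [Ring C'] [StarRing C'] [Algebra ℂ C'] (φ : C →ₐ[ℂ] C')
    (y : Matrix (Fin N) (Fin N) C) (y' : Matrix (Fin N) (Fin N) C')
    (h : ∀ i j, φ (y i j) = y' i j) (h' : ∀ i j, φ (star (y i j)) = star (y' i j))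
    (p : StarPoly N) : φ (evalGen y p) = evalGen y' p := by
  have : φ.comp (evalGen y) = evalGen y' := by
    apply FreeAlgebra.hom_ext
    funext q
    simp only [Function.comp, AlgHom.comp_apply, evalGen_ι]
    split_ifs <;> simp [h, h']
  exact DFunLike.congr_fun this p

theorem evalGen_starAlgHom {C' : Type*} [Ring C'] [StarRing C'] [Algebra ℂ C'] (φ : C →⋆ₐ[ℂ] C')
    (y : Matrix (Fin N) (Fin N) C) (p : StarPoly N) :
    φ (evalGen y p) = evalGen (Matrix.of fun i j => φ (y i j)) p :=
  evalGen_algHom φ.toAlgHom y _ (fun _ _ => rfl) (fun i j => map_star φ (y i j)) p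

end Eval

namespace QMat

variable {N : ℕ}

/-- The matrix of coordinates, with entries in the coordinate algebra. -/
def X (G : QMat.{u} N) : Matrix (Fin N) (Fin N) G.coordAlg := Matrix.of G.x

theorem coe_evalGen_X (G : QMat.{u} N) (p : StarPoly N) :
    ((evalGen G.X p : G.coordAlg) : G.A) = evalPoly G.u p :=
  evalGen_algHom G.coordAlg.subtype.toAlgHom G.X G.u (fun _ _ => rfl) (fun _ _ => rfl) p

theorem evalGen_X_eq_zero (G : QMat.{u} N) (p : StarPoly N) :
    evalGen G.X p = 0 ↔ evalPoly G.u p = 0 := by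
  rw [← coe_evalGen_X, ZeroMemClass.coe_eq_zero]

theorem evalGen_X_surjective (G : QMat.{u} N) : Function.Surjective (evalGen G.X) := by
  intro a
  have key : ∀ b ∈ G.coordAlg, ∃ p, evalPoly G.u p = b := by
    intro b hb
    have h1 : (G.coordAlg).toSubalgebra ≤ (evalPoly G.u).range := by
      rw [coordAlg, StarAlgebra.adjoin_toSubalgebra]
      refine Algebra.adjoin_le ?_
      rintro _ (⟨⟨i, j⟩, rfl⟩ | h)
      · exact ⟨FreeAlgebra.ι ℂ (i, j, false), by simp [evalPoly_eq_evalGen]⟩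
      · obtain ⟨⟨i, j⟩, h⟩ := h
        refine ⟨FreeAlgebra.ι ℂ (i, j, true), ?_⟩
        simp only at h
        simp [evalPoly_eq_evalGen, h]
    exact h1 hb
  obtain ⟨p, hp⟩ := key a a.2
  exact ⟨p, Subtype.ext (by rw [coe_evalGen_X, hp])⟩

/-- Universal property of the coordinate algebra: matrices satisfying all the relations between
the coordinates define morphisms. -/
theorem exists_lift (G : QMat.{u} N) {C : Type*} [Ring C] [StarRing C] [Algebra ℂ C]
    [StarModule ℂ C] (y : Matrix (Fin N) (Fin N) C)
    (h : ∀ p, evalPoly G.u p = 0 → evalGen y p = 0) :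
    ∃ Φ : G.coordAlg →⋆ₐ[ℂ] C, ∀ i j, Φ (G.x i j) = y i j := by
  let s : G.coordAlg → StarPoly N := Function.surjInv G.evalGen_X_surjective
  have hs : ∀ a, evalGen G.X (s a) = a := Function.surjInv_eq _
  -- Equality in the coordinate algebra implies equality after evaluation at `y`, so the arbitrary
  -- section `s` gives a well defined map, and each algebra law reduces to one instance of this.
  have hdet : ∀ p q, evalGen G.X p = evalGen G.X q → evalGen y p = evalGen y q := by
    intro p q hpq
    have := h (p - q) (by rw [← evalGen_X_eq_zero, map_sub, hpq, sub_self])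
    rwa [map_sub, sub_eq_zero] at this
  let Φ : G.coordAlg →ₐ[ℂ] C :=
    { toFun := fun a => evalGen y (s a)
      map_one' := by
        simpa using hdet (s 1) 1 (by simp [hs])
      map_mul' := fun a b => by
        simpa using hdet (s (a * b)) (s a * s b) (by simp [hs])
      map_zero' := by
        simpa using hdet (s 0) 0 (by simp [hs])
      map_add' := fun a b => by
        simpa using hdet (s (a + b)) (s a + s b) (by simp [hs])
      commutes' := fun r => by
        simpa using hdet (s (algebraMap _ _ r)) (algebraMap _ _ r)
          (by rw [hs, AlgHom.commutes]) }
  have hΦ : ∀ p, Φ (evalGen G.X p) = evalGen y p := fun p => hdet _ _ (hs _)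
  have hx : ∀ i j, Φ (G.x i j) = y i j := fun i j => by
    simpa [X] using hΦ (FreeAlgebra.ι ℂ (i, j, false))
  have hx' : ∀ i j, Φ (star (G.x i j)) = star (y i j) := fun i j => by
    simpa [X] using hΦ (FreeAlgebra.ι ℂ (i, j, true))
  have hstar : ∀ (a : G.A) (ha : a ∈ G.coordAlg),
      Φ (star ⟨a, ha⟩) = star (Φ ⟨a, ha⟩) := by
    intro a ha
    induction ha using StarAlgebra.adjoin_induction with
    | mem a h =>
      obtain ⟨⟨i, j⟩, rfl⟩ := h
      exact (hx' i j).trans (congrArg star (hx i j)).symm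
    | algebraMap r =>
      have : (⟨algebraMap ℂ G.A r, StarSubalgebra.algebraMap_mem _ r⟩ : G.coordAlg)
        = algebraMap ℂ G.coordAlg r := rfl
      rw [this, ← algebraMap_star_comm, AlgHom.commutes, AlgHom.commutes, algebraMap_star_comm]
    | add a b ha hb iha ihb =>
      have : (⟨a + b, add_mem ha hb⟩ : G.coordAlg) = ⟨a, ha⟩ + ⟨b, hb⟩ := rfl
      rw [this, star_add, map_add, map_add, star_add, iha, ihb]
    | mul a b ha hb iha ihb =>
      have : (⟨a * b, mul_mem ha hb⟩ : G.coordAlg) = ⟨a, ha⟩ * ⟨b, hb⟩ := rfl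
      rw [this, star_mul, map_mul, map_mul, star_mul, iha, ihb]
    | star a ha iha =>
      have : (⟨star a, star_mem ha⟩ : G.coordAlg) = star ⟨a, ha⟩ := rfl
      rw [this, iha, star_star, star_star]
  exact ⟨{ Φ with map_star' := fun a => hstar a.1 a.2 }, hx⟩

theorem starAlgHom_ext {G : QMat.{u} N} {C : Type*} [Ring C] [StarRing C] [Algebra ℂ C]
    {Φ Ψ : G.coordAlg →⋆ₐ[ℂ] C} (h : ∀ i j, Φ (G.x i j) = Ψ (G.x i j)) : Φ = Ψ := by
  ext a
  obtain ⟨p, rfl⟩ := G.evalGen_X_surjective a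
  rw [evalGen_starAlgHom, evalGen_starAlgHom]
  congr 2
  ext i j
  exact h i j

/-- Inclusions become reverse inclusions of ideals of relations: a morphism transports relations,
and conversely `exists_lift` builds the morphism. All comparisons below are made at this level. -/
theorem sub_iff {G : QMat.{u} N} {H : QMat.{v} N} :
    G.Sub H ↔ ∀ p, evalPoly H.u p = 0 → evalPoly G.u p = 0 := by
  constructor
  · rintro ⟨Φ, hΦ⟩ p hp
    rw [← evalGen_X_eq_zero] at hp ⊢
    have := evalGen_starAlgHom Φ H.X p
    rw [hp, map_zero] at this
    rw [this]
    congr 2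
    ext i j
    exact congrArg Subtype.val (hΦ i j).symm
  · intro h
    exact H.exists_lift G.X fun p hp => (evalGen_X_eq_zero G p).2 (h p hp)

theorem same_of_sub_of_sub {G : QMat.{u} N} {H : QMat.{v} N} (h₁ : G.Sub H) (h₂ : H.Sub G) :
    G.Same H := by
  obtain ⟨Φ, hΦ⟩ := h₁
  obtain ⟨Ψ, hΨ⟩ := h₂
  have h1 : Φ.comp Ψ = StarAlgHom.id ℂ _ := starAlgHom_ext fun i j => by simp [hΨ, hΦ]
  have h2 : Ψ.comp Φ = StarAlgHom.id ℂ _ := starAlgHom_ext fun i j => by simp [hΨ, hΦ]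
  exact ⟨StarAlgEquiv.ofStarAlgHom Ψ Φ h1 h2, hΨ⟩

theorem Same.sub {G : QMat.{u} N} {H : QMat.{v} N} (h : G.Same H) : G.Sub H := by
  obtain ⟨Φ, hΦ⟩ := h
  exact ⟨(Φ.symm : H.coordAlg →⋆ₐ[ℂ] G.coordAlg), fun i j => by simp [← hΦ]⟩

theorem Same.sub' {G : QMat.{u} N} {H : QMat.{v} N} (h : G.Same H) : H.Sub G := by
  obtain ⟨Φ, hΦ⟩ := h
  exact ⟨(Φ : G.coordAlg →⋆ₐ[ℂ] H.coordAlg), hΦ⟩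

/-! ### Intertwiners and `*`-polynomials -/

/-- The `*`-polynomial giving the entries of `u^{⊗k}`. -/
noncomputable def wordPoly {m : ℕ} (k : Word m) (I J : Fin m → Fin N) : StarPoly N :=
  (List.ofFn fun a => FreeAlgebra.ι ℂ (I a, J a, k a)).prod

theorem evalGen_wordPoly {C : Type*} [Ring C] [StarRing C] [Algebra ℂ C]
    (y : Matrix (Fin N) (Fin N) C) {m : ℕ} (k : Word m) (I J : Fin m → Fin N) :
    evalGen y (wordPoly k I J) =
      (List.ofFn fun a => if k a then star (y (I a) (J a)) else y (I a) (J a)).prod := by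
  rw [wordPoly, map_list_prod, List.map_ofFn]
  congr 2
  funext a
  simp

theorem evalPoly_wordPoly (G : QMat.{u} N) {m : ℕ} (k : Word m) (I J : Fin m → Fin N) :
    evalPoly G.u (wordPoly k I J) = G.tensorPow k I J := by
  rw [evalPoly_eq_evalGen, evalGen_wordPoly]; rfl

/-- The `*`-polynomials whose vanishing expresses that `T` is an intertwiner. -/
noncomputable def homPoly {m n : ℕ} (k : Word m) (l : Word n)
    (T : Matrix (Fin n → Fin N) (Fin m → Fin N) ℂ) (J : Fin n → Fin N) (I : Fin m → Fin N) :
    StarPoly N :=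
  ∑ I', T J I' • wordPoly k I' I - ∑ J', T J' I • wordPoly l J J'

/-- This makes the intertwiner spaces depend only on the relations between the coordinates, hence
monotone under `Sub`. -/
theorem mem_Hom_iff (G : QMat.{u} N) {m n : ℕ} (k : Word m) (l : Word n)
    (T : Matrix (Fin n → Fin N) (Fin m → Fin N) ℂ) :
    T ∈ G.Hom k l ↔ ∀ J I, evalPoly G.u (homPoly k l T J I) = 0 := by
  rw [Hom, Set.mem_ofPred_eq, ← Matrix.ext_iff]
  refine forall₂_congr fun J I => ?_
  have h : evalPoly G.u (homPoly k l T J I) = ∑ I', algebraMap ℂ G.A (T J I') * G.tensorPow k I' I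
      - ∑ J', G.tensorPow l J J' * algebraMap ℂ G.A (T J' I) := by
    simp only [homPoly, map_sub, map_sum, map_smul, evalPoly_wordPoly, ← Algebra.commutes,
      Algebra.smul_def (A := G.A)]
  rw [h, sub_eq_zero, Matrix.mul_apply, Matrix.mul_apply]
  rfl

theorem Sub.Hom_subset {G : QMat.{u} N} {H : QMat.{v} N} (h : G.Sub H) {m n : ℕ} (k : Word m)
    (l : Word n) : H.Hom k l ⊆ G.Hom k l := fun T hT => by
  rw [mem_Hom_iff] at hT ⊢
  exact fun J I => sub_iff.1 h _ (hT J I)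

end QMat

/-! ### Universal algebras -/

section Universal

variable {N : ℕ} {R : MatRel N}

/-- The inclusion of the universal algebra in the product of all the models. -/
noncomputable def univIncl (R : MatRel N) : (universalQ R).A →⋆ₐ[ℂ] BigProd R :=
  (univAlg R).subtype

theorem univIncl_injective : Function.Injective (univIncl R) := Subtype.val_injective

theorem univIncl_evalPoly (p : StarPoly N) :
    univIncl R (evalPoly (universalQ R).u p) = evalPoly (bigMat R) p :=
  evalGen_algHom (univIncl R).toAlgHom _ _ (fun _ _ => rfl) (fun _ _ => rfl) p

theorem bigProd_evalPoly_apply (p : StarPoly N) (s : SeminormIdx R) :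
    (evalPoly (bigMat R) p : BigProd R) s = evalPoly s.model.w p := by
  let φ : BigProd R →ₐ[ℂ] s.model.B :=
    { toFun := fun f => f s
      map_one' := rfl
      map_mul' := fun _ _ => rfl
      map_zero' := rfl
      map_add' := fun _ _ => rfl
      commutes' := fun _ => rfl }
  exact evalGen_algHom φ _ _ (fun _ _ => rfl) (fun _ _ => rfl) p

/-- Keeping one model per seminorm loses nothing: the model chosen for the seminorm of `M` kills the
same polynomials as `M`. -/
theorem evalPoly_universalQ_eq_zero (p : StarPoly N) :
    evalPoly (universalQ R).u p = 0 ↔ ∀ M : Model R, evalPoly M.w p = 0 := by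
  have h0 : evalPoly (universalQ R).u p = 0 ↔ evalPoly (bigMat R) p = 0 := by
    rw [← univIncl_evalPoly, map_eq_zero_iff _ univIncl_injective]
  rw [h0]
  constructor
  · intro h M
    let s : SeminormIdx R := ⟨fun p => ‖evalPoly M.w p‖, M, fun _ => rfl⟩
    have h1 : ∀ p, ‖evalPoly M.w p‖ = ‖evalPoly s.model.w p‖ := s.2.choose_spec
    rw [← norm_eq_zero, h1, ← bigProd_evalPoly_apply, h]
    simp
  · intro h
    apply lp.ext
    funext s
    rw [bigProd_evalPoly_apply, h]
    rfl

theorem universalQ_dense : Dense ((universalQ R).coordAlg : Set (universalQ R).A) := by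
  have h2 : Topology.IsInducing (univIncl R) := ⟨rfl⟩
  intro a
  rw [h2.closure_eq_preimage_closure_image, Set.mem_preimage]
  have h3 : StarAlgebra.adjoin ℂ (Set.range fun p : Fin N × Fin N => bigMat R p.1 p.2) ≤
      (StarSubalgebra.map (univIncl R) (universalQ R).coordAlg) := by
    rw [StarAlgebra.adjoin_le_iff]
    rintro _ ⟨⟨i, j⟩, rfl⟩
    exact ⟨(universalQ R).u i j, StarAlgebra.subset_adjoin ℂ _ ⟨(i, j), rfl⟩, rfl⟩
  exact closure_mono (fun x hx => h3 hx) a.2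

end Universal

/-! ### The linear maps associated to partitions -/

theorem setoid_map_le_iff {α β : Type*} {r : Setoid α} {f : α → β} {s : Setoid β} :
    r.map f ≤ s ↔ r ≤ s.comap f := by
  constructor
  · exact fun h a b hab => h (Relation.EqvGen.rel _ _ ⟨a, b, hab, rfl, rfl⟩)
  · intro h
    refine Setoid.eqvGen_le ?_
    rintro x y ⟨a, b, hab, rfl, rfl⟩
    exact h hab

theorem setoid_map_rel {α β : Type*} {r : Setoid α} (f : α → β) {a b : α} (h : r a b) :
    r.map f (f a) (f b) :=
  Relation.EqvGen.rel _ _ ⟨a, b, h, rfl, rfl⟩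

open Classical in
theorem Tmap_apply (N : ℕ) {m n : ℕ} (π : Part m n) (J : Fin n → Fin N) (I : Fin m → Fin N) :
    Tmap N π J I = if π ≤ Setoid.ker (Sum.elim I J) then 1 else 0 := by
  have : (π ≤ Setoid.ker (Sum.elim I J)) ↔
      ∀ a b, π a b → Sum.elim I J a = Sum.elim I J b := ⟨fun h a b => @h a b, fun h a b => h a b⟩
  simp [Tmap, this]

theorem tensor_le_ker_iff {N m n m' n' : ℕ} (π : Part m n) (σ : Part m' n')
    (I : Fin (m + m') → Fin N) (J : Fin (n + n') → Fin N) :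
    π.tensor σ ≤ Setoid.ker (Sum.elim I J) ↔
      π ≤ Setoid.ker (Sum.elim (I ∘ Fin.castAdd m') (J ∘ Fin.castAdd n')) ∧
      σ ≤ Setoid.ker (Sum.elim (I ∘ Fin.natAdd m) (J ∘ Fin.natAdd n)) := by
  rw [Part.tensor, sup_le_iff, setoid_map_le_iff, setoid_map_le_iff]
  have h1 : ∀ {a b : ℕ} (f : Fin a → Fin (m + m')) (g : Fin b → Fin (n + n')),
      (Setoid.ker (Sum.elim I J)).comap (Sum.map f g) = Setoid.ker (Sum.elim (I ∘ f) (J ∘ g)) := by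
    intro a b f g
    rw [← Sum.elim_comp_map]
    rfl
  rw [h1, h1]

theorem Tmap_tensor (N : ℕ) {m n m' n' : ℕ} (π : Part m n) (σ : Part m' n')
    (J : Fin (n + n') → Fin N) (I : Fin (m + m') → Fin N) :
    Tmap N (π.tensor σ) J I =
      Tmap N π (J ∘ Fin.castAdd n') (I ∘ Fin.castAdd m') *
        Tmap N σ (J ∘ Fin.natAdd n) (I ∘ Fin.natAdd m) := by
  classical
  simp only [Tmap_apply, tensor_le_ker_iff]
  split_ifs <;> simp_all

theorem Tmap_flip (N : ℕ) {m n : ℕ} (π : Part m n) : Tmap N π.flip = (Tmap N π)ᴴ := by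
  classical
  ext I J
  have h : π.flip ≤ Setoid.ker (Sum.elim J I) ↔ π ≤ Setoid.ker (Sum.elim I J) := by
    constructor
    · intro h a b hab
      have := @h a.swap b.swap (by simpa [Setoid.comap_rel] using hab)
      rcases a with a | a <;> rcases b with b | b <;> simpa [Setoid.ker_def] using this
    · intro h a b hab
      have := h hab
      rcases a with a | a <;> rcases b with b | b <;> simpa [Setoid.ker_def] using this
  simp only [Tmap_apply, Matrix.conjTranspose_apply, h]
  split_ifs <;> simp

theorem Tmap_idPart (N m : ℕ) : Tmap N (Part.idPart m) = 1 := by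
  classical
  ext J I
  have h : Part.idPart m ≤ Setoid.ker (Sum.elim I J) ↔ J = I := by
    constructor
    · intro h
      funext i
      exact (@h (Sum.inl i) (Sum.inr i) rfl).symm
    · rintro rfl a b hab
      rcases a with a | a <;> rcases b with b | b <;> simp_all [Setoid.ker_def]
  simp only [Tmap_apply, h, Matrix.one_apply]

/-- The number of labelings of the classes of a partition which extend a given admissible labeling
of some points does not depend on that labeling. -/
theorem card_extensions {Z Y : Type*} {ν : Type*} (s : Setoid Z) (f : Y → Z) (i₀ : ν)
    (L₀ : Y → ν) (h₀ : s.comap f ≤ Setoid.ker L₀) :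
    Nonempty ({L : Z → ν // s ≤ Setoid.ker L ∧ L ∘ f = L₀} ≃
      {L : Z → ν // s ≤ Setoid.ker L ∧ L ∘ f = fun _ => i₀}) := by
  classical
  -- The classes meeting the image of `f` are the ones whose label is forced. The bijection relabels
  -- these classes and leaves the other ones untouched.
  let P : Z → Prop := fun z => ∃ y, s z (f y)
  have hP : ∀ {z z'}, s z z' → (P z ↔ P z') := fun {z z'} h =>
    ⟨fun ⟨y, hy⟩ => ⟨y, s.trans' (s.symm' h) hy⟩, fun ⟨y, hy⟩ => ⟨y, s.trans' h hy⟩⟩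
  have hPf : ∀ y, P (f y) := fun y => ⟨y, s.refl' _⟩
  let L₁ : Z → ν := fun z => if h : P z then L₀ h.choose else i₀
  have hL₁ : s ≤ Setoid.ker L₁ := by
    intro z z' h
    rw [Setoid.ker_def]
    by_cases hz : P z
    · have hz' := (hP h).1 hz
      simp only [L₁, hz, hz', dif_pos]
      exact h₀ (s.trans' (s.symm' hz.choose_spec) (s.trans' h hz'.choose_spec))
    · have hz' : ¬ P z' := fun h' => hz ((hP h).2 h')
      simp only [L₁, hz, hz', dif_neg, not_false_eq_true]
  have hL₁f : ∀ y, L₁ (f y) = L₀ y := by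
    intro y
    simp only [L₁, hPf, dif_pos]
    exact h₀ (s.symm' (hPf y).choose_spec)
  have key : ∀ (A L : Z → ν), s ≤ Setoid.ker A → s ≤ Setoid.ker L →
      s ≤ Setoid.ker (fun z => if P z then A z else L z) := by
    intro A L hA hL z z' h
    have e1 : A z = A z' := hA h
    have e2 : L z = L z' := hL h
    simp only [Setoid.ker_def, hP h, e1, e2]
  refine ⟨⟨fun L => ⟨fun z => if P z then i₀ else L.1 z, key _ _ (fun _ _ _ => rfl) L.2.1, ?_⟩,
    fun L => ⟨fun z => if P z then L₁ z else L.1 z, key _ _ hL₁ L.2.1, ?_⟩, ?_, ?_⟩⟩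
  · funext y; simp [hPf]
  · funext y; simp [hPf, hL₁f]
  · rintro ⟨L, hL, hLf⟩
    apply Subtype.ext
    funext z
    by_cases hz : P z
    · obtain ⟨y, hy⟩ := id hz
      have e1 : L₁ z = L₁ (f y) := hL₁ hy
      have e2 : L z = L (f y) := hL hy
      simp only [hz, if_true]
      rw [e1, e2, hL₁f, ← hLf]; rfl
    · simp [hz]
  · rintro ⟨L, hL, hLf⟩
    apply Subtype.ext
    funext z
    by_cases hz : P z
    · obtain ⟨y, hy⟩ := id hz
      have e2 : L z = L (f y) := hL hy
      simp only [hz, if_true]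
      rw [e2]; exact (congrFun hLf y).symm
    · simp [hz]

/-- An entry of the product counts the labelings of the middle row compatible with the outer ones.
By `card_extensions` this count is the same for all admissible outer labels; it is nonzero because
constant labelings exist when `N > 0`. -/
theorem Tmap_comp {N : ℕ} (hN : 0 < N) {m n p : ℕ} (π : Part m n) (σ : Part n p) :
    ∃ c : ℂ, c ≠ 0 ∧ Tmap N σ * Tmap N π = c • Tmap N (π.comp σ) := by
  classical
  let s : Setoid (Fin m ⊕ (Fin n ⊕ Fin p)) :=
    Setoid.map π (Sum.map id Sum.inl) ⊔ Setoid.map σ Sum.inr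
  let f : Fin m ⊕ Fin p → Fin m ⊕ (Fin n ⊕ Fin p) := Sum.map id Sum.inr
  let i₀ : Fin N := ⟨0, hN⟩
  let S : (Fin m ⊕ Fin p → Fin N) → Type := fun L₀ =>
    {L : Fin m ⊕ (Fin n ⊕ Fin p) → Fin N // s ≤ Setoid.ker L ∧ L ∘ f = L₀}
  have hentry : ∀ K I, (Tmap N σ * Tmap N π) K I = (Nat.card (S (Sum.elim I K)) : ℂ) := by
    intro K I
    have h1 : ∀ J : Fin n → Fin N, Tmap N σ K J * Tmap N π J I =
        if s ≤ Setoid.ker (Sum.elim I (Sum.elim J K)) then 1 else 0 := by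
      intro J
      have : s ≤ Setoid.ker (Sum.elim I (Sum.elim J K)) ↔
          π ≤ Setoid.ker (Sum.elim I J) ∧ σ ≤ Setoid.ker (Sum.elim J K) := by
        rw [sup_le_iff, setoid_map_le_iff, setoid_map_le_iff]
        have e1 : (Setoid.ker (Sum.elim I (Sum.elim J K))).comap (Sum.map id Sum.inl) =
            Setoid.ker (Sum.elim I J) := by
          change Setoid.ker (Sum.elim I (Sum.elim J K) ∘ Sum.map id Sum.inl) = _
          rw [Sum.elim_comp_map, Sum.elim_comp_inl, Function.comp_id]
        have e2 : (Setoid.ker (Sum.elim I (Sum.elim J K))).comap Sum.inr =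
            Setoid.ker (Sum.elim J K) := rfl
        rw [e1, e2]
      rw [Tmap_apply, Tmap_apply]
      simp only [this]
      split_ifs <;> simp_all
    rw [Matrix.mul_apply, Finset.sum_congr rfl fun J _ => h1 J, Finset.sum_boole,
      ← Fintype.card_subtype, ← Nat.card_eq_fintype_card]
    congr 1
    refine Nat.card_congr ⟨fun J => ⟨Sum.elim I (Sum.elim J.1 K), J.2, ?_⟩,
      fun L => ⟨fun j => L.1 (Sum.inr (Sum.inl j)), ?_⟩, fun J => rfl, ?_⟩
    · rw [Sum.elim_comp_map]; rfl
    · have : Sum.elim I (Sum.elim (fun j => L.1 (Sum.inr (Sum.inl j))) K) = L.1 := by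
        funext z
        rcases z with i | j | k
        · exact (congrFun L.2.2 (Sum.inl i)).symm
        · rfl
        · exact (congrFun L.2.2 (Sum.inr k)).symm
      rw [this]; exact L.2.1
    · intro L
      apply Subtype.ext
      funext z
      rcases z with i | j | k
      · exact (congrFun L.2.2 (Sum.inl i)).symm
      · rfl
      · exact (congrFun L.2.2 (Sum.inr k)).symm
  refine ⟨Nat.card (S fun _ => i₀), ?_, ?_⟩
  · rw [Nat.cast_ne_zero]
    have : Nonempty (S fun _ => i₀) := ⟨⟨fun _ => i₀, fun _ _ _ => rfl, rfl⟩⟩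
    have : Finite (S fun _ => i₀) := Subtype.finite
    exact Nat.card_pos.ne'
  · ext K I
    rw [hentry, Matrix.smul_apply, Tmap_apply]
    by_cases h : π.comp σ ≤ Setoid.ker (Sum.elim I K)
    · obtain ⟨e⟩ := card_extensions s f i₀ (Sum.elim I K) h
      rw [if_pos h, smul_eq_mul, mul_one, Nat.card_congr e]
    · have : IsEmpty (S (Sum.elim I K)) := ⟨fun L => h fun a b hab => by
        rw [← L.2.2]; exact L.2.1 hab⟩
      rw [if_neg h, Nat.card_of_isEmpty]
      simp

/-! ### The category of partitions of a biunitary matrix -/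

namespace QMat

variable {N : ℕ}

theorem tensorPow_append (G : QMat.{u} N) {m m' : ℕ} (k : Word m) (k' : Word m')
    (I J : Fin (m + m') → Fin N) :
    G.tensorPow (Fin.append k k') I J =
      G.tensorPow k (I ∘ Fin.castAdd m') (J ∘ Fin.castAdd m') *
        G.tensorPow k' (I ∘ Fin.natAdd m) (J ∘ Fin.natAdd m) := by
  simp only [tensorPow, Matrix.of_apply]
  rw [← List.prod_append, ← List.ofFn_fin_append]
  congr 2
  funext a
  refine Fin.addCases (fun a => ?_) (fun a => ?_) a <;> simp

/-- The matrix `u` or its conjugate, according to the color. -/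
def letter (G : QMat.{u} N) (c : Bool) : Matrix (Fin N) (Fin N) G.A :=
  Matrix.of fun i j => if c then star (G.u i j) else G.u i j

theorem tensorPow_cons (G : QMat.{u} N) {m : ℕ} (k : Word (m + 1)) (i j : Fin N)
    (I J : Fin m → Fin N) :
    G.tensorPow k (Fin.cons i I) (Fin.cons j J) =
      G.letter (k 0) i j * G.tensorPow (Fin.tail k) I J := by
  simp only [tensorPow, letter, List.ofFn_succ, Fin.tail, Matrix.of_apply, List.prod_cons,
    Fin.cons_zero, Fin.cons_succ]
  rfl

theorem letter_unitary {G : QMat.{u} N} (hG : IsBiunitary G.u) (c : Bool) :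
    G.letter c * (G.letter c)ᴴ = 1 ∧ (G.letter c)ᴴ * G.letter c = 1 := by
  cases c
  · exact hG.1
  · have h : G.letter true = G.u.map star := by ext; simp [letter]
    have h' : (G.u.map star)ᴴ = G.uᵀ := by ext; simp
    rw [h, h']
    exact hG.2

theorem tensorPow_unitary {G : QMat.{u} N} (hG : IsBiunitary G.u) {m : ℕ} (k : Word m) :
    G.tensorPow k * (G.tensorPow k)ᴴ = 1 ∧ (G.tensorPow k)ᴴ * G.tensorPow k = 1 := by
  induction m with
  | zero =>
    constructor <;> ext I J <;> rw [Subsingleton.elim I J] <;>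
      simp [tensorPow, Matrix.mul_apply]
  | succ m ih =>
    obtain ⟨h1, h2⟩ := ih (Fin.tail k)
    obtain ⟨l1, l2⟩ := letter_unitary hG (k 0)
    rw [← Matrix.ext_iff] at h1 h2 l1 l2
    simp only [Matrix.mul_apply, Matrix.conjTranspose_apply] at h1 h2 l1 l2
    have hone : ∀ (i j : Fin N) (I J : Fin m → Fin N), 
        (1 : Matrix (Fin (m + 1) → Fin N) (Fin (m + 1) → Fin N) G.A)
          (Fin.cons i I) (Fin.cons j J) =
          (1 : Matrix (Fin N) (Fin N) G.A) i j * (1 : Matrix (Fin m → Fin N) _ G.A) I J := by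
      intro i j I J
      simp only [Matrix.one_apply, Fin.cons_inj]
      split_ifs <;> simp_all
    have hsum : ∀ F : (Fin (m + 1) → Fin N) → G.A,
        ∑ K, F K = ∑ i, ∑ K', F (Fin.cons i K') := by
      intro F
      rw [← Fintype.sum_prod_type']
      exact (Fintype.sum_equiv (Fin.consEquiv fun _ => Fin N) _ _ fun x => rfl).symm
    constructor
    · ext I J
      obtain ⟨i, I, rfl⟩ : ∃ i I', I = Fin.cons i I' := ⟨I 0, Fin.tail I, (Fin.cons_self_tail I).symm⟩
      obtain ⟨j, J, rfl⟩ : ∃ i I', J = Fin.cons i I' := ⟨J 0, Fin.tail J, (Fin.cons_self_tail J).symm⟩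
      rw [hone, Matrix.mul_apply, hsum, ← l1, ← h1]
      simp only [Matrix.conjTranspose_apply, tensorPow_cons, star_mul]
      rw [Finset.sum_mul]
      refine Finset.sum_congr rfl fun a _ => ?_
      trans G.letter (k 0) i a * (∑ K', G.tensorPow (Fin.tail k) I K' *
        star (G.tensorPow (Fin.tail k) J K')) * star (G.letter (k 0) j a)
      · rw [Finset.mul_sum, Finset.sum_mul]
        simp only [mul_assoc]
      · rw [h1, Matrix.one_apply]
        split_ifs <;> simp
    · ext I J
      obtain ⟨i, I, rfl⟩ : ∃ i I', I = Fin.cons i I' := ⟨I 0, Fin.tail I, (Fin.cons_self_tail I).symm⟩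
      obtain ⟨j, J, rfl⟩ : ∃ i I', J = Fin.cons i I' := ⟨J 0, Fin.tail J, (Fin.cons_self_tail J).symm⟩
      -- With the adjoint on the left, the first letters are innermost, so their index must be
      -- summed first; in the other product it is the tail that is innermost.
      rw [hone, Matrix.mul_apply, hsum, Finset.sum_comm]
      simp only [Matrix.conjTranspose_apply, tensorPow_cons, star_mul]
      trans ∑ K', star (G.tensorPow (Fin.tail k) K' I) * (∑ a, star (G.letter (k 0) a i) *
        G.letter (k 0) a j) * G.tensorPow (Fin.tail k) K' J
      · refine Finset.sum_congr rfl fun a _ => ?_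
        rw [Finset.mul_sum, Finset.sum_mul]
        simp only [mul_assoc]
      · rw [l2, ← h2, Finset.mul_sum]
        refine Finset.sum_congr rfl fun a _ => ?_
        rw [Matrix.one_apply]
        split_ifs <;> simp

/-- The collection of all the partitions `π` such that `T_π` is an intertwiner. -/
def homFam (G : QMat.{u} N) : PartFamily := fun _ _ k l => {π | Tmap N π ∈ G.Hom k l}

theorem mem_Hom {G : QMat.{u} N} {m n : ℕ} {k : Word m} {l : Word n}
    {T : Matrix (Fin n → Fin N) (Fin m → Fin N) ℂ} : T ∈ G.Hom k l ↔
      T.map (algebraMap ℂ G.A) * G.tensorPow k = G.tensorPow l * T.map (algebraMap ℂ G.A) :=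
  Iff.rfl

theorem mem_Hom_entry {G : QMat.{u} N} {m n : ℕ} {k : Word m} {l : Word n}
    {T : Matrix (Fin n → Fin N) (Fin m → Fin N) ℂ} : T ∈ G.Hom k l ↔
      ∀ J I, ∑ I', algebraMap ℂ G.A (T J I') * G.tensorPow k I' I =
        ∑ J', G.tensorPow l J J' * algebraMap ℂ G.A (T J' I) := by
  rw [mem_Hom, ← Matrix.ext_iff]
  rfl

theorem Hom_mul {G : QMat.{u} N} {m n p : ℕ} {k : Word m} {l : Word n} {r : Word p}
    {T : Matrix (Fin n → Fin N) (Fin m → Fin N) ℂ} {S : Matrix (Fin p → Fin N) (Fin n → Fin N) ℂ}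
    (hT : T ∈ G.Hom k l) (hS : S ∈ G.Hom l r) : S * T ∈ G.Hom k r := by
  rw [mem_Hom] at *
  rw [Matrix.map_mul, Matrix.mul_assoc, hT, ← Matrix.mul_assoc, hS, Matrix.mul_assoc]

theorem Hom_smul {G : QMat.{u} N} {m n : ℕ} {k : Word m} {l : Word n}
    {T : Matrix (Fin n → Fin N) (Fin m → Fin N) ℂ} (c : ℂ)
    (hT : T ∈ G.Hom k l) : c • T ∈ G.Hom k l := by
  rw [mem_Hom] at *
  have : (c • T).map (algebraMap ℂ G.A) = c • T.map (algebraMap ℂ G.A) := by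
    ext; simp [Algebra.smul_def]
  rw [this, Matrix.smul_mul, hT, Matrix.mul_smul]

theorem Hom_add {G : QMat.{u} N} {m n : ℕ} {k : Word m} {l : Word n}
    {T S : Matrix (Fin n → Fin N) (Fin m → Fin N) ℂ}
    (hT : T ∈ G.Hom k l) (hS : S ∈ G.Hom k l) : T + S ∈ G.Hom k l := by
  rw [mem_Hom] at *
  have : (T + S).map (algebraMap ℂ G.A) = T.map (algebraMap ℂ G.A) + S.map (algebraMap ℂ G.A) := by
    ext; simp
  rw [this, Matrix.add_mul, hT, hS, Matrix.mul_add]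

theorem span_Tmap_subset_Hom {G : QMat.{u} N} {m n : ℕ} {k : Word m} {l : Word n}
    {S : Set (Part m n)} (h : S ⊆ G.homFam m n k l) :
    (Submodule.span ℂ (Tmap N '' S) : Set _) ⊆ G.Hom k l := by
  intro T hT
  induction hT using Submodule.span_induction with
  | mem T hT => obtain ⟨π, hπ, rfl⟩ := hT; exact h hπ
  | zero => simp [mem_Hom]
  | add S T _ _ hS hT => exact Hom_add hS hT
  | smul c T _ hT => exact Hom_smul c hT

/-- Take adjoints in `T u^{⊗k} = u^{⊗l} T`, then multiply by `u^{⊗k}` on the left and by `u^{⊗l}` on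
the right. Both tensor powers must be unitary, hence biunitarity. -/
theorem Hom_conjTranspose {G : QMat.{u} N} (hG : IsBiunitary G.u) {m n : ℕ} {k : Word m}
    {l : Word n} {T : Matrix (Fin n → Fin N) (Fin m → Fin N) ℂ}
    (hT : T ∈ G.Hom k l) : Tᴴ ∈ G.Hom l k := by
  rw [mem_Hom] at *
  have hmap : (Tᴴ).map (algebraMap ℂ G.A) = (T.map (algebraMap ℂ G.A))ᴴ := by
    ext; exact algebraMap_star_comm _
  rw [hmap]
  have h := congrArg Matrix.conjTranspose hT
  rw [Matrix.conjTranspose_mul, Matrix.conjTranspose_mul] at h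
  have h1 := congrArg (fun M => G.tensorPow k * M * G.tensorPow l) h
  rw [← Matrix.mul_assoc, (tensorPow_unitary hG k).1, Matrix.one_mul, Matrix.mul_assoc,
    Matrix.mul_assoc, (tensorPow_unitary hG l).2, Matrix.mul_one] at h1
  exact h1

theorem homFam_tensor (G : QMat.{u} N) {m n m' n' : ℕ} {k : Word m} {l : Word n}
    {k' : Word m'} {l' : Word n'} {π : Part m n} {σ : Part m' n'} (hπ : π ∈ G.homFam m n k l)
    (hσ : σ ∈ G.homFam m' n' k' l') :
    π.tensor σ ∈ G.homFam (m + m') (n + n') (Fin.append k k') (Fin.append l l') := by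
  have hsum : ∀ {a b : ℕ} (F : (Fin a → Fin N) → (Fin b → Fin N) → G.A),
      ∑ K : Fin (a + b) → Fin N, F (K ∘ Fin.castAdd b) (K ∘ Fin.natAdd a) = ∑ K, ∑ K', F K K' := by
    intro a b F
    rw [← Fintype.sum_prod_type']
    refine (Fintype.sum_equiv (Fin.appendEquiv a b) _ _ fun x => ?_).symm
    congr 1 <;> funext i <;> simp [Fin.appendEquiv]
  have hπ' := mem_Hom_entry.1 hπ
  have hσ' := mem_Hom_entry.1 hσ
  refine mem_Hom_entry.2 fun J I => ?_
  simp only [Tmap_tensor, tensorPow_append, map_mul]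
  rw [hsum fun K K' => algebraMap ℂ G.A (Tmap N π (J ∘ Fin.castAdd n') K) *
      algebraMap ℂ G.A (Tmap N σ (J ∘ Fin.natAdd n) K') *
      (G.tensorPow k K (I ∘ Fin.castAdd m') * G.tensorPow k' K' (I ∘ Fin.natAdd m)),
    hsum fun K K' => G.tensorPow l (J ∘ Fin.castAdd n') K * G.tensorPow l' (J ∘ Fin.natAdd n) K' *
      (algebraMap ℂ G.A (Tmap N π K (I ∘ Fin.castAdd m')) *
        algebraMap ℂ G.A (Tmap N σ K' (I ∘ Fin.natAdd m)))]
  have e1 := congrArg₂ (· * ·) (hπ' (J ∘ Fin.castAdd n') (I ∘ Fin.castAdd m'))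
    (hσ' (J ∘ Fin.natAdd n) (I ∘ Fin.natAdd m))
  simp only [Finset.sum_mul_sum] at e1
  refine Eq.trans ?_ (e1.trans ?_)
  · refine Finset.sum_congr rfl fun K _ => Finset.sum_congr rfl fun K' _ => ?_
    rw [mul_assoc, ← mul_assoc (algebraMap ℂ G.A (Tmap N σ _ K')),
      Algebra.commutes (Tmap N σ _ K') (G.tensorPow k K _)]
    simp only [mul_assoc]
  · refine Finset.sum_congr rfl fun K _ => Finset.sum_congr rfl fun K' _ => ?_
    rw [mul_assoc, ← mul_assoc (algebraMap ℂ G.A (Tmap N π K _)),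
      Algebra.commutes (Tmap N π K _) (G.tensorPow l' _ K')]
    simp only [mul_assoc]

/-- The vector `∑ e_i ⊗ e_i` is fixed by a letter followed by its conjugate precisely because the
rows of the letter are orthonormal. -/
theorem homFam_cap {G : QMat.{u} N} (hG : IsBiunitary G.u) (c : Bool) :
    (⊤ : Part 0 2) ∈ G.homFam 0 2 ![] ![c, !c] := by
  classical
  refine mem_Hom_entry.2 fun J I => ?_
  have hT : ∀ (K : Fin 2 → Fin N) I, Tmap N (⊤ : Part 0 2) K I = if K 0 = K 1 then 1 else 0 := by
    intro K I
    rw [Tmap_apply]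
    congr 1
    rw [eq_iff_iff]
    constructor
    · intro h
      exact @h (Sum.inr 0) (Sum.inr 1) trivial
    · rintro h a b -
      rcases a with a | a
      · exact a.elim0
      rcases b with b | b
      · exact b.elim0
      fin_cases a <;> fin_cases b <;> simp [Setoid.ker_def, h]
  have hsum : ∀ F : (Fin 2 → Fin N) → G.A, ∑ K, F K = ∑ i, ∑ j, F ![i, j] := by
    intro F
    rw [← Fintype.sum_prod_type']
    refine (Fintype.sum_equiv (finTwoArrowEquiv (Fin N)).symm _ _ fun x => ?_).symm
    simp
  rw [hsum]
  simp only [hT]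
  have h0 : ∀ I', G.tensorPow ![] I' I = 1 := fun I' => by simp [tensorPow]
  have hl := (letter_unitary hG c).1
  rw [← Matrix.ext_iff] at hl
  have hl := hl (J 0) (J 1)
  rw [Matrix.mul_apply, Matrix.one_apply] at hl
  simp only [h0, mul_one]
  simp only [Fintype.sum_unique, tensorPow]
  cases c <;> simpa [letter, apply_ite, mul_ite] using hl.symm

/-- The easy direction of Tannakian duality. It supplies the category axioms for `P2star`, and it
also lets `NC2_le` be applied to `O_N^+`. -/
theorem isCategory_homFam {G : QMat.{u} N} (hN : 0 < N) (hG : IsBiunitary G.u) :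
    IsCategory G.homFam where
  tensor := homFam_tensor G
  comp := by
    intro m n p k l r π σ hπ hσ
    obtain ⟨c, hc, h⟩ := Tmap_comp hN π σ
    have h1 := Hom_smul c⁻¹ (Hom_mul hπ hσ)
    rw [h, smul_smul, inv_mul_cancel₀ hc, one_smul] at h1
    exact h1
  flip := by
    intro m n k l π hπ
    have := Hom_conjTranspose hG hπ
    rwa [← Tmap_flip] at this
  one := by
    intro m k
    change Tmap N _ ∈ G.Hom k k
    rw [Tmap_idPart, mem_Hom, Matrix.map_one _ (map_zero _) (map_one _), Matrix.one_mul,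
      Matrix.mul_one]
  cap := homFam_cap hG

end QMat

theorem IsOrth.isBiunitary {N : ℕ} {B : Type*} [CStarAlgebra B] {w : Matrix (Fin N) (Fin N) B}
    (h : IsOrth w) : IsBiunitary w := by
  have h1 : w.map star = w := by ext i j; exact h.1 i j
  have h2 : wᴴ = wᵀ := by ext i j; exact h.1 j i
  rw [IsBiunitary, h1, h2]
  exact ⟨h.2, h.2⟩

theorem IsOrth.tensorPow_eq {N : ℕ} {G : QMat.{u} N} (h : IsOrth G.u) {m : ℕ} (k k' : Word m) :
    G.tensorPow k = G.tensorPow k' := by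
  ext I J
  simp [QMat.tensorPow, h.1]

theorem IsOrth.Hom_eq {N : ℕ} {G : QMat.{u} N} (h : IsOrth G.u) {m n : ℕ} (k k' : Word m)
    (l l' : Word n) : G.Hom k l = G.Hom k' l' := by
  rw [QMat.Hom, QMat.Hom, h.tensorPow_eq k k', h.tensorPow_eq l l']

/-! ### Generalities on pairings -/

/-- Partners are unique, so nested pairings coincide. To identify a composition known to be a
pairing, it is thus enough to exhibit the expected strings in it. -/
theorem IsPairing.eq_of_le {m n : ℕ} {π τ : Part m n} (hπ : IsPairing π) (hτ : IsPairing τ)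
    (h : τ ≤ π) : τ = π := by
  refine le_antisymm h fun a b hab => ?_
  by_cases e : b = a
  · rw [e]
  · obtain ⟨c, ⟨hc, hac⟩, -⟩ := hτ a
    rw [(hπ a).unique ⟨e, hab⟩ ⟨hc, h hac⟩]
    exact hac

/-- The gluing of two partitions, before the restriction to the outer rows. -/
def Part.glue {m n p : ℕ} (π : Part m n) (σ : Part n p) : Setoid (Fin m ⊕ (Fin n ⊕ Fin p)) :=
  Setoid.map π (Sum.map id Sum.inl) ⊔ Setoid.map σ Sum.inr

theorem Part.comp_rel {m n p : ℕ} {π : Part m n} {σ : Part n p} {a b : Fin m ⊕ Fin p} :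
    π.comp σ a b ↔ π.glue σ (Sum.map id Sum.inr a) (Sum.map id Sum.inr b) := Iff.rfl

theorem Part.glue_top {m n p : ℕ} {π : Part m n} (σ : Part n p) {a b : Fin m ⊕ Fin n}
    (h : π a b) : π.glue σ (Sum.map id Sum.inl a) (Sum.map id Sum.inl b) :=
  (le_sup_left : _ ≤ π.glue σ) (setoid_map_rel _ h)

theorem Part.glue_bot {m n p : ℕ} (π : Part m n) {σ : Part n p} {a b : Fin n ⊕ Fin p}
    (h : σ a b) : π.glue σ (Sum.inr a) (Sum.inr b) :=
  (le_sup_right : _ ≤ π.glue σ) (setoid_map_rel _ h)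

theorem Part.tensor_left {m n m' n' : ℕ} {π : Part m n} (σ : Part m' n') {a b : Fin m ⊕ Fin n}
    (h : π a b) : π.tensor σ (Sum.map (Fin.castAdd m') (Fin.castAdd n') a)
      (Sum.map (Fin.castAdd m') (Fin.castAdd n') b) :=
  (le_sup_left : _ ≤ π.tensor σ) (setoid_map_rel _ h)

theorem Part.tensor_right {m n m' n' : ℕ} (π : Part m n) {σ : Part m' n'} {a b : Fin m' ⊕ Fin n'}
    (h : σ a b) : π.tensor σ (Sum.map (Fin.natAdd m) (Fin.natAdd n) a)
      (Sum.map (Fin.natAdd m) (Fin.natAdd n) b) :=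
  (le_sup_right : _ ≤ π.tensor σ) (setoid_map_rel _ h)

@[simp] theorem cpos_inl {m n : ℕ} (i : Fin m) : cpos (Sum.inl i : Fin m ⊕ Fin n) = i := rfl

@[simp] theorem cpos_inr {m n : ℕ} (j : Fin n) :
    cpos (Sum.inr j : Fin m ⊕ Fin n) = m + (n - (j + 1)) := by
  simp [cpos, Fin.val_rev]

theorem cpos_lt {m n : ℕ} (a : Fin m ⊕ Fin n) : cpos a < m + n := by
  rcases a with i | j
  · simp only [cpos_inl]; omega
  · simp only [cpos_inr]; omega

theorem cpos_injective {m n : ℕ} : Function.Injective (cpos : Fin m ⊕ Fin n → ℕ) := by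
  rintro (i | j) (i' | j') h
  · simp only [cpos_inl] at h; rw [Fin.ext h]
  · simp only [cpos_inl, cpos_inr] at h; omega
  · simp only [cpos_inl, cpos_inr] at h; omega
  · simp only [cpos_inr] at h
    rw [Fin.ext (by omega : (j : ℕ) = j')]

theorem exists_cpos {m n x : ℕ} (h : x < m + n) : ∃ a : Fin m ⊕ Fin n, cpos a = x := by
  by_cases hx : x < m
  · exact ⟨Sum.inl ⟨x, hx⟩, rfl⟩
  · refine ⟨Sum.inr ⟨m + n - 1 - x, by omega⟩, ?_⟩
    simp only [cpos_inr]
    omega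

/-- The partition of a two-row set of points induced by a partition of the positions. -/
@[reducible]
def posPart (m n : ℕ) (S : Setoid ℕ) : Part m n := S.comap cpos

theorem posPart_map {m n : ℕ} (π : Part m n) : posPart m n (π.map cpos) = π :=
  Setoid.comap_map_eq _ _ cpos_injective

/-- The partition `S` of the positions restricts to a pairing of the first `p` positions. -/
def PairOn (p : ℕ) (S : Setoid ℕ) : Prop := ∀ x < p, ∃ y < p, y ≠ x ∧ S x y ∧
  ∀ z < p, z ≠ x → S x z → z = y

theorem isPairing_posPart_iff {m n : ℕ} {S : Setoid ℕ} :
    IsPairing (posPart m n S) ↔ PairOn (m + n) S := by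
  constructor
  · intro h x hx
    obtain ⟨a, rfl⟩ := exists_cpos hx
    obtain ⟨b, ⟨hb, hab⟩, hu⟩ := h a
    refine ⟨cpos b, cpos_lt b, fun e => hb (cpos_injective e), hab, ?_⟩
    intro z hz hne hz'
    obtain ⟨c, rfl⟩ := exists_cpos hz
    rw [hu c ⟨fun e => hne (by rw [e]), hz'⟩]
  · intro h a
    obtain ⟨y, hy, hne, hs, hu⟩ := h (cpos a) (cpos_lt a)
    obtain ⟨b, rfl⟩ := exists_cpos hy
    exact ⟨b, ⟨fun e => hne (by rw [e]), hs⟩,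
      fun c hc => cpos_injective (hu _ (cpos_lt c) (fun e => hc.1 (cpos_injective e)) hc.2)⟩

theorem PairOn.eq {p : ℕ} {S : Setoid ℕ} (h : PairOn p S) {x y z : ℕ} (hx : x < p) (hy : y < p)
    (hz : z < p) (hxy : S x y) (hxz : S x z) (hy' : y ≠ x) (hz' : z ≠ x) : y = z := by
  obtain ⟨w, -, -, -, hu⟩ := h x hx
  rw [hu y hy hy' hxy, hu z hz hz' hxz]

theorem PairOn.even {p : ℕ} {S : Setoid ℕ} (h : PairOn p S) : Even p := by
  choose f hf hne hS hu using h
  -- Sending a point to its partner is a fixed-point-free involution, and the two terms of each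
  -- orbit cancel modulo 2.
  have : ∑ x ∈ Finset.range p, (1 : ZMod 2) = 0 := by
    refine Finset.sum_involution (fun x hx => f x (Finset.mem_range.1 hx)) ?_ ?_ ?_ ?_
    · intro a _; decide
    · intro a ha _; exact hne a (Finset.mem_range.1 ha)
    · intro a ha; exact Finset.mem_range.2 (hf a (Finset.mem_range.1 ha))
    · intro a ha
      have ha := Finset.mem_range.1 ha
      exact (hu _ (hf a ha) a ha (hne a ha).symm (S.symm' (hS a ha))).symm
  rw [Finset.sum_const, Finset.card_range, nsmul_one] at this
  exact (ZMod.natCast_eq_zero_iff_even).1 this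

/-! ### Color-blind categories of pairings -/

/-- A category of pairings, not depending on the colors. -/
structure PairCat (E : ∀ m n, Set (Part m n)) : Prop where
  tensor : ∀ {m n m' n' : ℕ} {π : Part m n} {σ : Part m' n'}, π ∈ E m n → σ ∈ E m' n' →
    π.tensor σ ∈ E (m + m') (n + n')
  comp : ∀ {m n p : ℕ} {π : Part m n} {σ : Part n p}, π ∈ E m n → σ ∈ E n p → π.comp σ ∈ E m p
  flip : ∀ {m n : ℕ} {π : Part m n}, π ∈ E m n → π.flip ∈ E n m
  one : ∀ m, Part.idPart m ∈ E m m
  cap : (⊤ : Part 0 2) ∈ E 0 2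
  pairing : ∀ {m n : ℕ} {π : Part m n}, π ∈ E m n → IsPairing π

namespace PairCat

variable {E : ∀ m n, Set (Part m n)} (hE : PairCat E)

include hE

theorem cup : (⊤ : Part 2 0) ∈ E 2 0 := hE.flip hE.cap

/-- The last upper leg is bent down on the right with a semicircle. In the clockwise numbering it
keeps the position `m`, being now the rightmost lower point, so the same `S` describes both
partitions. -/
theorem rotate_down {m n : ℕ} {S : Setoid ℕ} (h : posPart (m + 1) n S ∈ E (m + 1) n) :
    posPart m (n + 1) S ∈ E m (n + 1) := by
  let α : Part m (m + 2) := (Part.idPart m).tensor (⊤ : Part 0 2)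
  let π := posPart (m + 1) n S
  let β : Part (m + 2) (n + 1) := π.tensor (Part.idPart 1)
  have hα : α ∈ E m (m + 2) := hE.tensor (hE.one m) hE.cap
  have hβ : β ∈ E (m + 2) (n + 1) := hE.tensor h (hE.one 1)
  have hρ : α.comp β ∈ E m (n + 1) := hE.comp hα hβ
  have hp : IsPairing (posPart m (n + 1) S) := by
    have := isPairing_posPart_iff.1 (hE.pairing h)
    rw [isPairing_posPart_iff]
    convert this using 1
    omega
  have hlift : ∀ a : Fin m ⊕ Fin (n + 1), ∃ b : Fin (m + 1) ⊕ Fin n, cpos b = cpos a ∧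
      α.glue β (Sum.map id Sum.inr a)
        (Sum.inr (Sum.map (Fin.castAdd 1) (Fin.castAdd 1) b)) := by
    rintro (i | j)
    · refine ⟨Sum.inl i.castSucc, rfl, ?_⟩
      exact Part.glue_top β (Part.tensor_left (π := Part.idPart m) (⊤ : Part 0 2)
        (a := Sum.inl i) (b := Sum.inr i) rfl)
    · refine Fin.lastCases ?_ (fun j => ?_) j
      · refine ⟨Sum.inl (Fin.last m), by simp, ?_⟩
        have h1 : β (Sum.inl (Fin.last (m + 1))) (Sum.inr (Fin.last n)) :=
          Part.tensor_right π (σ := Part.idPart 1) (a := Sum.inl 0) (b := Sum.inr 0) rfl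
        have h2 : α (Sum.inr (Fin.last (m + 1))) (Sum.inr (Fin.last m).castSucc) :=
          Part.tensor_right (Part.idPart m) (σ := (⊤ : Part 0 2)) (a := Sum.inr 1)
            (b := Sum.inr 0) trivial
        exact Setoid.trans' _ (Setoid.symm' _ (Part.glue_bot α h1)) (Part.glue_top β h2)
      · exact ⟨Sum.inr j, by simp; omega, Setoid.refl' _ _⟩
  have hle : posPart m (n + 1) S ≤ α.comp β := by
    intro a b hab
    obtain ⟨a', ha', ha⟩ := hlift a
    obtain ⟨b', hb', hb⟩ := hlift b
    have h3 : π a' b' := by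
      change S (cpos a') (cpos b')
      rw [ha', hb']; exact hab
    exact Part.comp_rel.2 (Setoid.trans' _ ha (Setoid.trans' _
      (Part.glue_bot α (Part.tensor_left _ h3)) (Setoid.symm' _ hb)))
  rw [(hE.pairing hρ).eq_of_le hp hle]
  exact hρ

theorem rotate_up {m n : ℕ} {S : Setoid ℕ} (h : posPart m (n + 1) S ∈ E m (n + 1)) :
    posPart (m + 1) n S ∈ E (m + 1) n := by
  let π := posPart m (n + 1) S
  let α : Part (m + 1) (n + 2) := π.tensor (Part.idPart 1)
  let β : Part (n + 2) n := (Part.idPart n).tensor (⊤ : Part 2 0)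
  have hα : α ∈ E (m + 1) (n + 2) := hE.tensor h (hE.one 1)
  have hβ : β ∈ E (n + 2) n := hE.tensor (hE.one n) hE.cup
  have hρ : α.comp β ∈ E (m + 1) n := hE.comp hα hβ
  have hp : IsPairing (posPart (m + 1) n S) := by
    have := isPairing_posPart_iff.1 (hE.pairing h)
    rw [isPairing_posPart_iff]
    convert this using 1
    omega
  have hlift : ∀ a : Fin (m + 1) ⊕ Fin n, ∃ b : Fin m ⊕ Fin (n + 1), cpos b = cpos a ∧
      α.glue β (Sum.map id Sum.inr a)
        (Sum.map id Sum.inl (Sum.map (Fin.castAdd 1) (Fin.castAdd 1) b)) := by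
    rintro (i | j)
    · refine Fin.lastCases ?_ (fun i => ?_) i
      · refine ⟨Sum.inr (Fin.last n), by simp, ?_⟩
        have h1 : α (Sum.inl (Fin.last m)) (Sum.inr (Fin.last (n + 1))) :=
          Part.tensor_right π (σ := Part.idPart 1) (a := Sum.inl 0) (b := Sum.inr 0) rfl
        have h2 : β (Sum.inl (Fin.last (n + 1))) (Sum.inl (Fin.last n).castSucc) :=
          Part.tensor_right (Part.idPart n) (σ := (⊤ : Part 2 0)) (a := Sum.inl 1)
            (b := Sum.inl 0) trivial
        exact Setoid.trans' _ (Part.glue_top β h1) (Part.glue_bot α h2)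
      · exact ⟨Sum.inl i, rfl, Setoid.refl' _ _⟩
    · refine ⟨Sum.inr j.castSucc, by simp; omega, ?_⟩
      exact Part.glue_bot α (Part.tensor_left (π := Part.idPart n) (⊤ : Part 2 0)
        (a := Sum.inr j) (b := Sum.inl j) rfl)
  have hle : posPart (m + 1) n S ≤ α.comp β := by
    intro a b hab
    obtain ⟨a', ha', ha⟩ := hlift a
    obtain ⟨b', hb', hb⟩ := hlift b
    have h3 : π a' b' := by
      change S (cpos a') (cpos b')
      rw [ha', hb']; exact hab
    exact Part.comp_rel.2 (Setoid.trans' _ ha (Setoid.trans' _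
      (Part.glue_top β (Part.tensor_left _ h3)) (Setoid.symm' _ hb)))
  rw [(hE.pairing hρ).eq_of_le hp hle]
  exact hρ

/-- Frobenius duality: membership only depends on the partition of the positions. -/
theorem rotate_iff {m n p : ℕ} (h : m + n = p) (S : Setoid ℕ) :
    posPart m n S ∈ E m n ↔ posPart 0 p S ∈ E 0 p := by
  induction m generalizing n with
  | zero =>
    obtain rfl : n = p := by omega
    rfl
  | succ m ih =>
    rw [← ih (n := n + 1) (by omega)]
    exact ⟨hE.rotate_down, hE.rotate_up⟩

theorem pairOn {p : ℕ} {S : Setoid ℕ} (h : posPart 0 p S ∈ E 0 p) : PairOn p S := by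
  have := isPairing_posPart_iff.1 (hE.pairing h)
  rwa [zero_add] at this

end PairCat

/-- The increasing map skipping the positions `i` and `i + 1`. -/
def skipTwo (i x : ℕ) : ℕ := if x < i then x else x + 2

/-! ### Removing and inserting semicircles -/

namespace PairCat

variable {E : ∀ m n, Set (Part m n)} (hE : PairCat E)

include hE

/-- Capping two neighboring positions. -/
theorem exists_capped {p i : ℕ} {S : Setoid ℕ} (hi : i ≤ p)
    (h : posPart 0 (p + 2) S ∈ E 0 (p + 2)) : ∃ S' : Setoid ℕ, posPart 0 p S' ∈ E 0 p ∧
      ∀ x < p, ∀ y < p, S (skipTwo i x) (skipTwo i y) → S' x y := by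
  obtain ⟨n, rfl⟩ := Nat.exists_eq_add_of_le hi
  -- With the first `i` positions moved to the upper row, the positions `i` and `i + 1` are the two
  -- rightmost lower points, where a semicircle can be composed.
  rw [← hE.rotate_iff (m := i) (n := n + 2) (by omega)] at h
  let π := posPart i (n + 2) S
  let β : Part (n + 2) n := (Part.idPart n).tensor (⊤ : Part 2 0)
  have hβ : β ∈ E (n + 2) n := hE.tensor (hE.one n) hE.cup
  have hρ : π.comp β ∈ E i n := hE.comp h hβ
  refine ⟨(π.comp β).map cpos, ?_, ?_⟩
  · rw [← hE.rotate_iff rfl, posPart_map]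
    exact hρ
  · have hlift : ∀ a : Fin i ⊕ Fin n, ∃ b : Fin i ⊕ Fin (n + 2), cpos b = skipTwo i (cpos a) ∧
        π.glue β (Sum.map id Sum.inr a) (Sum.map id Sum.inl b) := by
      rintro (a | j)
      · exact ⟨Sum.inl a, by simp [skipTwo], Setoid.refl' _ _⟩
      · refine ⟨Sum.inr (Fin.castAdd 2 j), by simp [skipTwo]; omega, ?_⟩
        exact Part.glue_bot π (Part.tensor_left (π := Part.idPart n) (⊤ : Part 2 0)
          (a := Sum.inr j) (b := Sum.inl j) rfl)
    intro x hx y hy hxy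
    obtain ⟨a, rfl⟩ := exists_cpos hx
    obtain ⟨b, rfl⟩ := exists_cpos hy
    obtain ⟨a', ha', ha⟩ := hlift a
    obtain ⟨b', hb', hb⟩ := hlift b
    refine setoid_map_rel _ ?_
    have h3 : π a' b' := by
      change S (cpos a') (cpos b')
      rw [ha', hb']; exact hxy
    exact Part.comp_rel.2 (Setoid.trans' _ ha (Setoid.trans' _ (Part.glue_top β h3)
      (Setoid.symm' _ hb)))

/-- Inserting a semicircle. -/
theorem insert_cap {p i : ℕ} {S : Setoid ℕ} (hi : i ≤ p) (hS : PairOn (p + 2) S)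
    (hi' : S i (i + 1)) (h : posPart 0 p (S.comap (skipTwo i)) ∈ E 0 p) :
    posPart 0 (p + 2) S ∈ E 0 (p + 2) := by
  obtain ⟨n, rfl⟩ := Nat.exists_eq_add_of_le hi
  rw [← hE.rotate_iff (m := i) (n := n) (by omega)] at h
  rw [← hE.rotate_iff (m := i) (n := n + 2) (by omega)]
  let π := posPart i n (S.comap (skipTwo i))
  let β : Part n (n + 2) := (Part.idPart n).tensor (⊤ : Part 0 2)
  have hβ : β ∈ E n (n + 2) := hE.tensor (hE.one n) hE.cap
  have hρ : π.comp β ∈ E i (n + 2) := hE.comp h hβ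
  have hp : IsPairing (posPart i (n + 2) S) := isPairing_posPart_iff.2 hS
  have hlift : ∀ a : Fin i ⊕ Fin (n + 2),
      (∃ b : Fin i ⊕ Fin n, skipTwo i (cpos b) = cpos a ∧
        π.glue β (Sum.map id Sum.inr a) (Sum.map id Sum.inl b)) ∨
      ((cpos a = i ∨ cpos a = i + 1) ∧ ∃ c : Fin 2, a = Sum.inr (Fin.natAdd n c)) := by
    rintro (a | j)
    · exact Or.inl ⟨Sum.inl a, by simp [skipTwo], Setoid.refl' _ _⟩
    · refine Fin.addCases (fun j => ?_) (fun j => ?_) j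
      · refine Or.inl ⟨Sum.inr j, by simp [skipTwo]; omega, ?_⟩
        exact Part.glue_bot π (Part.tensor_left (π := Part.idPart n) (⊤ : Part 0 2)
          (a := Sum.inr j) (b := Sum.inl j) rfl)
      · refine Or.inr ⟨?_, j, rfl⟩
        simp; omega
  have hskip : ∀ x, skipTwo i x ≠ i ∧ skipTwo i x ≠ i + 1 := by
    intro x; unfold skipTwo; split_ifs <;> omega
  -- The positions `i` and `i + 1` are partners, so no string of `S` joins one of them to the rest.
  -- Every string is either inherited from `π` or part of the new semicircle.
  have hmixed : ∀ a b : Fin i ⊕ Fin (n + 2), (cpos a = i ∨ cpos a = i + 1) →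
      cpos b ≠ i → cpos b ≠ i + 1 → ¬ S (cpos a) (cpos b) := by
    intro a b ha hb hb' hab
    have hb2 := cpos_lt b
    rcases ha with ha | ha <;> rw [ha] at hab
    · exact hb' (hS.eq (x := i) (by omega) (by omega) (by omega) hab hi' hb (by omega))
    · exact hb (hS.eq (x := i + 1) (by omega) (by omega) (by omega) hab (S.symm' hi') hb'
        (by omega))
  have hle : posPart i (n + 2) S ≤ π.comp β := by
    intro a b hab
    rcases hlift a with ⟨a', ha', ha⟩ | ⟨ha, c, hc⟩ <;>
      rcases hlift b with ⟨b', hb', hb⟩ | ⟨hb, d, hd⟩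
    · have h3 : π a' b' := by
        change S (skipTwo i (cpos a')) (skipTwo i (cpos b'))
        rw [ha', hb']; exact hab
      exact Part.comp_rel.2 (Setoid.trans' _ ha (Setoid.trans' _ (Part.glue_top β h3)
        (Setoid.symm' _ hb)))
    · exact absurd (S.symm' hab) (hmixed b a hb (ha' ▸ (hskip _).1) (ha' ▸ (hskip _).2))
    · exact absurd hab (hmixed a b ha (hb' ▸ (hskip _).1) (hb' ▸ (hskip _).2))
    · rw [hc, hd]
      exact Part.glue_bot π (Part.tensor_right (Part.idPart n) (σ := (⊤ : Part 0 2))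
        (a := Sum.inr c) (b := Sum.inr d) trivial)
  rw [(hE.pairing hρ).eq_of_le hp hle]
  exact hρ

end PairCat

/-- The permutation of the positions which reverses the interval `[i, i + s)`. -/
def revAt (i s x : ℕ) : ℕ := if i ≤ x ∧ x < i + s then 2 * i + s - 1 - x else x

theorem revAt_revAt (i s x : ℕ) : revAt i s (revAt i s x) = x := by
  unfold revAt; split_ifs <;> omega

theorem revAt_lt {i s x p : ℕ} (h : i + s ≤ p) (hx : x < p) : revAt i s x < p := by
  unfold revAt; split_ifs <;> omega

theorem comap_revAt_revAt (i s : ℕ) (S : Setoid ℕ) :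
    (S.comap (revAt i s)).comap (revAt i s) = S := by
  ext x y
  simp [Setoid.comap_rel, revAt_revAt]

theorem PairOn.comap_revAt {p i s : ℕ} {S : Setoid ℕ} (h : PairOn p S) (hi : i + s ≤ p) :
    PairOn p (S.comap (revAt i s)) := by
  intro x hx
  obtain ⟨y, hy, hne, hs, hu⟩ := h _ (revAt_lt hi hx)
  refine ⟨revAt i s y, revAt_lt hi hy, ?_, ?_, ?_⟩
  · intro e; exact hne (by rw [← e, revAt_revAt])
  · simpa [Setoid.comap_rel, revAt_revAt] using hs
  · intro z hz hzx hxz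
    rw [← hu (revAt i s z) (revAt_lt hi hz) (fun e => hzx ?_) hxz, revAt_revAt]
    rw [← revAt_revAt i s z, e, revAt_revAt]

theorem PairOn.comap_skipTwo {p i : ℕ} {S : Setoid ℕ} (h : PairOn (p + 2) S) (hi : i ≤ p)
    (hS : S i (i + 1)) : PairOn p (S.comap (skipTwo i)) := by
  have hlt : ∀ {x}, x < p → skipTwo i x < p + 2 := by
    intro x; unfold skipTwo; split_ifs <;> omega
  have hinj : ∀ {x y}, skipTwo i x = skipTwo i y → x = y := by
    intro x y; unfold skipTwo; split_ifs <;> omega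
  have hskip : ∀ x, skipTwo i x ≠ i ∧ skipTwo i x ≠ i + 1 := by
    intro x; unfold skipTwo; split_ifs <;> omega
  intro x hx
  obtain ⟨y, hy, hne, hs, hu⟩ := h _ (hlt hx)
  have hyi : y ≠ i := by
    rintro rfl
    exact (hskip x).2 (h.eq (x := y) (by omega) (hlt hx) (by omega) (S.symm' hs) hS
      (hskip x).1 (by omega))
  have hyi' : y ≠ i + 1 := by
    rintro rfl
    exact (hskip x).1 (h.eq (x := i + 1) (by omega) (hlt hx) (by omega) (S.symm' hs) (S.symm' hS)
      (hskip x).2 (by omega))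
  have hy' : ∃ y', y' < p ∧ skipTwo i y' = y := by
    by_cases hlt : y < i
    · exact ⟨y, by omega, by simp [skipTwo, hlt]⟩
    · exact ⟨y - 2, by omega, by unfold skipTwo; split_ifs <;> omega⟩
  obtain ⟨y', hy'p, rfl⟩ := hy'
  exact ⟨y', hy'p, fun e => hne (by rw [e]), hs,
    fun z hz hzx hxz => hinj (hu _ (hlt hz) (fun e => hzx (hinj e)) hxz)⟩

/-- The partition joining each upper point to the opposite lower point: the crossing for `s = 2`,
the half-liberated crossing for `s = 3`. -/
@[reducible]
def revPart (s : ℕ) : Part s s := Setoid.ker (Sum.elim id Fin.rev)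

/-! ### Generating categories from crossings, and extracting crossings from pairings -/

namespace PairCat

variable {E : ∀ m n, Set (Part m n)} (hE : PairCat E)

include hE

/-- After rotating `i` positions up, the interval to be reversed consists of the `s` rightmost lower
points, and composing with the identity next to `revPart s` reverses it. -/
theorem reverse_mem {p i s : ℕ} {S : Setoid ℕ} (hi : i + s ≤ p) (hs : revPart s ∈ E s s)
    (h : posPart 0 p S ∈ E 0 p) : posPart 0 p (S.comap (revAt i s)) ∈ E 0 p := by
  obtain ⟨n, rfl⟩ : ∃ n, p = i + (n + s) := ⟨p - i - s, by omega⟩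
  have hpair := hE.pairOn h
  rw [← hE.rotate_iff (m := i) (n := n + s) rfl] at h ⊢
  let π := posPart i (n + s) S
  let β : Part (n + s) (n + s) := (Part.idPart n).tensor (revPart s)
  have hβ : β ∈ E (n + s) (n + s) := hE.tensor (hE.one n) hs
  have hρ : π.comp β ∈ E i (n + s) := hE.comp h hβ
  have hp : IsPairing (posPart i (n + s) (S.comap (revAt i s))) :=
    isPairing_posPart_iff.2 (hpair.comap_revAt hi)
  have hlift : ∀ a : Fin i ⊕ Fin (n + s), ∃ b : Fin i ⊕ Fin (n + s),
      cpos b = revAt i s (cpos a) ∧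
        π.glue β (Sum.map id Sum.inr a) (Sum.map id Sum.inl b) := by
    rintro (a | j)
    · refine ⟨Sum.inl a, ?_, Setoid.refl' _ _⟩
      rw [cpos_inl, revAt, if_neg (by omega)]
    · refine Fin.addCases (fun j => ?_) (fun j => ?_) j
      · refine ⟨Sum.inr (Fin.castAdd s j), ?_, ?_⟩
        · simp only [cpos_inr, revAt, Fin.val_castAdd]; split_ifs <;> omega
        · exact Part.glue_bot π (Part.tensor_left (π := Part.idPart n) (revPart s)
            (a := Sum.inr j) (b := Sum.inl j) rfl)
      · refine ⟨Sum.inr (Fin.natAdd n j.rev), ?_, ?_⟩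
        · simp only [cpos_inr, revAt, Fin.val_natAdd, Fin.val_rev]; split_ifs <;> omega
        · exact Part.glue_bot π (Part.tensor_right (Part.idPart n) (σ := revPart s)
            (a := Sum.inr j) (b := Sum.inl j.rev) rfl)
  have hle : posPart i (n + s) (S.comap (revAt i s)) ≤ π.comp β := by
    intro a b hab
    obtain ⟨a', ha', ha⟩ := hlift a
    obtain ⟨b', hb', hb⟩ := hlift b
    have h3 : π a' b' := by
      change S (cpos a') (cpos b')
      rw [ha', hb']; exact hab
    exact Part.comp_rel.2 (Setoid.trans' _ ha (Setoid.trans' _ (Part.glue_top β h3)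
      (Setoid.symm' _ hb)))
  rw [(hE.pairing hρ).eq_of_le hp hle]
  exact hρ

theorem posPart_zero_mem (S : Setoid ℕ) : posPart 0 0 S ∈ E 0 0 := by
  have : posPart 0 0 S = Part.idPart 0 := by
    ext a; exact isEmptyElim a
  rw [this]; exact hE.one 0

/-- The noncrossing pairings belong to all the categories. -/
theorem noncrossing_mem {p : ℕ} {S : Setoid ℕ} (hS : PairOn p S)
    (hnc : ∀ a b c d, a < b → b < c → c < d → d < p → S a c → S b d → False) :
    posPart 0 p S ∈ E 0 p := by
  induction p using Nat.strong_induction_on generalizing S with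
  | _ p ih =>
  match p, ih, hS, hnc with
  | 0, _, _, _ => exact hE.posPart_zero_mem S
  | 1, _, hS, _ => exact absurd hS.even (by decide)
  | p + 2, ih, hS, hnc =>
    -- Descent to an innermost string: the partner of `a + 1` cannot leave the interval between `a`
    -- and `a + d + 1` without crossing, so it gives a strictly shorter string, until two neighbors
    -- are joined.
    have key : ∀ d a, a + d + 1 < p + 2 → S a (a + d + 1) → ∃ i ≤ p, S i (i + 1) := by
      intro d
      induction d using Nat.strong_induction_on with
      | _ d ihd =>
      intro a had h
      rcases Nat.eq_zero_or_pos d with rfl | hd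
      · exact ⟨a, by omega, h⟩
      · obtain ⟨y, hy, hne, hs, -⟩ := hS (a + 1) (by omega)
        have hya : y ≠ a := by
          rintro rfl
          have := hS.eq (x := y) (by omega) (by omega) (by omega) (S.symm' hs) h (by omega)
            (by omega)
          omega
        have hyd : y ≠ a + d + 1 := by
          rintro rfl
          have := hS.eq (x := a + d + 1) (by omega) (by omega) (by omega) (S.symm' hs)
            (S.symm' h) (by omega) (by omega)
          omega
        rcases Nat.lt_or_ge y a with h1 | h1
        · exact (hnc y a (a + 1) (a + d + 1) h1 (by omega) (by omega) (by omega)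
            (S.symm' hs) h).elim
        · rcases Nat.lt_or_ge (a + d + 1) y with h2 | h2
          · exact (hnc a (a + 1) (a + d + 1) y (by omega) (by omega) h2 hy h hs).elim
          · refine ihd (y - a - 2) (by omega) (a + 1) (by omega) ?_
            have : a + 1 + (y - a - 2) + 1 = y := by omega
            rwa [this]
    obtain ⟨y, hy, hne, hs, -⟩ := hS 0 (by omega)
    obtain ⟨i, hi, hii⟩ := key (y - 1) 0 (by omega) (by rwa [zero_add, Nat.sub_add_cancel (by omega)])
    refine hE.insert_cap hi hS hii (ih p (by omega) (hS.comap_skipTwo hi hii) ?_)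
    intro a b c d hab hbc hcd hd hac hbd
    have hmono : ∀ {x y}, x < y → skipTwo i x < skipTwo i y := by
      intro x y; unfold skipTwo; split_ifs <;> omega
    refine hnc _ _ _ _ (hmono hab) (hmono hbc) (hmono hcd) ?_ hac hbd
    unfold skipTwo; split_ifs <;> omega

/-- A category containing the (half-liberated) crossing contains all the pairings (joining
positions of different parities). -/
theorem mem_of_revPart_mem {t : ℕ} (ht : t = 1 ∨ t = 2) (hr : revPart (t + 1) ∈ E (t + 1) (t + 1))
    {p : ℕ} {S : Setoid ℕ} (hS : PairOn p S)
    (hpar : t = 2 → ∀ x < p, ∀ y < p, x ≠ y → S x y → Odd (x + y)) :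
    posPart 0 p S ∈ E 0 p := by
  induction p using Nat.strong_induction_on generalizing S with
  | _ p ih =>
  match p, ih, hS, hpar with
  | 0, _, _, _ => exact hE.posPart_zero_mem S
  | 1, _, hS, _ => exact absurd hS.even (by decide)
  | p + 2, ih, hS, hpar =>
    -- Induction on the distance `d` from `p` to the partner `q` of the last position. Reversing the
    -- `t + 1` positions from `q` on moves this partner to `q + t`; once it reaches `p`, the last
    -- string is a semicircle and can be removed.
    have key : ∀ d (S : Setoid ℕ), PairOn (p + 2) S → (t = 2 → ∀ x < p + 2, ∀ y < p + 2, x ≠ y →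
        S x y → Odd (x + y)) → ∀ q, q + d = p → S (p + 1) q →
        posPart 0 (p + 2) S ∈ E 0 (p + 2) := by
      intro d
      induction d using Nat.strong_induction_on with
      | _ d ihd =>
      intro S hS hpar q hq hpq
      rcases Nat.eq_zero_or_pos d with rfl | hd
      · obtain rfl : q = p := by omega
        refine hE.insert_cap le_rfl hS (S.symm' hpq)
          (ih q (by omega) (hS.comap_skipTwo le_rfl (S.symm' hpq)) ?_)
        intro ht x hx y hy hxy hs
        have hx' : skipTwo q x = x := by simp [skipTwo, hx]
        have hy' : skipTwo q y = y := by simp [skipTwo, hy]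
        rw [Setoid.comap_rel, hx', hy'] at hs
        exact hpar ht x (by omega) y (by omega) hxy hs
      · have hqt : q + t ≤ p := by
          rcases ht with rfl | rfl
          · omega
          · have := hpar rfl (p + 1) (by omega) q (by omega) (by omega) hpq
            rw [Nat.odd_iff] at this
            omega
        rw [← comap_revAt_revAt q (t + 1) S]
        refine hE.reverse_mem (by omega) hr ?_
        refine ihd (d - t) (by omega) _ (hS.comap_revAt (by omega)) ?_ (q + t) (by omega) ?_
        · intro ht' x hx y hy hxy hs
          have h1 := hpar ht' _ (revAt_lt (i := q) (s := t + 1) (by omega) hx) _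
            (revAt_lt (i := q) (s := t + 1) (by omega) hy)
            (fun e => hxy (by rw [← revAt_revAt q (t + 1) x, e, revAt_revAt])) hs
          -- For `t = 2` the reversal is `x ↦ 2q + 2 - x` on the interval, which preserves parities.
          have h2 : ∀ x, revAt q (t + 1) x % 2 = x % 2 := by
            intro x; unfold revAt; split_ifs <;> omega
          rw [Nat.odd_iff, Nat.add_mod, h2, h2, ← Nat.add_mod] at h1
          exact Nat.odd_iff.2 h1
        · have e1 : revAt q (t + 1) (p + 1) = p + 1 := by unfold revAt; split_ifs <;> omega
          have e2 : revAt q (t + 1) (q + t) = q := by unfold revAt; split_ifs <;> omega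
          rw [Setoid.comap_rel, e1, e2]; exact hpq
    obtain ⟨q, hq, hne, hs, -⟩ := hS (p + 1) (by omega)
    exact key (p - q) S hS hpar q (by omega) hs

/-- On the circle of `2s` positions, `revPart s` joins opposite points: the string starting at the
upper point `x` ends at the position `x + s`. -/
theorem revPart_mem_of_rel {s : ℕ} {S : Setoid ℕ} (h : posPart 0 (s + s) S ∈ E 0 (s + s))
    (hS : ∀ x < s, S x (x + s)) : revPart s ∈ E s s := by
  have h' := (hE.rotate_iff (m := s) (n := s) rfl S).2 h
  have hlift : ∀ a : Fin s ⊕ Fin s, S (Sum.elim id Fin.rev a : Fin s) (cpos a) := by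
    rintro (a | a)
    · exact S.refl' _
    · have := hS (Fin.rev a : Fin s) (Fin.rev a).2
      rw [add_comm] at this
      exact this
  have hp : IsPairing (revPart s) := by
    rintro (a | a)
    · refine ⟨Sum.inr a.rev, ⟨by simp, by simp [Setoid.ker_def]⟩, ?_⟩
      rintro (b | b) ⟨hb, hab⟩
      · exact absurd (congrArg Sum.inl (show a = b from hab)).symm hb
      · rw [show a = b.rev from hab, Fin.rev_rev]
    · refine ⟨Sum.inl a.rev, ⟨by simp, by simp [Setoid.ker_def]⟩, ?_⟩
      rintro (b | b) ⟨hb, hab⟩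
      · rw [show a.rev = b from hab]
      · exact absurd (congrArg Sum.inr (Fin.rev_injective (show a.rev = b.rev from hab))).symm hb
  have : revPart s = posPart s s S := by
    refine (hE.pairing h').eq_of_le hp fun a b hab => ?_
    have hab : (Sum.elim id Fin.rev a : Fin s) = Sum.elim id Fin.rev b := hab
    have h1 := hlift a
    rw [hab] at h1
    exact S.trans' (S.symm' h1) (hlift b)
  rw [this]; exact h'

/-- A category which contains a string joining positions of the same parity contains the
crossing. -/
theorem crossing_mem {p : ℕ} {S : Setoid ℕ} (h : posPart 0 p S ∈ E 0 p) {x y : ℕ} (hxy : x < y)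
    (hy : y < p) (hS : S x y) (hpar : Even (x + y)) : revPart 2 ∈ E 2 2 := by
  induction p using Nat.strong_induction_on generalizing S x y with
  | _ p ih =>
  have hp := hE.pairOn h
  have hpe := hp.even
  rw [Nat.even_iff] at hpe hpar
  rcases Nat.lt_or_ge p 6 with h6 | h6
  -- On 4 points, a string joining equal parities is `0–2` or `1–3`, and the two remaining points
  -- are forced to be joined to each other.
  · obtain rfl : p = 4 := by omega
    have hu := @PairOn.eq 4 S hp
    refine hE.revPart_mem_of_rel h ?_
    have h02 : (x = 0 ∧ y = 2) ∨ (x = 1 ∧ y = 3) := by omega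
    have hz : S 0 2 ∧ S 1 3 := by
      rcases h02 with ⟨rfl, rfl⟩ | ⟨rfl, rfl⟩
      · refine ⟨hS, ?_⟩
        obtain ⟨z, hz, hne, hs, -⟩ := hp 1 (by omega)
        have hz0 : z ≠ 0 := by
          rintro rfl
          have := hu (x := 0) (by omega) (by omega) (by omega) (S.symm' hs) hS (by omega)
            (by omega)
          omega
        have hz2 : z ≠ 2 := by
          rintro rfl
          have := hu (x := 2) (by omega) (by omega) (by omega) (S.symm' hs) (S.symm' hS)
            (by omega) (by omega)
          omega
        obtain rfl : z = 3 := by omega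
        exact hs
      · refine ⟨?_, hS⟩
        obtain ⟨z, hz, hne, hs, -⟩ := hp 0 (by omega)
        have hz0 : z ≠ 1 := by
          rintro rfl
          have := hu (x := 1) (by omega) (by omega) (by omega) (S.symm' hs) hS (by omega)
            (by omega)
          omega
        have hz2 : z ≠ 3 := by
          rintro rfl
          have := hu (x := 3) (by omega) (by omega) (by omega) (S.symm' hs) (S.symm' hS)
            (by omega) (by omega)
          omega
        obtain rfl : z = 2 := by omega
        exact hs
    intro x hx
    interval_cases x
    · exact hz.1
    · exact hz.2
  -- With at least 6 points, two neighbors avoid both `x` and `y`. Capping them shifts each of `x`,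
  -- `y` by 0 or 2, so the parity of the sum is kept.
  · have hi : ∃ i, i + 1 < p ∧ i ≠ x ∧ i ≠ y ∧ i + 1 ≠ x ∧ i + 1 ≠ y := by
      by_cases h1 : 2 ≤ x
      · exact ⟨0, by omega⟩
      · by_cases h2 : x + 3 ≤ y
        · exact ⟨x + 1, by omega⟩
        · exact ⟨y + 1, by omega⟩
    obtain ⟨i, hip, hi⟩ := hi
    obtain ⟨p, rfl⟩ : ∃ p', p = p' + 2 := ⟨p - 2, by omega⟩
    obtain ⟨S', hS', hSS'⟩ := hE.exists_capped (i := i) (by omega) h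
    have hun : ∀ z, z ≠ i → z ≠ i + 1 → z < p + 2 → ∃ z' < p, skipTwo i z' = z := by
      intro z h1 h2 h3
      by_cases hlt : z < i
      · exact ⟨z, by omega, by simp [skipTwo, hlt]⟩
      · exact ⟨z - 2, by omega, by unfold skipTwo; split_ifs <;> omega⟩
    obtain ⟨x', hx', rfl⟩ := hun x (by omega) (by omega) (by omega)
    obtain ⟨y', hy', rfl⟩ := hun y (by omega) (by omega) (by omega)
    refine ih p (by omega) hS' (x := x') (y := y') ?_ hy' (hSS' _ hx' _ hy' hS) ?_
    · unfold skipTwo at hxy; split_ifs at hxy <;> omega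
    · unfold skipTwo at hpar; rw [Nat.even_iff]; split_ifs at hpar <;> omega

/-- A category of pairings joining positions of different parities which contains a crossing
pairing contains the half-liberated crossing. -/
theorem halfCrossing_mem (hpar : ∀ {p : ℕ} {S : Setoid ℕ}, posPart 0 p S ∈ E 0 p →
      ∀ x < p, ∀ y < p, x ≠ y → S x y → Odd (x + y))
    {p : ℕ} {S : Setoid ℕ} (h : posPart 0 p S ∈ E 0 p) {a b c d : ℕ}
    (hab : a < b) (hbc : b < c) (hcd : c < d) (hd : d < p) (hac : S a c) (hbd : S b d) :
    revPart 3 ∈ E 3 3 := by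
  induction p using Nat.strong_induction_on generalizing S a b c d with
  | _ p ih =>
  have hp := hE.pairOn h
  have hpe := hp.even
  have hodd := hpar h
  have hu : ∀ x y z, x < p → y < p → z < p → S x y → S x z → y ≠ x → z ≠ x → y = z :=
    fun x y z hx hy hz h1 h2 h3 h4 => hp.eq hx hy hz h1 h2 h3 h4
  have hac' := hodd a (by omega) c (by omega) (by omega) hac
  have hbd' := hodd b (by omega) d (by omega) (by omega) hbd
  rw [Nat.even_iff] at hpe
  rw [Nat.odd_iff] at hac' hbd'
  have havoid : ∀ x y z, S x y → x < p → y < p → z < p → x ≠ y → z ≠ x → z ≠ y →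
      ∀ w < p, w ≠ z → S z w → w ≠ x ∧ w ≠ y := by
    intro x y z hxy hx hy hz hne hzx hzy w hw hwz hzw
    constructor
    · rintro rfl
      exact hzy (hu w z y hx hz hy (S.symm' hzw) hxy hzx (by omega))
    · rintro rfl
      exact hzx (hu w z x hy hz hx (S.symm' hzw) (S.symm' hxy) hzy (by omega))
  rcases Nat.lt_or_ge p 8 with h8 | h8
  · obtain rfl : p = 6 := by omega
    -- Crossing strings of odd length on 6 points must have length 3, and the last string is then
    -- forced to join opposite points too.
    have hca : c = a + 3 := by omega
    have hdb : d = b + 3 := by omega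
    subst hca hdb
    refine hE.revPart_mem_of_rel h fun x hx => ?_
    by_cases hxa : x = a
    · rw [hxa]; exact hac
    by_cases hxb : x = b
    · rw [hxb]; exact hbd
    obtain ⟨z, hz, hne, hs, -⟩ := hp x (by omega)
    have h1 := havoid _ _ x hac (by omega) (by omega) (by omega) (by omega) hxa (by omega) z hz
      hne hs
    have h2 := havoid _ _ x hbd (by omega) (by omega) (by omega) (by omega) hxb (by omega) z hz
      hne hs
    obtain rfl : z = x + 3 := by omega
    exact hs
  -- Find a crossing pair of strings, possibly a new one, together with two neighbors that it does
  -- not use, in order to cap them.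
  · have hex : ∃ a b c d i, a < b ∧ b < c ∧ c < d ∧ d < p ∧ S a c ∧ S b d ∧ i + 1 < p ∧
        (i ≠ a ∧ i ≠ b ∧ i ≠ c ∧ i ≠ d) ∧ (i + 1 ≠ a ∧ i + 1 ≠ b ∧ i + 1 ≠ c ∧ i + 1 ≠ d) := by
      by_cases h1 : 2 ≤ a
      · exact ⟨a, b, c, d, 0, by omega, by omega, by omega, by omega, hac, hbd, by omega⟩
      by_cases h2 : a + 3 ≤ b
      · exact ⟨a, b, c, d, a + 1, by omega, by omega, by omega, by omega, hac, hbd, by omega⟩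
      by_cases h3 : b + 3 ≤ c
      · exact ⟨a, b, c, d, b + 1, by omega, by omega, by omega, by omega, hac, hbd, by omega⟩
      by_cases h4 : c + 3 ≤ d
      · exact ⟨a, b, c, d, c + 1, by omega, by omega, by omega, by omega, hac, hbd, by omega⟩
      by_cases h5 : d + 3 ≤ p
      · exact ⟨a, b, c, d, d + 1, by omega, by omega, by omega, by omega, hac, hbd, by omega⟩
      -- If no two neighbors are free, the five gaps left by `a, b, c, d` have at most one point
      -- each, and parity leaves this single configuration. The other points `0, 2, 5, 7` carry two
      -- more strings, and in both possible cases another crossing pair leaves two neighbors free.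
      obtain ⟨rfl, rfl, rfl, rfl, rfl⟩ : a = 1 ∧ b = 3 ∧ c = 4 ∧ d = 6 ∧ p = 8 := by omega
      obtain ⟨q, hq, hne, hs, -⟩ := hp 0 (by omega)
      obtain ⟨r, hr, hner, hsr, -⟩ := hp 2 (by omega)
      have q1 := havoid _ _ 0 hac (by omega) (by omega) (by omega) (by omega) (by omega) (by omega)
        q hq hne hs
      have q2 := havoid _ _ 0 hbd (by omega) (by omega) (by omega) (by omega) (by omega) (by omega)
        q hq hne hs
      have q3 := hodd 0 (by omega) q hq hne.symm hs
      have r1 := havoid _ _ 2 hac (by omega) (by omega) (by omega) (by omega) (by omega) (by omega)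
        r hr hner hsr
      have r2 := havoid _ _ 2 hbd (by omega) (by omega) (by omega) (by omega) (by omega) (by omega)
        r hr hner hsr
      have r3 := hodd 2 (by omega) r hr hner.symm hsr
      rw [Nat.odd_iff] at q3 r3
      have r4 := havoid _ _ 2 hs (by omega) hq (by omega) hne.symm (by omega) (by omega) r hr hner
        hsr
      have hcase : (q = 5 ∧ r = 7) ∨ (q = 7 ∧ r = 5) := by omega
      rcases hcase with ⟨rfl, rfl⟩ | ⟨rfl, rfl⟩
      · exact ⟨0, 2, 5, 7, 3, by omega, by omega, by omega, by omega, hs, hsr, by omega⟩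
      · exact ⟨1, 2, 4, 5, 6, by omega, by omega, by omega, by omega, hac, hsr, by omega⟩
    clear hac' hbd' hac hbd hab hbc hcd hd a b c d
    obtain ⟨a, b, c, d, i, hab, hbc, hcd, hd, hac, hbd, hip, hi, hi'⟩ := hex
    obtain ⟨p, rfl⟩ : ∃ p', p = p' + 2 := ⟨p - 2, by omega⟩
    obtain ⟨S', hS', hSS'⟩ := hE.exists_capped (i := i) (by omega) h
    have hun : ∀ z, z ≠ i → z ≠ i + 1 → z < p + 2 → ∃ z' < p, skipTwo i z' = z := by
      intro z h1 h2 h3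
      by_cases hlt : z < i
      · exact ⟨z, by omega, by simp [skipTwo, hlt]⟩
      · exact ⟨z - 2, by omega, by unfold skipTwo; split_ifs <;> omega⟩
    have hmono : ∀ {x y}, skipTwo i x < skipTwo i y → x < y := by
      intro x y; unfold skipTwo; split_ifs <;> omega
    obtain ⟨a', ha', rfl⟩ := hun a (by omega) (by omega) (by omega)
    obtain ⟨b', hb', rfl⟩ := hun b (by omega) (by omega) (by omega)
    obtain ⟨c', hc', rfl⟩ := hun c (by omega) (by omega) (by omega)
    obtain ⟨d', hd', rfl⟩ := hun d (by omega) (by omega) (by omega)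
    exact ih p (by omega) hS' (hmono hab) (hmono hbc) (hmono hcd) hd' (hSS' _ ha' _ hc' hac)
      (hSS' _ hb' _ hd' hbd)

end PairCat

/-! ### Categories of partitions between `NC₂` and `P₂` -/

section Classification

variable {D : PartFamily} (hD : IsCategory D) (hP : D ≤ P2)
  (hid : ∀ c c', Part.idPart 1 ∈ D 1 1 ![c] ![c'])

include hD hP hid

/-- Tensoring one-string identities with independent upper and lower colors recolors a whole row at
once. -/
theorem idPart_mem {m : ℕ} (k l : Word m) : Part.idPart m ∈ D m m k l := by
  induction m with
  | zero =>
    rw [Subsingleton.elim l k]; exact hD.one k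
  | succ m ih =>
    have h := hD.tensor (ih (Fin.init k) (Fin.init l)) (hid (k (Fin.last m)) (l (Fin.last m)))
    have hw : ∀ k : Word (m + 1), Fin.append (Fin.init k) ![k (Fin.last m)] = k := by
      intro k
      funext a
      refine Fin.lastCases ?_ (fun a => ?_) a
      · exact Fin.append_right (Fin.init k) ![k (Fin.last m)] 0
      · exact Fin.append_left _ _ _
    rw [hw, hw] at h
    have hp : IsPairing (Part.idPart (m + 1)) := hP _ _ k k (hD.one k)
    rw [← (hP _ _ _ _ h : IsPairing _).eq_of_le hp ?_] at h
    · exact h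
    · have hlift : ∀ a : Fin (m + 1), ((Part.idPart m).tensor (Part.idPart 1) :
          Part (m + 1) (m + 1)) (Sum.inl a) (Sum.inr a) := by
        intro a
        refine Fin.lastCases ?_ (fun a => ?_) a
        · exact Part.tensor_right (Part.idPart m) (σ := Part.idPart 1) (a := Sum.inl 0)
            (b := Sum.inr 0) rfl
        · exact Part.tensor_left (π := Part.idPart m) (Part.idPart 1) (a := Sum.inl a)
            (b := Sum.inr a) rfl
      rintro (a | a) (b | b) hab <;> obtain rfl : a = b := hab
      · exact Setoid.refl' _ _
      · exact hlift a
      · exact Setoid.symm' _ (hlift a)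
      · exact Setoid.refl' _ _

/-- Composing above and below with recoloring identities does not change the pairing, so colors are
irrelevant from here on. -/
theorem mem_of_mem {m n : ℕ} {k k' : Word m} {l l' : Word n} {π : Part m n}
    (h : π ∈ D m n k l) : π ∈ D m n k' l' := by
  have hπ : IsPairing π := hP _ _ _ _ h
  have h1 : π ∈ D m n k l' := by
    have h2 := hD.comp h (idPart_mem hD hP hid l l')
    rw [← (hP _ _ _ _ h2 : IsPairing _).eq_of_le hπ ?_] at h2
    · exact h2
    · have hlift : ∀ a : Fin m ⊕ Fin n, π.glue (Part.idPart n) (Sum.map id Sum.inr a)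
          (Sum.map id Sum.inl a) := by
        rintro (a | a)
        · exact Setoid.refl' _ _
        · exact Part.glue_bot π (σ := Part.idPart n) (a := Sum.inr a) (b := Sum.inl a) rfl
      intro a b hab
      exact Part.comp_rel.2 (Setoid.trans' _ (hlift a) (Setoid.trans' _ (Part.glue_top _ hab)
        (Setoid.symm' _ (hlift b))))
  have h2 := hD.comp (idPart_mem hD hP hid k' k) h1
  rw [← (hP _ _ _ _ h2 : IsPairing _).eq_of_le hπ ?_] at h2
  · exact h2
  · have hlift : ∀ a : Fin m ⊕ Fin n, (Part.idPart m).glue π (Sum.map id Sum.inr a)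
        (Sum.inr a) := by
      rintro (a | a)
      · exact Part.glue_top π (π := Part.idPart m) (a := Sum.inl a) (b := Sum.inr a) rfl
      · exact Setoid.refl' _ _
    intro a b hab
    exact Part.comp_rel.2 (Setoid.trans' _ (hlift a) (Setoid.trans' _ (Part.glue_bot _ hab)
      (Setoid.symm' _ (hlift b))))

theorem pairCat_of_isCategory :
    PairCat fun m n => D m n (fun _ => false) (fun _ => false) where
  tensor h h' := mem_of_mem hD hP hid (hD.tensor h h')
  comp h h' := hD.comp h h'
  flip h := hD.flip h
  one _ := hD.one _
  cap := mem_of_mem hD hP hid (hD.cap false)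
  pairing h := hP _ _ _ _ h

theorem mem_iff_posPart {m n : ℕ} {k : Word m} {l : Word n} {π : Part m n} :
    π ∈ D m n k l ↔ posPart 0 (m + n) (π.map cpos) ∈
      D 0 (m + n) (fun _ => false) (fun _ => false) := by
  rw [← (pairCat_of_isCategory hD hP hid).rotate_iff rfl, posPart_map]
  exact ⟨mem_of_mem hD hP hid, mem_of_mem hD hP hid⟩

theorem NC2_le : NC2 ≤ D := by
  rintro m n k l π ⟨hπ, hnc⟩
  rw [mem_iff_posPart hD hP hid]
  refine (pairCat_of_isCategory hD hP hid).noncrossing_mem ?_ ?_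
  · rw [← isPairing_posPart_iff, posPart_map]; exact hπ
  · intro a b c d hab hbc hcd hd hac hbd
    obtain ⟨d, rfl⟩ := exists_cpos hd
    obtain ⟨c, rfl⟩ := exists_cpos (hcd.trans hd)
    obtain ⟨b, rfl⟩ := exists_cpos (hbc.trans (hcd.trans hd))
    obtain ⟨a, rfl⟩ := exists_cpos (hab.trans (hbc.trans (hcd.trans hd)))
    rw [← Setoid.comap_rel, Setoid.comap_map_eq _ _ cpos_injective] at hac hbd
    exact hnc a b c d hab hbc hcd ⟨hac, hbd⟩

/-- There are exactly three categories of pairings which contain the bicolored identities. -/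
theorem eq_NC2_or_eq_P2star_or_eq_P2 : D = NC2 ∨ D = P2star ∨ D = P2 := by
  have hE := pairCat_of_isCategory hD hP hid
  have hrel : ∀ {m n : ℕ} {π : Part m n} {a b}, π.map cpos (cpos a) (cpos b) ↔ π a b := by
    intro m n π a b
    rw [← Setoid.comap_rel, Setoid.comap_map_eq _ _ cpos_injective]
  have hpair : ∀ {m n : ℕ} {π : Part m n}, IsPairing π → PairOn (m + n) (π.map cpos) := by
    intro m n π hπ
    rw [← isPairing_posPart_iff, posPart_map]; exact hπ
  by_cases h1 : D ≤ P2star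
  · by_cases h2 : D ≤ NC2
    · exact Or.inl (le_antisymm h2 (NC2_le hD hP hid))
    · refine Or.inr (Or.inl (le_antisymm h1 ?_))
      simp only [Pi.le_def, not_forall] at h2
      obtain ⟨m, n, k, l, h2⟩ := h2
      obtain ⟨π, hπ, hnc⟩ := Set.not_subset.1 h2
      have hπp : IsPairing π := hP _ _ _ _ hπ
      have hcross : ∃ a b c d, cpos a < cpos b ∧ cpos b < cpos c ∧ cpos c < cpos d ∧
          π a c ∧ π b d := by
        by_contra hcon
        exact hnc ⟨hπp, fun a b c d h1 h2 h3 h4 => hcon ⟨a, b, c, d, h1, h2, h3, h4⟩⟩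
      obtain ⟨a, b, c, d, hab, hbc, hcd, hac, hbd⟩ := hcross
      rw [mem_iff_posPart hD hP hid] at hπ
      have hhalf := hE.halfCrossing_mem (fun {p S} hS x hx y hy hxy hxyS => by
          obtain ⟨a, rfl⟩ := exists_cpos (m := 0) (n := p) (by omega : x < 0 + p)
          obtain ⟨b, rfl⟩ := exists_cpos (m := 0) (n := p) (by omega : y < 0 + p)
          exact (h1 _ _ _ _ hS).2 a b (fun e => hxy (by rw [e])) hxyS)
        hπ hab hbc hcd (cpos_lt d) (hrel.2 hac) (hrel.2 hbd)
      rintro m n k l τ ⟨hτ, hodd⟩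
      rw [mem_iff_posPart hD hP hid]
      refine hE.mem_of_revPart_mem (Or.inr rfl) hhalf (hpair hτ) fun _ x hx y hy hxy hs => ?_
      obtain ⟨a, rfl⟩ := exists_cpos hx
      obtain ⟨b, rfl⟩ := exists_cpos hy
      exact hodd a b (fun e => hxy (by rw [e])) (hrel.1 hs)
  · refine Or.inr (Or.inr (le_antisymm hP ?_))
    simp only [Pi.le_def, not_forall] at h1
    obtain ⟨m, n, k, l, h2⟩ := h1
    obtain ⟨π, hπ, hns⟩ := Set.not_subset.1 h2
    have hπp : IsPairing π := hP _ _ _ _ hπ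
    have hbad : ∃ a b, cpos a < cpos b ∧ π a b ∧ Even (cpos a + cpos b) := by
      by_contra hcon
      refine hns ⟨hπp, fun a b hab hr => ?_⟩
      rw [← Nat.not_even_iff_odd]
      intro hev
      rcases lt_trichotomy (cpos a) (cpos b) with h | h | h
      · exact hcon ⟨a, b, h, hr, hev⟩
      · exact hab (cpos_injective h)
      · exact hcon ⟨b, a, h, π.symm' hr, by rwa [add_comm]⟩
    obtain ⟨a, b, hab, hr, hev⟩ := hbad
    rw [mem_iff_posPart hD hP hid] at hπ
    have hX := hE.crossing_mem hπ hab (cpos_lt b) (hrel.2 hr) hev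
    intro m n k l τ hτ
    rw [mem_iff_posPart hD hP hid]
    exact hE.mem_of_revPart_mem (Or.inl rfl) hX (hpair hτ) fun h => absurd h (by decide)

end Classification

/-! ### The double commutant theorem for matrix algebras -/

/-- Take the orthogonal projection onto `R` for the inner product `tr(A* B)`. The adjoint of left
multiplication by `r` is left multiplication by `r*`, so the complement of `R` is also stable under
`R`, and the projection is `R`-linear. -/
theorem exists_equivariant_projection {Ω : Type*} [Fintype Ω] [DecidableEq Ω]
    (R : Subalgebra ℂ (Matrix Ω Ω ℂ)) (hstar : ∀ A ∈ R, Aᴴ ∈ R) :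
    ∃ P : Matrix Ω Ω ℂ →ₗ[ℂ] Matrix Ω Ω ℂ, (∀ A, P A ∈ R) ∧ (∀ A ∈ R, P A = A) ∧
      ∀ r ∈ R, ∀ A, P (r * A) = r * P A := by
  let vec : Matrix Ω Ω ℂ ≃ₗ[ℂ] EuclideanSpace ℂ (Ω × Ω) :=
    (Matrix.ofLinearEquiv ℂ).symm.trans
      ((LinearEquiv.curry ℂ ℂ Ω Ω).symm.trans (WithLp.linearEquiv 2 ℂ (Ω × Ω → ℂ)).symm)
  have hvec : ∀ A p, vec A p = A p.1 p.2 := fun A p => rfl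
  have hinner : ∀ A B, inner ℂ (vec A) (vec B) = (Aᴴ * B).trace := by
    intro A B
    simp only [PiLp.inner_apply, hvec, Matrix.trace, Matrix.diag, Matrix.mul_apply,
      Matrix.conjTranspose_apply]
    rw [Fintype.sum_prod_type_right]
    refine Finset.sum_congr rfl fun x _ => Finset.sum_congr rfl fun y _ => ?_
    simp [mul_comm]
  have hadj : ∀ r A B, inner ℂ (vec A) (vec (r * B)) = inner ℂ (vec (rᴴ * A)) (vec B) := by
    intro r A B
    rw [hinner, hinner, Matrix.conjTranspose_mul, Matrix.conjTranspose_conjTranspose,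
      Matrix.mul_assoc]
  let K : Submodule ℂ (EuclideanSpace ℂ (Ω × Ω)) :=
    (Subalgebra.toSubmodule R).map (vec : Matrix Ω Ω ℂ →ₗ[ℂ] EuclideanSpace ℂ (Ω × Ω))
  have hK : ∀ A, vec A ∈ K ↔ A ∈ R := by
    intro A
    constructor
    · rintro ⟨B, hB, h⟩
      rw [← vec.injective h]; exact hB
    · exact fun h => ⟨A, h, rfl⟩
  let P : Matrix Ω Ω ℂ →ₗ[ℂ] Matrix Ω Ω ℂ :=
    (vec.symm : EuclideanSpace ℂ (Ω × Ω) →ₗ[ℂ] Matrix Ω Ω ℂ) ∘ₗ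
      (K.starProjection : EuclideanSpace ℂ (Ω × Ω) →ₗ[ℂ] EuclideanSpace ℂ (Ω × Ω)) ∘ₗ
      (vec : Matrix Ω Ω ℂ →ₗ[ℂ] EuclideanSpace ℂ (Ω × Ω))
  have hP : ∀ A, vec (P A) = K.starProjection (vec A) := fun A => vec.apply_symm_apply _
  have hPR : ∀ A, P A ∈ R := fun A => by
    rw [← hK, hP]; exact Submodule.starProjection_apply_mem _ _
  refine ⟨P, hPR, ?_, ?_⟩
  · intro A hA
    apply vec.injective
    rw [hP]
    exact Submodule.starProjection_eq_self_iff.2 ((hK A).2 hA)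
  · intro r hr A
    apply vec.injective
    rw [hP]
    refine Submodule.eq_starProjection_of_mem_of_inner_eq_zero
      ((hK _).2 (R.mul_mem hr (hPR A))) ?_
    rintro w ⟨B, hB, rfl⟩
    rw [← map_sub, ← Matrix.mul_sub, ← inner_conj_symm, LinearEquiv.coe_coe, hadj,
      inner_conj_symm, map_sub, hP]
    exact Submodule.starProjection_inner_eq_zero _ _
      ((hK _).2 (R.mul_mem (hstar r hr) hB))

/-- As a left `R`-module, the matrix algebra is a sum of columns, and the blocks `T y y'` of the
equivariant projection `P` between columns commute with `R`. They then commute with `M`, so `P M = M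
* P 1 = M`, while `P` takes values in `R`. -/
theorem double_commutant {Ω : Type*} [Fintype Ω] [DecidableEq Ω]
    (R : Subalgebra ℂ (Matrix Ω Ω ℂ)) (hstar : ∀ A ∈ R, Aᴴ ∈ R) {M : Matrix Ω Ω ℂ}
    (hM : ∀ T : Matrix Ω Ω ℂ, (∀ A ∈ R, T * A = A * T) → M * T = T * M) : M ∈ R := by
  obtain ⟨P, hPR, hPid, hPmul⟩ := exists_equivariant_projection R hstar
  let T : Ω → Ω → Matrix Ω Ω ℂ := fun y y' => Matrix.of fun x x' => P (Matrix.single x' y' 1) x y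
  have hPT : ∀ A x y, P A x y = ∑ y', (T y y' * A) x y' := by
    intro A x y
    conv_lhs => rw [Matrix.matrix_eq_sum_single A]
    simp only [map_sum, Matrix.sum_apply, Matrix.mul_apply, T, Matrix.of_apply]
    rw [Finset.sum_comm]
    refine Finset.sum_congr rfl fun y' _ => Finset.sum_congr rfl fun x' _ => ?_
    have : Matrix.single x' y' (A x' y') = A x' y' • Matrix.single x' y' (1 : ℂ) := by
      rw [Matrix.smul_single, smul_eq_mul, mul_one]
    rw [this, map_smul, Matrix.smul_apply, smul_eq_mul, mul_comm]
  have hTcomm : ∀ y y', ∀ r ∈ R, T y y' * r = r * T y y' := by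
    intro y y' r hr
    ext x z
    have h1 : r * Matrix.single z y' (1 : ℂ) = ∑ x', r x' z • Matrix.single x' y' 1 := by
      ext a b
      simp only [Matrix.mul_apply, Matrix.sum_apply, Matrix.smul_apply, Matrix.single_apply,
        smul_eq_mul]
      by_cases hb : y' = b <;> simp [hb]
    have h2 := congrFun (congrFun (hPmul r hr (Matrix.single z y' 1)) x) y
    rw [h1, map_sum, Matrix.sum_apply, Matrix.mul_apply] at h2
    simp only [map_smul, Matrix.smul_apply, smul_eq_mul] at h2
    simp only [Matrix.mul_apply, T, Matrix.of_apply]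
    rw [← h2]
    exact Finset.sum_congr rfl fun _ _ => mul_comm _ _
  have h1 : P M = M * P 1 := by
    ext x y
    rw [hPT, Matrix.mul_apply]
    simp only [← hM _ (hTcomm y _), hPT 1, Matrix.mul_one]
    simp only [Matrix.mul_apply, Finset.mul_sum]
    exact Finset.sum_comm
  rw [hPid 1 R.one_mem, Matrix.mul_one] at h1
  rw [← h1]
  exact hPR M

/-! ### Reconstruction of a quantum group from its intertwiners -/

namespace QMat

variable {N : ℕ}

/-- The coefficients of `u^{⊗k}`, as elements of the coordinate algebra. -/
noncomputable def coeff (G : QMat.{u} N) {m : ℕ} (k : Word m) (I J : Fin m → Fin N) : G.coordAlg :=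
  evalGen G.X (wordPoly k I J)

theorem wordPoly_cons {m : ℕ} (k : Word (m + 1)) (i j : Fin N) (I J : Fin m → Fin N) :
    wordPoly k (Fin.cons i I) (Fin.cons j J) =
      FreeAlgebra.ι ℂ (i, j, k 0) * wordPoly (Fin.tail k) I J := by
  simp only [wordPoly, List.ofFn_succ, Fin.tail, List.prod_cons, Fin.cons_zero, Fin.cons_succ]

/-- A coordinate or its adjoint, according to the color. -/
def coeffLetter (G : QMat.{u} N) (c : Bool) (i j : Fin N) : G.coordAlg :=
  if c then star (G.x i j) else G.x i j

theorem coeff_cons (G : QMat.{u} N) {m : ℕ} (k : Word (m + 1)) (i j : Fin N)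
    (I J : Fin m → Fin N) : G.coeff k (Fin.cons i I) (Fin.cons j J) =
      G.coeffLetter (k 0) i j * G.coeff (Fin.tail k) I J := by
  rw [coeff, wordPoly_cons, map_mul, evalGen_ι]
  rfl

theorem coeff_zero (G : QMat.{u} N) (k : Word 0) (I J : Fin 0 → Fin N) : G.coeff k I J = 1 := by
  simp [coeff, wordPoly]

theorem cons_induction {m : ℕ} {P : (Fin (m + 1) → Fin N) → Prop}
    (h : ∀ i I, P (Fin.cons i I)) (I) : P I := by
  rw [← Fin.cons_self_tail I]; exact h _ _

theorem sum_cons {M : Type*} [AddCommMonoid M] {m : ℕ} (F : (Fin (m + 1) → Fin N) → M) :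
    ∑ K, F K = ∑ i, ∑ K', F (Fin.cons i K') := by
  rw [← Fintype.sum_prod_type']
  exact (Fintype.sum_equiv (Fin.consEquiv fun _ => Fin N) _ _ fun x => rfl).symm

theorem comul_coeff {G : QMat.{u} N} {Δ : G.coordAlg →⋆ₐ[ℂ] G.coordAlg ⊗[ℂ] G.coordAlg}
    (hΔ : ∀ i j, Δ (G.x i j) = ∑ k, G.x i k ⊗ₜ[ℂ] G.x k j) {m : ℕ} (k : Word m)
    (I J : Fin m → Fin N) :
    Δ (G.coeff k I J) = ∑ K, G.coeff k I K ⊗ₜ[ℂ] G.coeff k K J := by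
  have hl : ∀ c i j, Δ (G.coeffLetter c i j) =
      ∑ a, G.coeffLetter c i a ⊗ₜ[ℂ] G.coeffLetter c a j := by
    intro c i j
    cases c
    · exact hΔ i j
    · simp only [coeffLetter, if_true, map_star, hΔ, star_sum, TensorProduct.star_tmul]
  induction m with
  | zero => simp [coeff_zero, Algebra.TensorProduct.one_def]
  | succ m ih =>
    induction I using cons_induction with | h i I =>
    induction J using cons_induction with | h j J =>
    rw [sum_cons]
    simp only [coeff_cons, map_mul, hl, ih, Finset.sum_mul_sum,
      Algebra.TensorProduct.tmul_mul_tmul]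

theorem counit_coeff {G : QMat.{u} N} {ε : G.coordAlg →⋆ₐ[ℂ] ℂ}
    (hε : ∀ i j, ε (G.x i j) = if i = j then 1 else 0) {m : ℕ} (k : Word m)
    (I J : Fin m → Fin N) : ε (G.coeff k I J) = if I = J then 1 else 0 := by
  have hl : ∀ c i j, ε (G.coeffLetter c i j) = if i = j then 1 else 0 := by
    intro c i j
    cases c
    · exact hε i j
    · simp only [coeffLetter, if_true, map_star, hε]
      split_ifs <;> simp
  induction m with
  | zero => simp [coeff_zero, Subsingleton.elim I J]
  | succ m ih =>
    induction I using cons_induction with | h i I =>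
    induction J using cons_induction with | h j J =>
    simp only [coeff_cons, map_mul, hl, ih, Fin.cons_inj]
    split_ifs <;> simp_all

theorem antipode_coeff {G : QMat.{u} N} {S : G.coordAlg →⋆ₐ[ℂ] (G.coordAlg)ᵐᵒᵖ}
    (hS : ∀ i j, S (G.x i j) = MulOpposite.op (star (G.x j i))) {m : ℕ} (k : Word m)
    (I J : Fin m → Fin N) : S (G.coeff k I J) = MulOpposite.op (star (G.coeff k J I)) := by
  have hl : ∀ c i j, S (G.coeffLetter c i j) = MulOpposite.op (star (G.coeffLetter c j i)) := by
    intro c i j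
    cases c
    · exact hS i j
    · simp only [coeffLetter, if_true, map_star, hS, MulOpposite.op_star]
  induction m with
  | zero => simp [coeff_zero]
  | succ m ih =>
    induction I using cons_induction with | h i I =>
    induction J using cons_induction with | h j J =>
    simp only [coeff_cons, map_mul, hl, ih, star_mul, MulOpposite.op_mul]

theorem mem_span_wordPoly (p : StarPoly N) :
    p ∈ Submodule.span ℂ (Set.range fun w : (Σ t : (Σ m, Word m),
      (Fin t.1 → Fin N) × (Fin t.1 → Fin N)) => wordPoly w.1.2 w.2.1 w.2.2) := by
  have h1 : p ∈ Algebra.adjoin ℂ (Set.range (FreeAlgebra.ι ℂ (X := Fin N × Fin N × Bool))) := by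
    rw [FreeAlgebra.adjoin_range_ι]; trivial
  rw [← Subalgebra.mem_toSubmodule, Algebra.adjoin_eq_span] at h1
  refine Submodule.span_mono ?_ h1
  intro q hq
  obtain ⟨l, hl, rfl⟩ := Submonoid.exists_list_of_mem_closure hq
  have hl' : ∃ l' : List (Fin N × Fin N × Bool), l'.map (FreeAlgebra.ι ℂ) = l := by
    have h2 : l ∈ {l : List (StarPoly N) | ∀ x ∈ l, x ∈ Set.range (FreeAlgebra.ι ℂ)} := hl
    rwa [← Set.range_list_map] at h2
  obtain ⟨l', rfl⟩ := hl'
  refine ⟨⟨⟨l'.length, fun a => (l'.get a).2.2⟩, fun a => (l'.get a).1, fun a => (l'.get a).2.1⟩, ?_⟩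
  simp only [wordPoly]
  congr 1
  conv_rhs => rw [← List.ofFn_get l', List.map_ofFn]
  rfl

/-- Only finitely many words occur in a polynomial, so a relation lives in the coefficients of a
single finite direct sum of tensor powers. -/
theorem exists_sum_wordPoly (p : StarPoly N) : ∃ (F : Finset (Σ m, Word m))
    (c : ∀ t : (Σ m, Word m), (Fin t.1 → Fin N) → (Fin t.1 → Fin N) → ℂ),
    p = ∑ t : F, ∑ I, ∑ J, c t.1 I J • wordPoly t.1.2 I J := by
  classical
  obtain ⟨c, hc⟩ := Finsupp.mem_span_range_iff_exists_finsupp.1 (mem_span_wordPoly p)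
  refine ⟨c.support.image Sigma.fst, fun t I J => c ⟨t, I, J⟩, ?_⟩
  rw [← hc, Finsupp.sum, Finset.sum_coe_sort (c.support.image Sigma.fst)
    fun t => ∑ I, ∑ J, c ⟨t, I, J⟩ • wordPoly t.2 I J]
  have h1 : ∀ t : (Σ m, Word m), ∑ I, ∑ J, c ⟨t, I, J⟩ • wordPoly t.2 I J =
      ∑ q : (Fin t.1 → Fin N) × (Fin t.1 → Fin N), c ⟨t, q⟩ • wordPoly t.2 q.1 q.2 :=
    fun t => (Fintype.sum_prod_type' _).symm
  rw [Finset.sum_congr rfl fun t _ => h1 t, ← Finset.sum_sigma _ (fun _ => Finset.univ)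
    (fun w => c w • wordPoly w.1.2 w.2.1 w.2.2)]
  refine Finset.sum_subset ?_ ?_
  · intro w hw
    simp only [Finset.mem_sigma, Finset.mem_univ, and_true]
    exact Finset.mem_image_of_mem _ hw
  · intro w _ hw
    rw [Finsupp.notMem_support_iff.1 hw, zero_smul]

theorem sum_mul_blockDiagonal' {F : Type*} [Fintype F] [DecidableEq F] {n : F → Type*}
    [∀ t, Fintype (n t)] {A M : Type*} [Zero A] [AddCommMonoid M]
    (r : ∀ t, Matrix (n t) (n t) A) (f : (Σ t, n t) → A → M) (hf : ∀ z, f z 0 = 0)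
    (t : F) (J : n t) :
    ∑ z, f z (Matrix.blockDiagonal' r z ⟨t, J⟩) = ∑ I, f ⟨t, I⟩ (r t I J) := by
  rw [Fintype.sum_sigma, Finset.sum_eq_single t]
  · simp [Matrix.blockDiagonal'_apply_eq]
  · intro s _ hs
    exact Finset.sum_eq_zero fun I _ => by rw [Matrix.blockDiagonal'_apply_ne _ _ _ hs, hf]
  · simp

theorem sum_blockDiagonal'_mul {F : Type*} [Fintype F] [DecidableEq F] {n : F → Type*}
    [∀ t, Fintype (n t)] {A M : Type*} [Zero A] [AddCommMonoid M]
    (r : ∀ t, Matrix (n t) (n t) A) (f : (Σ t, n t) → A → M) (hf : ∀ z, f z 0 = 0)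
    (t : F) (I : n t) :
    ∑ z, f z (Matrix.blockDiagonal' r ⟨t, I⟩ z) = ∑ J, f ⟨t, J⟩ (r t I J) := by
  rw [Fintype.sum_sigma, Finset.sum_eq_single t]
  · simp [Matrix.blockDiagonal'_apply_eq]
  · intro s _ hs
    exact Finset.sum_eq_zero fun I _ => by rw [Matrix.blockDiagonal'_apply_ne _ _ _ hs.symm, hf]
  · simp

/-- The algebra of the matrices obtained by applying linear forms to the entries of a
corepresentation. -/
theorem exists_coefficient_algebra {A : Type*} [Ring A] [StarRing A] [Algebra ℂ A]
    [StarModule ℂ A] (Δ : A →⋆ₐ[ℂ] A ⊗[ℂ] A) (ε : A →⋆ₐ[ℂ] ℂ) (S : A →⋆ₐ[ℂ] Aᵐᵒᵖ)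
    {Ω : Type*} [Fintype Ω] [DecidableEq Ω] (r : Matrix Ω Ω A)
    (hΔ : ∀ x y, Δ (r x y) = ∑ z, r x z ⊗ₜ[ℂ] r z y)
    (hε : ∀ x y, ε (r x y) = if x = y then 1 else 0)
    (hS : ∀ x y, S (r x y) = MulOpposite.op (star (r y x))) :
    ∃ R : Subalgebra ℂ (Matrix Ω Ω ℂ), (∀ M ∈ R, Mᴴ ∈ R) ∧
      ∀ M, M ∈ R ↔ ∃ φ : Module.Dual ℂ A, M = r.map φ := by
  let R : Subalgebra ℂ (Matrix Ω Ω ℂ) :=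
    { carrier := {M | ∃ φ : Module.Dual ℂ A, M = r.map φ}
      mul_mem' := by
        rintro _ _ ⟨φ, rfl⟩ ⟨ψ, rfl⟩
        -- Matrix products correspond to convolution of linear forms, with the counit as unit.
        refine ⟨LinearMap.mul' ℂ ℂ ∘ₗ TensorProduct.map φ ψ ∘ₗ Δ.toAlgHom.toLinearMap, ?_⟩
        ext x y
        simp [Matrix.mul_apply, hΔ]
      add_mem' := by
        rintro _ _ ⟨φ, rfl⟩ ⟨ψ, rfl⟩
        exact ⟨φ + ψ, by ext; simp⟩
      algebraMap_mem' := by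
        intro c
        refine ⟨c • ε.toAlgHom.toLinearMap, ?_⟩
        ext x y
        simp [hε, Matrix.algebraMap_matrix_apply] }
  refine ⟨R, ?_, fun M => Iff.rfl⟩
  rintro _ ⟨φ, rfl⟩
  -- The form `a ↦ conj (φ (S(a)*))` is linear, two conjugations having been used, and the antipode
  -- makes it produce the adjoint matrix.
  let φ' : Module.Dual ℂ A :=
    { toFun := fun a => star (φ (star (MulOpposite.unop (S a))))
      map_add' := fun a b => by simp
      map_smul' := fun c a => by simp [star_smul] }
  refine ⟨φ', ?_⟩
  ext x y
  have : φ' (r x y) = star (φ (r y x)) := by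
    change star (φ (star (MulOpposite.unop (S (r x y))))) = _
    rw [hS]; simp
  simp [this]

/-- A quantum group with less intertwiners is bigger. -/
theorem IsQuantumGroup.sub_of_Hom_subset {G : QMat.{u} N} (hG : G.IsQuantumGroup)
    {H : QMat.{v} N} (h : ∀ {m n : ℕ} (k : Word m) (l : Word n), G.Hom k l ⊆ H.Hom k l) :
    H.Sub G := by
  classical
  obtain ⟨Δ, hΔ⟩ := hG.comul
  obtain ⟨ε, hε⟩ := hG.counit
  obtain ⟨S, hS⟩ := hG.antipode
  rw [sub_iff]
  intro p hp
  obtain ⟨F, c, hc⟩ := exists_sum_wordPoly p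
  let Ω := Σ t : F, (Fin t.1.1 → Fin N)
  let r' : ∀ t : F, Matrix (Fin t.1.1 → Fin N) (Fin t.1.1 → Fin N) G.coordAlg :=
    fun t => Matrix.of (G.coeff t.1.2)
  let r : Matrix Ω Ω G.coordAlg := Matrix.blockDiagonal' r'
  have hr : ∀ (t : F) I J, r ⟨t, I⟩ ⟨t, J⟩ = G.coeff t.1.2 I J := fun t I J =>
    Matrix.blockDiagonal'_apply_eq _ _ _ _
  have hr0 : ∀ (s t : F) I J, s ≠ t → r ⟨s, I⟩ ⟨t, J⟩ = 0 := fun s t I J hst =>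
    Matrix.blockDiagonal'_apply_ne _ _ _ hst
  obtain ⟨R, hRstar, hR⟩ := exists_coefficient_algebra Δ ε S r
    (by
      rintro ⟨s, I⟩ ⟨t, J⟩
      rw [sum_blockDiagonal'_mul r' (fun z a => a ⊗ₜ[ℂ] r z ⟨t, J⟩) (fun z => by simp)]
      by_cases hst : s = t
      · subst hst
        simp only [hr, comul_coeff hΔ]
        rfl
      · simp [hr0 _ _ _ _ hst])
    (by
      rintro ⟨s, I⟩ ⟨t, J⟩
      by_cases hst : s = t
      · subst hst
        have : ((⟨s, I⟩ : Ω) = ⟨s, J⟩) ↔ I = J :=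
          ⟨fun h => eq_of_heq (Sigma.mk.inj h).2, fun h => by rw [h]⟩
        simp only [hr, counit_coeff hε, this]
      · rw [hr0 _ _ _ _ hst, map_zero, if_neg fun h => hst (Sigma.mk.inj h).1])
    (by
      rintro ⟨s, I⟩ ⟨t, J⟩
      by_cases hst : s = t
      · subst hst
        simp only [hr, antipode_coeff hS]
      · simp [hr0 _ _ _ _ hst, hr0 _ _ _ _ (Ne.symm hst)])
  rw [← Module.forall_dual_apply_eq_zero_iff ℂ]
  intro ψ
  let rH' : ∀ t : F, Matrix (Fin t.1.1 → Fin N) (Fin t.1.1 → Fin N) ℂ :=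
    fun t => Matrix.of fun I J => ψ (evalPoly H.u (wordPoly t.1.2 I J))
  let M : Matrix Ω Ω ℂ := Matrix.blockDiagonal' rH'
  -- `M` collects the values of `ψ` on the coefficients over `H`. It lies in the double commutant of
  -- `R`, since the blocks of a matrix commuting with `R` are intertwiners of `G`, hence of `H`.
  have hMR : M ∈ R := by
    refine double_commutant R hRstar fun T hT => ?_
    have hT1 : ∀ x y, ∑ z, T x z • r z y = ∑ z, T z y • r x z := by
      intro x y
      rw [← sub_eq_zero, ← Module.forall_dual_apply_eq_zero_iff ℂ]
      intro φ
      have := congrFun (congrFun (hT (r.map φ) ((hR _).2 ⟨φ, rfl⟩)) x) y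
      simp only [Matrix.mul_apply, Matrix.map_apply] at this
      simp only [map_sub, map_sum, map_smul, smul_eq_mul, this, sub_eq_zero]
      exact Finset.sum_congr rfl fun _ _ => mul_comm _ _
    ext ⟨s, J⟩ ⟨t, I⟩
    have h1 : (Matrix.of fun J I => T ⟨s, J⟩ ⟨t, I⟩) ∈ G.Hom t.1.2 s.1.2 := by
      rw [mem_Hom_iff]
      intro J I
      rw [← evalGen_X_eq_zero]
      have h2 := hT1 ⟨s, J⟩ ⟨t, I⟩
      rw [sum_mul_blockDiagonal' r' (fun z a => T ⟨s, J⟩ z • a) (fun z => smul_zero _),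
        sum_blockDiagonal'_mul r' (fun z a => T z ⟨t, I⟩ • a) (fun z => smul_zero _)] at h2
      simp only [homPoly, map_sub, map_sum, map_smul, sub_eq_zero]
      exact h2
    have h3 := congrArg ψ ((mem_Hom_iff H _ _ _).1 (h _ _ h1) J I)
    simp only [homPoly, map_sub, map_sum, map_smul, sub_eq_zero, map_zero, smul_eq_mul,
      Matrix.of_apply] at h3
    rw [Matrix.mul_apply, Matrix.mul_apply,
      sum_mul_blockDiagonal' rH' (fun z a => T ⟨s, J⟩ z * a) (fun z => mul_zero _),
      sum_blockDiagonal'_mul rH' (fun z a => a * T z ⟨t, I⟩) (fun z => zero_mul _)]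
    simp only [rH', Matrix.of_apply]
    rw [h3]
    exact Finset.sum_congr rfl fun _ _ => mul_comm _ _
  -- So `ψ` on the coefficients of `H` agrees with a form `φ` on those of `G`, and `φ` vanishes on
  -- the relation `p` of `G`.
  obtain ⟨φ, hφ⟩ := (hR M).1 hMR
  have hent : ∀ (t : F) I J, ψ (evalPoly H.u (wordPoly t.1.2 I J)) = φ (G.coeff t.1.2 I J) := by
    intro t I J
    have := congrFun (congrFun hφ ⟨t, I⟩) ⟨t, J⟩
    rw [Matrix.map_apply, hr] at this
    rw [← this]
    exact (Matrix.blockDiagonal'_apply_eq rH' t I J).symm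
  rw [← evalGen_X_eq_zero] at hp
  have hfin := congrArg φ hp
  rw [hc] at hfin ⊢
  simp only [map_sum, map_smul, map_zero] at hfin ⊢
  rw [← hfin]
  refine Finset.sum_congr rfl fun t _ => Finset.sum_congr rfl fun I _ =>
    Finset.sum_congr rfl fun J _ => ?_
  rw [hent]; rfl

end QMat

/-! ### Polynomials vanishing on the unitary group -/

section Polynomials

variable {n : Type*} [Fintype n] [DecidableEq n]

/-- Diagonalize `A = V diag(λ) V*`. The polynomial `z ↦ q(V diag(z) V*)` vanishes on the torus,
where the argument is unitary, so it is zero and vanishes at `λ`. -/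
theorem eval_hermitian_eq_zero {q : MvPolynomial (n × n) ℂ}
    (h : ∀ v ∈ Matrix.unitaryGroup n ℂ, MvPolynomial.eval (fun p => v p.1 p.2) q = 0)
    {A : Matrix n n ℂ} (hA : A.IsHermitian) : MvPolynomial.eval (fun p => A p.1 p.2) q = 0 := by
  let V : Matrix n n ℂ := hA.eigenvectorUnitary
  have hV : V ∈ Matrix.unitaryGroup n ℂ := hA.eigenvectorUnitary.2
  let q' : MvPolynomial n ℂ := MvPolynomial.aeval
    (fun p : n × n => ∑ a, MvPolynomial.C (V p.1 a * star (V p.2 a)) * MvPolynomial.X a) q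
  have heval : ∀ z : n → ℂ, MvPolynomial.eval z q' =
      MvPolynomial.eval (fun p => (V * Matrix.diagonal z * star V) p.1 p.2) q := by
    intro z
    have h1 : (MvPolynomial.aeval z : MvPolynomial n ℂ →ₐ[ℂ] ℂ) q' =
      MvPolynomial.aeval (fun p => (V * Matrix.diagonal z * star V) p.1 p.2) q := by
      rw [← AlgHom.comp_apply, MvPolynomial.comp_aeval]
      congr 2
      funext p
      rw [Matrix.mul_apply]
      simp only [map_sum, map_mul, MvPolynomial.aeval_X, MvPolynomial.aeval_C,
        Matrix.star_apply, Matrix.mul_diagonal]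
      exact Finset.sum_congr rfl fun a _ => by simp; ring
    simpa [MvPolynomial.aeval_eq_eval] using h1
  have hq' : q' = 0 := by
    refine MvPolynomial.funext_set (fun _ => Metric.sphere (0 : ℂ) 1) (fun _ => ?_) ?_
    -- The unit circle is infinite, being the target of the injective map `t ↦ e^{it}` on `(0, 1)`.
    · have : Set.InjOn (fun t : ℝ => Complex.exp (t * Complex.I)) (Set.Ioo 0 1) := by
        intro s hs t ht hst
        have h1 := congrArg Complex.arg hst
        have hpi := Real.pi_gt_three
        simp only at h1
        rw [Complex.arg_exp_mul_I, Complex.arg_exp_mul_I,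
          (toIocMod_eq_self _).2, (toIocMod_eq_self _).2] at h1
        · exact h1
        · constructor <;> linarith [ht.1, ht.2]
        · constructor <;> linarith [hs.1, hs.2]
      refine Set.Infinite.mono ?_ ((Set.Ioo_infinite zero_lt_one).image this)
      rintro _ ⟨t, -, rfl⟩
      simp [Complex.norm_exp_ofReal_mul_I]
    · intro z hz
      rw [heval, map_zero]
      refine h _ (mul_mem (mul_mem hV ?_) (Unitary.star_mem hV))
      rw [Matrix.mem_unitaryGroup_iff, Matrix.star_eq_conjTranspose, Matrix.diagonal_conjTranspose,
        Matrix.diagonal_mul_diagonal, ← Matrix.diagonal_one]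
      congr 1
      funext a
      have := hz a (Set.mem_univ a)
      rw [mem_sphere_zero_iff_norm] at this
      simp [Complex.mul_conj, Complex.normSq_eq_norm_sq, this]
  have h2 := heval (fun a => (hA.eigenvalues a : ℂ))
  rw [hq', map_zero] at h2
  have h3 : A = V * Matrix.diagonal (fun a => (hA.eigenvalues a : ℂ)) * star V := by
    conv_lhs => rw [hA.spectral_theorem]
    rw [Unitary.conjStarAlgAut_apply]
    rfl
  rw [h3]
  exact h2.symm

/-- Write an arbitrary matrix as `H + iK` with `H`, `K` Hermitian. The one-variable polynomial `q(H
+ zK)` vanishes for real `z`, hence for `z = i`. -/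
theorem mvPolynomial_eq_zero_of_unitary {q : MvPolynomial (n × n) ℂ}
    (h : ∀ v ∈ Matrix.unitaryGroup n ℂ, MvPolynomial.eval (fun p => v p.1 p.2) q = 0) :
    q = 0 := by
  refine MvPolynomial.funext fun x => ?_
  rw [map_zero]
  let A : Matrix n n ℂ := Matrix.of fun i j => x (i, j)
  let H : Matrix n n ℂ := (1 / 2 : ℂ) • (A + Aᴴ)
  let K : Matrix n n ℂ := (-Complex.I / 2) • (A - Aᴴ)
  have hH : H.IsHermitian := by
    change ((1 / 2 : ℂ) • (A + Aᴴ))ᴴ = _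
    rw [Matrix.conjTranspose_smul, Matrix.conjTranspose_add, Matrix.conjTranspose_conjTranspose,
      add_comm]
    congr 1
    simp
  have hK : K.IsHermitian := by
    change ((-Complex.I / 2) • (A - Aᴴ))ᴴ = (-Complex.I / 2) • (A - Aᴴ)
    rw [Matrix.conjTranspose_smul, Matrix.conjTranspose_sub, Matrix.conjTranspose_conjTranspose,
      ← neg_sub A, smul_neg, ← neg_smul]
    congr 1
    simp [neg_div]
  let q' : Polynomial ℂ := MvPolynomial.aeval
    (fun p : n × n => Polynomial.C (H p.1 p.2) + Polynomial.C (K p.1 p.2) * Polynomial.X) q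
  have heval : ∀ z : ℂ, q'.eval z = MvPolynomial.eval (fun p => (H + z • K) p.1 p.2) q := by
    intro z
    have h1 : (Polynomial.aeval z : Polynomial ℂ →ₐ[ℂ] ℂ) q' =
        MvPolynomial.aeval (fun p => (H + z • K) p.1 p.2) q := by
      rw [← AlgHom.comp_apply, MvPolynomial.comp_aeval]
      congr 2
      funext p
      simp only [map_add, map_mul, Polynomial.aeval_C, Polynomial.aeval_X, Matrix.add_apply,
        Matrix.smul_apply, smul_eq_mul, Algebra.algebraMap_self, RingHom.id_apply]
      rw [mul_comm]
    simpa [MvPolynomial.aeval_eq_eval, Polynomial.coe_aeval_eq_eval] using h1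
  have hq' : q' = 0 := by
    refine Polynomial.eq_zero_of_infinite_isRoot _ (Set.Infinite.mono ?_
      (Set.infinite_range_of_injective Complex.ofReal_injective))
    rintro _ ⟨t, rfl⟩
    change q'.eval (t : ℂ) = 0
    rw [heval]
    refine eval_hermitian_eq_zero h (hH.add ?_)
    rw [Matrix.IsHermitian, Matrix.conjTranspose_smul, hK.eq]
    simp
  have h2 := heval Complex.I
  rw [hq', Polynomial.eval_zero] at h2
  rw [h2]
  congr 1
  congr 1
  funext p
  have : ∀ a b : ℂ, a = (1 / 2) * (a + b) + Complex.I * ((-Complex.I / 2) * (a - b)) := by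
    intro a b
    linear_combination ((a - b) / 2) * Complex.I_mul_I
  exact this (x p) _

variable {ι : Type*} [Fintype ι] [DecidableEq ι]

theorem exists_perm_of_sum_single_eq {X : Type*} {f g : ι → X}
    (h : ∑ a, Finsupp.single (f a) 1 = ∑ a, Finsupp.single (g a) (1 : ℕ)) :
    ∃ σ : Equiv.Perm ι, f = g ∘ σ := by
  classical
  have hcard : ∀ x, Fintype.card {a // f a = x} = Fintype.card {a // g a = x} := by
    intro x
    have := DFunLike.congr_fun h x
    simpa [Finsupp.finsetSum_apply, Finsupp.single_apply, Fintype.card_subtype] using this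
  let e : ∀ x, {a // f a = x} ≃ {a // g a = x} := fun x => Fintype.equivOfCardEq (hcard x)
  exact ⟨Equiv.ofFiberEquiv e, funext fun a => (Equiv.ofFiberEquiv_map e a).symm⟩

/-- The tensor powers of the unitary matrices span the symmetric tensors. -/
theorem sum_mul_symmetric_eq_zero {X : (ι → n) → (ι → n) → ℂ}
    (hX : ∀ v ∈ Matrix.unitaryGroup n ℂ, ∑ I, ∑ J, X I J * ∏ a, v (I a) (J a) = 0)
    {Y : (ι → n) → (ι → n) → ℂ} (hY : ∀ (σ : Equiv.Perm ι) I J, Y (I ∘ σ) (J ∘ σ) = Y I J) :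
    ∑ I, ∑ J, X I J * Y I J = 0 := by
  let x : (ι → n × n) → ℂ := fun f => X (fun a => (f a).1) (fun a => (f a).2)
  let y : (ι → n × n) → ℂ := fun f => Y (fun a => (f a).1) (fun a => (f a).2)
  have hsum : ∀ {M : Type} [AddCommMonoid M] (F : (ι → n) → (ι → n) → M),
      ∑ I, ∑ J, F I J = ∑ f : ι → n × n, F (fun a => (f a).1) (fun a => (f a).2) := by
    intro M _ F
    rw [← Fintype.sum_prod_type']
    exact (Fintype.sum_equiv (Equiv.arrowProdEquivProdArrow ι (fun _ => n) (fun _ => n)) _ _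
      fun _ => rfl).symm
  let mono : (ι → n × n) → (n × n →₀ ℕ) := fun f => ∑ a, Finsupp.single (f a) 1
  let q : MvPolynomial (n × n) ℂ := ∑ f, MvPolynomial.monomial (mono f) (x f)
  have hq : q = 0 := by
    refine mvPolynomial_eq_zero_of_unitary fun v hv => ?_
    rw [← hX v hv, hsum, map_sum]
    refine Finset.sum_congr rfl fun f _ => ?_
    rw [MvPolynomial.monomial_sum_index, map_mul, MvPolynomial.eval_C, map_prod]
    congr 1
    refine Finset.prod_congr rfl fun a _ => ?_
    exact MvPolynomial.eval_X _
  rw [hsum]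
  change ∑ f, x f * y f = 0
  -- Multi-indices with the same monomial are permutations of each other, so `Y` is constant on each
  -- fiber, while the sum of `X` over a fiber is a coefficient of the zero polynomial `q`.
  rw [← Finset.sum_fiberwise_of_maps_to (t := Finset.univ.image mono) (g := mono)
    (fun f _ => Finset.mem_image_of_mem _ (Finset.mem_univ f))]
  refine Finset.sum_eq_zero fun s hs => ?_
  obtain ⟨f₀, -, rfl⟩ := Finset.mem_image.1 hs
  have h1 : ∀ f ∈ Finset.univ.filter (fun f => mono f = mono f₀), x f * y f = x f * y f₀ := by
    intro f hf
    obtain ⟨σ, rfl⟩ := exists_perm_of_sum_single_eq (Finset.mem_filter.1 hf).2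
    exact congrArg (x (f₀ ∘ σ) * ·) (hY σ (fun a => (f₀ a).1) (fun a => (f₀ a).2))
  rw [Finset.sum_congr rfl h1, ← Finset.sum_mul]
  have h2 := congrArg (MvPolynomial.coeff (mono f₀)) hq
  rw [MvPolynomial.coeff_sum] at h2
  simp only [MvPolynomial.coeff_monomial, MvPolynomial.coeff_zero] at h2
  rw [← Finset.sum_filter] at h2
  rw [h2, zero_mul]

/-! ### Schur-Weyl duality for the unitary group -/

/-- The tensor product of a family of matrices. -/
def tprod (A : ι → Matrix n n ℂ) : Matrix (ι → n) (ι → n) ℂ :=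
  Matrix.of fun I J => ∏ a, A a (I a) (J a)

/-- The operator permuting the factors of a tensor power. -/
def permOp (n : Type*) [DecidableEq n] (σ : Equiv.Perm ι) : Matrix (ι → n) (ι → n) ℂ :=
  Matrix.of fun I J => if I = J ∘ σ then 1 else 0

theorem permOp_mul (σ τ : Equiv.Perm ι) : permOp n τ * permOp n σ = permOp n (σ * τ) := by
  ext I J
  simp [permOp, Matrix.mul_apply, Function.comp_assoc]
  rfl

theorem permOp_one : permOp n (1 : Equiv.Perm ι) = 1 := by
  ext I J
  simp [permOp, Matrix.one_apply]

theorem eq_comp_perm_iff {σ : Equiv.Perm ι} {I J : ι → n} : I = J ∘ σ ↔ J = I ∘ ⇑σ⁻¹ := by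
  constructor
  · rintro rfl; funext a; simp
  · rintro rfl; funext a; simp

theorem permOp_conjTranspose (σ : Equiv.Perm ι) : (permOp n σ)ᴴ = permOp n σ⁻¹ := by
  ext I J
  simp only [permOp, Matrix.conjTranspose_apply, Matrix.of_apply, eq_comp_perm_iff (σ := σ)]
  split_ifs <;> simp

/-- Schur-Weyl duality. The permutation operators span a self-adjoint algebra whose commutant
consists of the symmetric matrices `Y`. By polarization, what commutes with all `v^{⊗ι}` commutes
with every such `Y`, and the double commutant theorem concludes. -/
theorem mem_span_permOp {T : Matrix (ι → n) (ι → n) ℂ}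
    (hT : ∀ v ∈ Matrix.unitaryGroup n ℂ, T * tprod (fun _ => v) = tprod (fun _ => v) * T) :
    T ∈ Submodule.span ℂ (Set.range (permOp (ι := ι) n)) := by
  let R : Subalgebra ℂ (Matrix (ι → n) (ι → n) ℂ) :=
    (Submodule.span ℂ (Set.range (permOp (ι := ι) n))).toSubalgebra
      (by rw [← permOp_one]; exact Submodule.subset_span ⟨_, rfl⟩)
      (by
        intro A B hA hB
        have := Submodule.mul_mem_mul hA hB
        rw [Submodule.span_mul_span] at this
        refine Submodule.span_mono ?_ this
        rintro _ ⟨_, ⟨σ, rfl⟩, _, ⟨τ, rfl⟩, rfl⟩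
        exact ⟨τ * σ, (permOp_mul _ _).symm⟩)
  refine double_commutant R ?_ ?_
  · intro A hA
    change A ∈ Submodule.span ℂ _ at hA
    change Aᴴ ∈ Submodule.span ℂ (Set.range (permOp (ι := ι) n))
    induction hA using Submodule.span_induction with
    | mem A hA =>
      obtain ⟨σ, rfl⟩ := hA
      rw [permOp_conjTranspose]
      exact Submodule.subset_span ⟨_, rfl⟩
    | zero => simp
    | add A B _ _ hA hB => rw [Matrix.conjTranspose_add]; exact add_mem hA hB
    | smul c A _ hA => rw [Matrix.conjTranspose_smul]; exact Submodule.smul_mem _ _ hA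
  · intro Y hY
    have hsymm : ∀ (σ : Equiv.Perm ι) I J, Y (I ∘ σ) (J ∘ σ) = Y I J := by
      intro σ I J
      have := congrFun (congrFun (hY (permOp n σ) (Submodule.subset_span ⟨σ, rfl⟩)) (I ∘ σ)) J
      simp only [permOp, Matrix.mul_apply, Matrix.of_apply] at this
      simpa [(Function.Surjective.injective_comp_right σ.surjective).eq_iff] using this
    ext a b
    have key := sum_mul_symmetric_eq_zero (n := n)
      -- Chosen so that pairing `X` with a matrix `Z` gives the entry `(a, b)` of `T Z - Z T`.
      (X := fun I J => T a I * (if J = b then 1 else 0) - (if a = I then 1 else 0) * T J b)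
      (fun v hv => by
        have := congrFun (congrFun (hT v hv) a) b
        simp only [Matrix.mul_apply, tprod, Matrix.of_apply] at this
        simp only [sub_mul, Finset.sum_sub_distrib, sub_eq_zero]
        simp [this, mul_comm]) (Y := Y) hsymm
    simp only [sub_mul, Finset.sum_sub_distrib, sub_eq_zero] at key
    simp at key
    rw [Matrix.mul_apply, Matrix.mul_apply, key]
    exact Finset.sum_congr rfl fun _ _ => mul_comm _ _

end Polynomials

/-! ### Intertwiners of twisted tensor powers -/

section Twisted

variable {n : Type*} [Fintype n] [DecidableEq n] {ι κ : Type*} [Fintype ι] [Fintype κ]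
  [DecidableEq ι] [DecidableEq κ]

theorem tprod_mul (A B : ι → Matrix n n ℂ) : tprod A * tprod B = tprod fun a => A a * B a := by
  ext I J
  simp only [tprod, Matrix.mul_apply, Matrix.of_apply, Finset.prod_univ_sum,
    Fintype.piFinset_univ, Finset.prod_mul_distrib]

theorem tprod_one : tprod (fun _ : ι => (1 : Matrix n n ℂ)) = 1 := by
  ext I J
  simp only [tprod, Matrix.of_apply, Matrix.one_apply, Finset.prod_ite_zero, Finset.prod_const_one,
    funext_iff, Finset.mem_univ, true_implies]

theorem tprod_conjTranspose (A : ι → Matrix n n ℂ) : (tprod A)ᴴ = tprod fun a => (A a)ᴴ := by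
  ext I J
  simp [tprod]

theorem tprod_unitary {A : ι → Matrix n n ℂ} (hA : ∀ a, A a ∈ Matrix.unitaryGroup n ℂ) :
    tprod A * (tprod A)ᴴ = 1 ∧ (tprod A)ᴴ * tprod A = 1 := by
  rw [tprod_conjTranspose, tprod_mul, tprod_mul]
  have h1 : ∀ a, A a * (A a)ᴴ = 1 := fun a => Matrix.mem_unitaryGroup_iff.1 (hA a)
  have h2 : ∀ a, (A a)ᴴ * A a = 1 := fun a => Matrix.mem_unitaryGroup_iff'.1 (hA a)
  simp only [h1, h2, tprod_one, and_self]

/-- Frobenius duality between intertwiners and fixed vectors. -/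
theorem intertwines_iff_fixed {B : ι → Matrix n n ℂ} {C : κ → Matrix n n ℂ}
    (hB : ∀ a, B a ∈ Matrix.unitaryGroup n ℂ) (T : Matrix (κ → n) (ι → n) ℂ) :
    T * tprod B = tprod C * T ↔
      tprod (Sum.elim (fun i => (B i).map star) C) *ᵥ (fun K => T (K ∘ Sum.inr) (K ∘ Sum.inl)) =
        fun K => T (K ∘ Sum.inr) (K ∘ Sum.inl) := by
  have h1 : T * tprod B = tprod C * T ↔ tprod C * T * (tprod B)ᴴ = T := by
    constructor
    · intro h
      rw [← h, Matrix.mul_assoc, (tprod_unitary hB).1, Matrix.mul_one]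
    · intro h
      conv_lhs => rw [← h]
      rw [Matrix.mul_assoc, (tprod_unitary hB).2, Matrix.mul_one]
  have h2 : ∀ I : ι ⊕ κ → n, (tprod (Sum.elim (fun i => (B i).map star) C) *ᵥ
      (fun K => T (K ∘ Sum.inr) (K ∘ Sum.inl))) I =
        (tprod C * T * (tprod B)ᴴ) (I ∘ Sum.inr) (I ∘ Sum.inl) := by
    intro I
    rw [Matrix.mulVec, dotProduct,
      Fintype.sum_equiv (Equiv.sumArrowEquivProdArrow ι κ n) _ (fun K =>
        (∏ i, star (B i (I (Sum.inl i)) (K.1 i))) * (∏ j, C j (I (Sum.inr j)) (K.2 j)) *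
          T K.2 K.1) (fun K => by
            simp only [tprod, Matrix.of_apply, Fintype.prod_sum_type, Sum.elim_inl,
              Sum.elim_inr, Matrix.map_apply]
            rfl), Fintype.sum_prod_type, Matrix.mul_apply]
    refine Finset.sum_congr rfl fun K _ => ?_
    rw [Matrix.mul_apply, Finset.sum_mul]
    refine Finset.sum_congr rfl fun K' _ => ?_
    simp only [tprod, Matrix.of_apply, Matrix.conjTranspose_apply, star_prod, Function.comp]
    ring
  rw [h1]
  constructor
  · intro h
    funext I
    rw [h2, h]
  · intro h
    ext J I
    have := congrFun h (Sum.elim I J)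
    rw [h2] at this
    simpa using this

/-- Fixed vectors do not remember the order of the legs. This is the reason for passing from
intertwiners to vectors: the legs of an alternating word can then be sorted by color. -/
theorem fixed_reindex_iff (e : κ ≃ ι) (A : ι → Matrix n n ℂ) (ξ : (ι → n) → ℂ) :
    tprod A *ᵥ ξ = ξ ↔ tprod (A ∘ e) *ᵥ (fun K => ξ (K ∘ e.symm)) = fun K => ξ (K ∘ e.symm) := by
  have h : ∀ I : κ → n, (tprod (A ∘ e) *ᵥ (fun K => ξ (K ∘ e.symm))) I =
      (tprod A *ᵥ ξ) (I ∘ e.symm) := by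
    intro I
    rw [Matrix.mulVec, dotProduct, Matrix.mulVec, dotProduct]
    refine Fintype.sum_equiv (Equiv.arrowCongr e (Equiv.refl n)) _ _ fun K => ?_
    simp only [tprod, Matrix.of_apply, Function.comp, Equiv.arrowCongr_apply, Equiv.refl_apply]
    congr 1
    exact Fintype.prod_equiv e _ _ fun p => by simp
  constructor
  · intro h'
    funext I
    rw [h, h']
  · intro h'
    funext I
    have := congrFun h' (I ∘ e)
    rw [h] at this
    simpa [Function.comp_assoc] using this

/-- A matrix or its conjugate, according to the color. -/
def conjIf (c : Bool) (v : Matrix n n ℂ) : Matrix n n ℂ := if c then v.map star else v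

theorem map_star_mem_unitaryGroup {v : Matrix n n ℂ} (hv : v ∈ Matrix.unitaryGroup n ℂ) :
    v.map star ∈ Matrix.unitaryGroup n ℂ := by
  rw [Matrix.mem_unitaryGroup_iff'] at *
  have : star (v.map star) * v.map star = (star v * v).map star := by
    ext i j
    simp [Matrix.mul_apply]
  rw [this, hv]
  exact Matrix.map_one _ (star_zero _) (star_one _)

theorem conjIf_mem {v : Matrix n n ℂ} (hv : v ∈ Matrix.unitaryGroup n ℂ) (c : Bool) :
    conjIf c v ∈ Matrix.unitaryGroup n ℂ := by
  cases c
  · exact hv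
  · exact map_star_mem_unitaryGroup hv

theorem conjIf_not_map_star (c : Bool) (v : Matrix n n ℂ) :
    (conjIf (!c) v).map star = conjIf c v := by
  cases c
  · ext; simp [conjIf]
  · rfl

end Twisted

/-! ### Pairings as permutations, after sorting the legs by color -/

section Pairings

variable {N m n : ℕ}

/-- `T` intertwines the tensor powers of all the unitary matrices, with the matrices corresponding
to the lower points `b` with `ε b = true`, and to the upper points `a` with `ε a = false`, being
conjugated. -/
def Intertwines (ε : Fin m ⊕ Fin n → Bool) (T : Matrix (Fin n → Fin N) (Fin m → Fin N) ℂ)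
    (v : Matrix (Fin N) (Fin N) ℂ) : Prop :=
  T * tprod (fun i => conjIf (!ε (Sum.inl i)) v) = tprod (fun j => conjIf (ε (Sum.inr j)) v) * T

theorem intertwines_iff {ε : Fin m ⊕ Fin n → Bool} {T : Matrix (Fin n → Fin N) (Fin m → Fin N) ℂ}
    {v : Matrix (Fin N) (Fin N) ℂ} (hv : v ∈ Matrix.unitaryGroup (Fin N) ℂ) :
    Intertwines ε T v ↔
      tprod (fun p => conjIf (ε p) v) *ᵥ (fun K => T (K ∘ Sum.inr) (K ∘ Sum.inl)) =
        fun K => T (K ∘ Sum.inr) (K ∘ Sum.inl) := by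
  rw [Intertwines, intertwines_iff_fixed fun i => conjIf_mem hv _]
  simp only [conjIf_not_map_star]
  have : (Sum.elim (fun i => conjIf (ε (Sum.inl i)) v) fun j => conjIf (ε (Sum.inr j)) v) =
      fun p => conjIf (ε p) v := by
    funext p; cases p <;> rfl
  rw [this]

variable {ι : Type*} [Fintype ι] [DecidableEq ι]

/-- Moving the legs of a matrix according to a bijection between the sets of legs. -/
def moveLegs (N : ℕ) (e : ι ⊕ ι ≃ Fin m ⊕ Fin n) : Matrix (ι → Fin N) (ι → Fin N) ℂ →ₗ[ℂ]
    Matrix (Fin n → Fin N) (Fin m → Fin N) ℂ where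
  toFun T := Matrix.of fun J I => T (Sum.elim I J ∘ e ∘ Sum.inr) (Sum.elim I J ∘ e ∘ Sum.inl)
  map_add' _ _ := rfl
  map_smul' _ _ := rfl

theorem moveLegs_apply (e : ι ⊕ ι ≃ Fin m ⊕ Fin n) (T : Matrix (ι → Fin N) (ι → Fin N) ℂ)
    (J : Fin n → Fin N) (I : Fin m → Fin N) :
    moveLegs N e T J I = T (Sum.elim I J ∘ e ∘ Sum.inr) (Sum.elim I J ∘ e ∘ Sum.inl) :=
  rfl

/-- Frobenius duality is used twice, with a reindexing of the legs in between: the legs colored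
`true` become inputs and those colored `false` become outputs of an operator commuting with
`v^{⊗ι}`. -/
theorem intertwines_moveLegs_iff {ε : Fin m ⊕ Fin n → Bool} (e : ι ⊕ ι ≃ Fin m ⊕ Fin n)
    (h₁ : ∀ a, ε (e (Sum.inl a)) = true) (h₂ : ∀ a, ε (e (Sum.inr a)) = false)
    (T : Matrix (ι → Fin N) (ι → Fin N) ℂ) {v : Matrix (Fin N) (Fin N) ℂ}
    (hv : v ∈ Matrix.unitaryGroup (Fin N) ℂ) :
    Intertwines ε (moveLegs N e T) v ↔ T * tprod (fun _ => v) = tprod (fun _ => v) * T := by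
  rw [intertwines_iff hv, fixed_reindex_iff e, intertwines_iff_fixed fun _ => hv]
  have h3 : ((fun p => conjIf (ε p) v) ∘ e) = Sum.elim (fun _ => v.map star) (fun _ => v) := by
    funext p
    rcases p with a | a
    · simp [h₁, conjIf]
    · simp [h₂, conjIf]
  have h4 : (fun K : ι ⊕ ι → Fin N => moveLegs N e T ((K ∘ e.symm) ∘ Sum.inr)
      ((K ∘ e.symm) ∘ Sum.inl)) = fun K => T (K ∘ Sum.inr) (K ∘ Sum.inl) := by
    funext K
    simp only [moveLegs_apply, Sum.elim_comp_inl_inr]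
    congr 1 <;> funext a <;> simp
  rw [h3, h4]

theorem exists_moveLegs_eq (e : ι ⊕ ι ≃ Fin m ⊕ Fin n)
    (T : Matrix (Fin n → Fin N) (Fin m → Fin N) ℂ) : ∃ T', moveLegs N e T' = T := by
  refine ⟨Matrix.of fun J I => T (Sum.elim I J ∘ e.symm ∘ Sum.inr)
    (Sum.elim I J ∘ e.symm ∘ Sum.inl), ?_⟩
  ext J I
  simp only [moveLegs_apply, Matrix.of_apply]
  have : (Sum.elim (Sum.elim I J ∘ e ∘ Sum.inl) (Sum.elim I J ∘ e ∘ Sum.inr)) =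
      Sum.elim I J ∘ e := by
    funext p; cases p <;> rfl
  rw [this]
  congr 1 <;> funext a <;> simp

/-- The pairing joining the leg `inr a` to the leg `inl (σ a)`. -/
@[reducible]
def legPart (e : ι ⊕ ι ≃ Fin m ⊕ Fin n) (σ : Equiv.Perm ι) : Part m n :=
  Setoid.ker fun p => Sum.elim id σ (e.symm p)

theorem moveLegs_permOp (e : ι ⊕ ι ≃ Fin m ⊕ Fin n) (σ : Equiv.Perm ι) :
    moveLegs N e (permOp (Fin N) σ) = Tmap N (legPart e σ) := by
  classical
  ext J I
  rw [Tmap_apply]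
  simp only [moveLegs_apply, Matrix.of_apply, permOp]
  congr 1
  rw [eq_iff_iff]
  constructor
  · intro h p q hpq
    have key : ∀ p, Sum.elim I J p = Sum.elim I J (e (Sum.inl (Sum.elim id σ (e.symm p)))) := by
      intro p
      obtain ⟨p, rfl⟩ := e.surjective p
      rcases p with a | a
      · simp
      · simpa using congrFun h a
    rw [Setoid.ker_def, key p, key q]
    rw [show Sum.elim id σ (e.symm p) = Sum.elim id σ (e.symm q) from hpq]
  · intro h
    funext a
    exact @h (e (Sum.inr a)) (e (Sum.inl (σ a))) (by simp [Setoid.ker_def])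

/-- The first fundamental theorem for the unitary group: the intertwiners come from pairings. -/
theorem mem_span_of_intertwines {ε : Fin m ⊕ Fin n → Bool} (e : ι ⊕ ι ≃ Fin m ⊕ Fin n)
    (h₁ : ∀ a, ε (e (Sum.inl a)) = true) (h₂ : ∀ a, ε (e (Sum.inr a)) = false)
    {T : Matrix (Fin n → Fin N) (Fin m → Fin N) ℂ}
    (hT : ∀ v ∈ Matrix.unitaryGroup (Fin N) ℂ, Intertwines ε T v) :
    T ∈ Submodule.span ℂ (Tmap N ''
      {π | IsPairing π ∧ ∀ a b, a ≠ b → π a b → ε a ≠ ε b}) := by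
  obtain ⟨T, rfl⟩ := exists_moveLegs_eq e T
  have h := mem_span_permOp fun v hv => (intertwines_moveLegs_iff e h₁ h₂ T hv).1 (hT v hv)
  have h' := Submodule.mem_map_of_mem (f := moveLegs N e) h
  rw [Submodule.map_span] at h'
  refine Submodule.span_mono ?_ h'
  rintro _ ⟨_, ⟨σ, rfl⟩, rfl⟩
  refine ⟨legPart e σ, ⟨?_, ?_⟩, (moveLegs_permOp e σ).symm⟩
  · intro p
    obtain ⟨p, rfl⟩ := e.surjective p
    rcases p with a | a
    · refine ⟨e (Sum.inr (σ.symm a)), ⟨by simp, by simp [Setoid.ker_def]⟩, ?_⟩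
      intro q hq
      obtain ⟨q, rfl⟩ := e.surjective q
      rcases q with b | b
      · exact absurd (by simpa [Setoid.ker_def] using hq.2) (fun h : a = b => hq.1 (by rw [h]))
      · have : a = σ b := by simpa [Setoid.ker_def] using hq.2
        rw [this, Equiv.symm_apply_apply]
    · refine ⟨e (Sum.inl (σ a)), ⟨by simp, by simp [Setoid.ker_def]⟩, ?_⟩
      intro q hq
      obtain ⟨q, rfl⟩ := e.surjective q
      rcases q with b | b
      · have : σ a = b := by simpa [Setoid.ker_def] using hq.2
        rw [this]
      · exact absurd (by simpa [Setoid.ker_def] using hq.2) (fun h : a = b => hq.1 (by rw [h]))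
  · intro p q hpq hr
    obtain ⟨p, rfl⟩ := e.surjective p
    obtain ⟨q, rfl⟩ := e.surjective q
    rcases p with a | a <;> rcases q with b | b
    · exact absurd (by simpa [Setoid.ker_def] using hr) (fun h : a = b => hpq (by rw [h]))
    · simp [h₁, h₂]
    · simp [h₁, h₂]
    · exact absurd (by simpa [Setoid.ker_def] using hr) (fun h : a = b => hpq (by rw [h]))

/-- Use the `true` end of each string as input and its partner as the matching output: `T_π` is then
the identity with its legs moved. -/
theorem Tmap_intertwines {ε : Fin m ⊕ Fin n → Bool} {π : Part m n} (hπ : IsPairing π)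
    (hε : ∀ a b, a ≠ b → π a b → ε a ≠ ε b) {v : Matrix (Fin N) (Fin N) ℂ}
    (hv : v ∈ Matrix.unitaryGroup (Fin N) ℂ) : Intertwines ε (Tmap N π) v := by
  classical
  choose f hf hfu using hπ
  have hff : ∀ a, f (f a) = a := fun a =>
    (hfu (f a) a ⟨(hf a).1.symm, π.symm' (hf a).2⟩).symm
  have hεf : ∀ a, ε (f a) = !ε a := fun a => by
    have := hε a (f a) (hf a).1.symm (hf a).2
    cases h1 : ε a <;> cases h2 : ε (f a) <;> simp_all
  let ι := {p // ε p = true}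
  let g : ι ⊕ ι → Fin m ⊕ Fin n := Sum.elim (fun p => p.1) (fun p => f p.1)
  have hg : Function.Bijective g := by
    constructor
    · rintro (a | a) (b | b) h
      · exact congrArg Sum.inl (Subtype.ext h)
      · have h' : a.1 = f b.1 := h
        have := hεf b.1
        rw [← h', a.2, b.2] at this
        simp at this
      · have h' : f a.1 = b.1 := h
        have := hεf a.1
        rw [h', a.2, b.2] at this
        simp at this
      · have h' : f a.1 = f b.1 := h
        exact congrArg Sum.inr (Subtype.ext (by rw [← hff a.1, h', hff]))
    · intro p
      cases h : ε p
      · exact ⟨Sum.inr ⟨f p, by rw [hεf, h]; rfl⟩, hff p⟩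
      · exact ⟨Sum.inl ⟨p, h⟩, rfl⟩
  let e : ι ⊕ ι ≃ Fin m ⊕ Fin n := Equiv.ofBijective g hg
  have h1 : moveLegs N e 1 = Tmap N π := by
    ext J I
    rw [Tmap_apply]
    simp only [moveLegs_apply, Matrix.one_apply]
    congr 1
    rw [eq_iff_iff]
    constructor
    · intro h a b hab
      rw [Setoid.ker_def]
      by_cases hne : b = a
      · rw [hne]
      · obtain rfl := hfu a b ⟨hne, hab⟩
        cases hc : ε a
        · have := congrFun h ⟨f a, by rw [hεf, hc]; rfl⟩
          have : Sum.elim I J (f (f a)) = Sum.elim I J (f a) := this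
          rwa [hff] at this
        · exact (congrFun h ⟨a, hc⟩).symm
    · intro h
      funext p
      exact (h (hf p.1).2).symm
  rw [← h1, intertwines_moveLegs_iff e (fun p => p.2) (fun p => ?_) 1 hv, Matrix.one_mul,
    Matrix.mul_one]
  change ε (f p.1) = false
  rw [hεf, p.2]; rfl

/-! ### Partitions which give intertwiners are pairings -/

/-- Labelings constant on blocks are functions on the quotient, so the sum factors into power sums,
one for each block. -/
theorem sum_prod_ker {Z ν : Type*} [Fintype Z] [DecidableEq Z] [Fintype ν] [DecidableEq ν]
    (s : Setoid Z) [DecidableRel s] [Fintype (Quotient s)] [DecidableEq (Quotient s)]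
    [∀ K : Z → ν, Decidable (s ≤ Setoid.ker K)] (x : ν → ℂ) :
    ∑ K : Z → ν, (∏ p, x (K p)) * (if s ≤ Setoid.ker K then 1 else 0) =
      ∏ β : Quotient s, ∑ i, x i ^ (Finset.univ.filter fun p => Quotient.mk s p = β).card := by
  rw [Finset.prod_univ_sum, Fintype.piFinset_univ]
  simp only [mul_ite, mul_one, mul_zero]
  rw [← Finset.sum_filter]
  refine (Finset.sum_bij (fun (F : Quotient s → ν) _ => F ∘ Quotient.mk s) ?_ ?_ ?_ ?_).symm
  · intro F _
    simp only [Finset.mem_filter, Finset.mem_univ, true_and]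
    intro a b hab
    rw [Setoid.ker_def, Function.comp, Function.comp, Quotient.sound hab]
  · intro F _ F' _ h
    exact (Quotient.mk_surjective).injective_comp_right h
  · intro K hK
    simp only [Finset.mem_filter, Finset.mem_univ, true_and] at hK
    exact ⟨Quotient.lift K fun a b hab => hK hab, Finset.mem_univ _, rfl⟩
  · intro F _
    have : ∏ p, x (F (Quotient.mk s p)) = ∏ β, ∏ p ∈ Finset.univ.filter
        (fun p => Quotient.mk s p = β), x (F (Quotient.mk s p)) :=
      (Finset.prod_fiberwise _ _ _).symm
    simp only [Function.comp]
    rw [this]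
    refine Finset.prod_congr rfl fun β _ => ?_
    rw [Finset.prod_congr rfl (g := fun _ => x (F β)) (fun p hp => by
      rw [(Finset.mem_filter.1 hp).2]), Finset.prod_const]

/-- A single real reflection suffices. Its first row is `(3/5, -4/5, 0, …)`, and the fixed vector
equation at the constant label `i₀` says that the product of `(3/5)^r + (-4/5)^r` over the block
sizes `r` equals 1. Each factor has modulus at most 1, with equality only for `r = 2`. -/
theorem isPairing_of_intertwines (hN : 2 ≤ N) {π : Part m n}
    (h : ∀ g ∈ Matrix.unitaryGroup (Fin N) ℂ, g.map star = g →
      Tmap N π * tprod (fun _ : Fin m => g) = tprod (fun _ : Fin n => g) * Tmap N π) :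
    IsPairing π := by
  classical
  let i₀ : Fin N := ⟨0, by omega⟩
  let i₁ : Fin N := ⟨1, by omega⟩
  have h01 : i₀ ≠ i₁ := by simp [i₀, i₁]
  -- The vector `(1, 2, 0, …)` has squared norm 5, so `1 - (2/5) a aᵗ` is the reflection orthogonal
  -- to it.
  let a : Fin N → ℂ := fun i => if i = i₀ then 1 else if i = i₁ then 2 else 0
  have ha2 : ∑ i, a i * a i = 5 := by
    rw [← Finset.sum_subset (Finset.subset_univ {i₀, i₁}), Finset.sum_pair h01]
    · simp [a, h01.symm]; norm_num
    · intro i _ hi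
      simp only [Finset.mem_insert, Finset.mem_singleton, not_or] at hi
      simp [a, hi.1, hi.2]
  have hastar : ∀ i, star (a i) = a i := by
    intro i; simp only [a]; split_ifs <;> simp
  let g : Matrix (Fin N) (Fin N) ℂ := 1 - (2 / 5 : ℂ) • Matrix.vecMulVec a a
  have hgent : ∀ i j, g i j = (1 : Matrix (Fin N) (Fin N) ℂ) i j - 2 / 5 * (a i * a j) := by
    intro i j
    simp [g, Matrix.vecMulVec_apply]
  have hgstar : g.map star = g := by
    ext i j
    rw [Matrix.map_apply, hgent, star_sub, star_mul', star_mul', hastar, hastar, Matrix.one_apply]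
    congr 1
    · split_ifs <;> simp
    · congr 1; simp
  have hgT : gᵀ = g := by
    ext i j
    rw [Matrix.transpose_apply, hgent, hgent, mul_comm (a j), Matrix.one_apply, Matrix.one_apply]
    simp only [eq_comm]
  have hgH : star g = g := by
    rw [Matrix.star_eq_conjTranspose, Matrix.conjTranspose, hgT, hgstar]
  have hg : g ∈ Matrix.unitaryGroup (Fin N) ℂ := by
    rw [Matrix.mem_unitaryGroup_iff, hgH]
    ext i j
    rw [Matrix.mul_apply]
    simp only [hgent]
    have : ∀ k, ((1 : Matrix (Fin N) (Fin N) ℂ) i k - 2 / 5 * (a i * a k)) *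
        ((1 : Matrix (Fin N) (Fin N) ℂ) k j - 2 / 5 * (a k * a j)) =
        (1 : Matrix (Fin N) (Fin N) ℂ) i k * (1 : Matrix (Fin N) (Fin N) ℂ) k j -
        (1 : Matrix (Fin N) (Fin N) ℂ) i k * (2 / 5 * (a k * a j)) -
        2 / 5 * (a i * a k) * (1 : Matrix (Fin N) (Fin N) ℂ) k j +
        4 / 25 * a i * a j * (a k * a k) := fun k => by ring
    simp only [this, Finset.sum_add_distrib, Finset.sum_sub_distrib, ← Finset.mul_sum, ha2]
    simp only [Matrix.one_apply, ite_mul, one_mul, zero_mul, mul_ite, mul_one, mul_zero,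
      Finset.sum_ite_eq, Finset.sum_ite_eq', Finset.mem_univ, if_true]
    ring
  have h1 := congrFun ((intertwines_iff_fixed (fun _ => hg) _).1 (h g hg hgstar)) (fun _ => i₀)
  simp only [hgstar] at h1
  have h2 : (Sum.elim (fun _ : Fin m => g) fun _ : Fin n => g) = fun _ => g := by
    funext p; cases p <;> rfl
  rw [h2, Matrix.mulVec, dotProduct] at h1
  simp only [Tmap_apply, Sum.elim_comp_inl_inr, tprod, Matrix.of_apply] at h1
  rw [sum_prod_ker π (g i₀), if_pos (show π ≤ Setoid.ker fun _ => i₀ from fun _ _ _ => rfl)] at h1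
  have hf : ∀ r, 0 < r → ∑ i, g i₀ i ^ r = (3 / 5) ^ r + (-4 / 5) ^ r := by
    intro r hr
    rw [← Finset.sum_subset (Finset.subset_univ {i₀, i₁}), Finset.sum_pair h01]
    · congr 2 <;> rw [hgent] <;> simp [a, h01, h01.symm] <;> norm_num
    · intro i _ hi
      simp only [Finset.mem_insert, Finset.mem_singleton, not_or] at hi
      rw [hgent, Matrix.one_apply_ne (Ne.symm hi.1)]
      simp [a, hi.1, hi.2, hr.ne']
  have hnorm : ∀ r, 0 < r → ‖∑ i, g i₀ i ^ r‖ ≤ 1 ∧ (‖∑ i, g i₀ i ^ r‖ = 1 → r = 2) := by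
    intro r hr
    rw [hf r hr]
    rcases Nat.lt_or_ge r 3 with h3 | h3
    · interval_cases r
      · norm_num
      · norm_num
    · have : ‖(3 / 5 : ℂ) ^ r + (-4 / 5) ^ r‖ < 1 := by
        calc ‖(3 / 5 : ℂ) ^ r + (-4 / 5) ^ r‖ ≤ ‖(3 / 5 : ℂ) ^ r‖ + ‖(-4 / 5 : ℂ) ^ r‖ :=
              norm_add_le _ _
          _ = (3 / 5 : ℝ) ^ r + (4 / 5) ^ r := by
              rw [norm_pow, norm_pow]; norm_num
          _ ≤ (3 / 5 : ℝ) ^ 3 + (4 / 5) ^ 3 := by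
              gcongr ?_ + ?_ <;> exact pow_le_pow_of_le_one (by norm_num) (by norm_num) h3
          _ < 1 := by norm_num
      exact ⟨this.le, fun h => absurd h this.ne⟩
  have hpos : ∀ β : Quotient π, 0 < (Finset.univ.filter fun p => Quotient.mk π p = β).card := by
    intro β
    obtain ⟨p, rfl⟩ := Quotient.exists_rep β
    exact Finset.card_pos.2 ⟨p, by simp⟩
  have hcard : ∀ β : Quotient π, (Finset.univ.filter fun p => Quotient.mk π p = β).card = 2 := by
    intro β
    refine (hnorm _ (hpos β)).2 (le_antisymm (hnorm _ (hpos β)).1 ?_)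
    have h3 := congrArg norm h1
    rw [norm_prod, norm_one, ← Finset.mul_prod_erase _ _ (Finset.mem_univ β)] at h3
    have h4 : ∏ β' ∈ Finset.univ.erase β, ‖∑ i, g i₀ i ^
        (Finset.univ.filter fun p => Quotient.mk π p = β').card‖ ≤ 1 :=
      Finset.prod_le_one (fun _ _ => norm_nonneg _) fun β' _ => (hnorm _ (hpos β')).1
    rw [← h3]
    exact mul_le_of_le_one_right (norm_nonneg _) h4
  intro p
  obtain ⟨x, y, hxy, hset⟩ := Finset.card_eq_two.1 (hcard (Quotient.mk π p))
  have hmem : ∀ q, π p q ↔ q = x ∨ q = y := by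
    intro q
    have h3 : q ∈ Finset.univ.filter (fun q => Quotient.mk π q = Quotient.mk π p) ↔
      q = x ∨ q = y := by rw [hset]; simp
    rw [← h3, Finset.mem_filter, Quotient.eq]
    simp only [Finset.mem_univ, true_and]
    exact π.comm'
  rcases (hmem p).1 (π.refl' p) with rfl | rfl
  · exact ⟨y, ⟨hxy.symm, (hmem y).2 (Or.inr rfl)⟩, fun q hq =>
      ((hmem q).1 hq.2).resolve_left hq.1⟩
  · exact ⟨x, ⟨hxy, (hmem x).2 (Or.inl rfl)⟩, fun q hq =>
      ((hmem q).1 hq.2).resolve_right hq.1⟩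

/-- Test on `diag(i, 1, …)`, with a labeling equal to `i₀` exactly on the string `{p, q}`. Only the
diagonal term survives, and equal colors would give `(±i)² = -1` instead of 1. -/
theorem color_ne_of_intertwines (hN : 2 ≤ N) {ε : Fin m ⊕ Fin n → Bool} {π : Part m n}
    (hπ : IsPairing π)
    (h : ∀ v ∈ Matrix.unitaryGroup (Fin N) ℂ, Intertwines ε (Tmap N π) v)
    (p q : Fin m ⊕ Fin n) (hpq : p ≠ q) (hr : π p q) : ε p ≠ ε q := by
  classical
  let i₀ : Fin N := ⟨0, by omega⟩
  let i₁ : Fin N := ⟨1, by omega⟩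
  have h01 : i₁ ≠ i₀ := by simp [i₀, i₁]
  let d : Fin N → ℂ := fun i => if i = i₀ then Complex.I else 1
  have hv : Matrix.diagonal d ∈ Matrix.unitaryGroup (Fin N) ℂ := by
    rw [Matrix.mem_unitaryGroup_iff, Matrix.star_eq_conjTranspose, Matrix.diagonal_conjTranspose,
      Matrix.diagonal_mul_diagonal, ← Matrix.diagonal_one]
    congr 1
    funext i
    simp only [d, Pi.star_apply]
    split_ifs <;> simp
  let L : Fin m ⊕ Fin n → Fin N := fun z => if z = p ∨ z = q then i₀ else i₁
  have hL : π ≤ Setoid.ker L := by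
    have hcl : ∀ a b, π a b → (a = p ∨ a = q) → (b = p ∨ b = q) := by
      intro a b hab ha
      by_contra hb
      rw [not_or] at hb
      rcases ha with rfl | rfl
      · exact hb.2 ((hπ a).unique ⟨hb.1, hab⟩ ⟨hpq.symm, hr⟩)
      · exact hb.1 ((hπ a).unique ⟨hb.2, hab⟩ ⟨hpq, π.symm' hr⟩)
    intro a b hab
    have : (a = p ∨ a = q) ↔ (b = p ∨ b = q) := ⟨hcl a b hab, hcl b a (π.symm' hab)⟩
    simp only [Setoid.ker_def, L, this]
  have h1 := congrFun ((intertwines_iff hv).1 (h _ hv)) L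
  simp only [Tmap_apply, Sum.elim_comp_inl_inr, Matrix.mulVec, dotProduct, tprod,
    Matrix.of_apply] at h1
  rw [if_pos hL, Finset.sum_eq_single L] at h1
  · rw [if_pos hL, mul_one] at h1
    have h2 : ∀ z, conjIf (ε z) (Matrix.diagonal d) (L z) (L z) =
        if z = p ∨ z = q then (if ε z then -Complex.I else Complex.I) else 1 := by
      intro z
      simp only [conjIf, L, d]
      split_ifs <;> simp [h01]
    simp only [h2] at h1
    rw [← Finset.prod_subset (Finset.subset_univ {p, q}), Finset.prod_pair hpq] at h1
    · intro heq
      simp only [true_or, or_true, if_true, heq] at h1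
      split_ifs at h1
      · rw [neg_mul_neg, Complex.I_mul_I] at h1
        norm_num at h1
      · rw [Complex.I_mul_I] at h1
        norm_num at h1
    · intro z _ hz
      rw [if_neg (by simpa using hz)]
  · intro K _ hK
    obtain ⟨z, hz⟩ := Function.ne_iff.1 hK
    rw [Finset.prod_eq_zero (Finset.mem_univ z), zero_mul]
    cases hc : ε z <;> simp [conjIf, Ne.symm hz]
  · simp

end Pairings

/-! ### Characters of commutative `*`-subalgebras -/

theorem eq_zero_of_commutative {B : Type*} [CommCStarAlgebra B] {a : B}
    (h : ∀ χ : B →⋆ₐ[ℂ] ℂ, χ a = 0) : a = 0 := by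
  have h1 : WeakDual.gelfandTransform ℂ B a = 0 := by
    ext φ
    exact h (φ : B →⋆ₐ[ℂ] ℂ)
  exact (gelfandTransform_isometry B).injective (h1.trans (map_zero _).symm)

/-- The characters separate the points of a commutative `*`-subalgebra. -/
theorem eq_zero_of_forall_character {B : Type*} [CStarAlgebra B] {S : StarSubalgebra ℂ B}
    (hS : ∀ a b : S, a * b = b * a) {a : S} (h : ∀ χ : S →⋆ₐ[ℂ] ℂ, χ a = 0) : a = 0 := by
  have : IsClosed (S.topologicalClosure : Set B) := StarSubalgebra.isClosed_topologicalClosure S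
  let : CommCStarAlgebra S.topologicalClosure :=
    { (inferInstance : CStarAlgebra S.topologicalClosure) with
      mul_comm := (S.commRingTopologicalClosure hS).mul_comm }
  have h1 : StarSubalgebra.inclusion (StarSubalgebra.le_topologicalClosure S) a = 0 :=
    eq_zero_of_commutative fun χ =>
      h (χ.comp (StarSubalgebra.inclusion (StarSubalgebra.le_topologicalClosure S)))
  exact Subtype.ext (congrArg (fun x : S.topologicalClosure => (x : B)) h1)

/-! ### Orthogonal matrices over `C*`-algebras -/

section Orth

variable {N : ℕ} {B : Type*} [CStarAlgebra B] {w : Matrix (Fin N) (Fin N) B}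

/-- `w_ij w_ij*` is one of the positive terms of a sum equal to 1. -/
theorem IsOrth.norm_le (hw : IsOrth w) (i j : Fin N) : ‖w i j‖ ≤ 1 := by
  let := CStarAlgebra.spectralOrder B
  have := CStarAlgebra.spectralOrderedRing B
  have h1 : w i j * star (w i j) ≤ 1 := by
    have h2 := congrFun (congrFun hw.2.1 i) i
    rw [Matrix.mul_apply, Matrix.one_apply_eq] at h2
    rw [← h2]
    have h3 : ∀ k, w i k * wᵀ k i = w i k * star (w i k) := fun k => by
      rw [Matrix.transpose_apply, hw.1]
    simp only [h3]
    exact Finset.single_le_sum (f := fun k => w i k * star (w i k))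
      (fun k _ => mul_star_self_nonneg (w i k)) (Finset.mem_univ j)
  have h4 := (CStarAlgebra.norm_le_one_iff_of_nonneg _ (mul_star_self_nonneg (w i j))).2 h1
  rw [CStarRing.norm_self_mul_star] at h4
  nlinarith [norm_nonneg (w i j)]

end Orth

/-- The defining conditions of `O_N^+`, for matrices over arbitrary `*`-rings. -/
structure OrthRel {N : ℕ} {C : Type*} [Ring C] [StarRing C] (y : Matrix (Fin N) (Fin N) C) :
    Prop where
  star_eq : ∀ i j, star (y i j) = y i j
  row : ∀ i j, ∑ k, y i k * y j k = if i = j then 1 else 0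
  col : ∀ i j, ∑ k, y k i * y k j = if i = j then 1 else 0

theorem isOrth_iff {N : ℕ} {B : Type*} [CStarAlgebra B] {w : Matrix (Fin N) (Fin N) B} :
    IsOrth w ↔ OrthRel w := by
  have h1 : w * wᵀ = 1 ↔ ∀ i j, ∑ k, w i k * w j k = if i = j then 1 else 0 := by
    rw [← Matrix.ext_iff]
    simp only [Matrix.mul_apply, Matrix.transpose_apply, Matrix.one_apply]
  have h2 : wᵀ * w = 1 ↔ ∀ i j, ∑ k, w k i * w k j = if i = j then 1 else 0 := by
    rw [← Matrix.ext_iff]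
    simp only [Matrix.mul_apply, Matrix.transpose_apply, Matrix.one_apply]
  constructor
  · rintro ⟨h, h', h''⟩
    exact ⟨h, h1.1 h', h2.1 h''⟩
  · rintro ⟨h, h', h''⟩
    exact ⟨h, h1.2 h', h2.2 h''⟩

theorem OrthRel.map {N : ℕ} {C C' : Type*} [Ring C] [StarRing C] [Algebra ℂ C] [Ring C']
    [StarRing C'] [Algebra ℂ C'] {y : Matrix (Fin N) (Fin N) C} (hy : OrthRel y)
    (φ : C →⋆ₐ[ℂ] C') : OrthRel (Matrix.of fun i j => φ (y i j)) := by
  refine ⟨fun i j => ?_, fun i j => ?_, fun i j => ?_⟩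
  · rw [Matrix.of_apply, ← map_star, hy.star_eq]
  · simp only [Matrix.of_apply, ← map_mul, ← map_sum, hy.row]
    split_ifs <;> simp
  · simp only [Matrix.of_apply, ← map_mul, ← map_sum, hy.col]
    split_ifs <;> simp

theorem QMat.orthRel_X {N : ℕ} {G : QMat.{u} N} (hG : IsOrth G.u) : OrthRel G.X := by
  rw [isOrth_iff] at hG
  refine ⟨fun i j => Subtype.ext (hG.star_eq i j), fun i j => Subtype.ext ?_,
    fun i j => Subtype.ext ?_⟩
  · have := hG.row i j
    rw [AddSubmonoidClass.coe_finsetSum]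
    refine this.trans ?_
    split_ifs <;> rfl
  · have := hG.col i j
    rw [AddSubmonoidClass.coe_finsetSum]
    refine this.trans ?_
    split_ifs <;> rfl

/-- Evaluation at a point of `O_N`. -/
noncomputable def qOEval {N : ℕ} (g : Matrix.orthogonalGroup (Fin N) ℝ) : (qO N).A →⋆ₐ[ℂ] ℂ :=
  ContinuousMap.evalStarAlgHom ℂ ℂ g

theorem qO_ext {N : ℕ} {a b : (qO N).A} (h : ∀ g, qOEval g a = qOEval g b) : a = b :=
  ContinuousMap.ext h

/-- A complex matrix satisfying `OrthRel` has real entries, so it is a point of `O_N`, and functions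
are determined by their values. -/
theorem evalPoly_qO_eq_zero {N : ℕ} (p : StarPoly N) :
    evalPoly (qO N).u p = 0 ↔ ∀ g : Matrix (Fin N) (Fin N) ℂ, OrthRel g → evalGen g p = 0 := by
  have h1 : ∀ g, qOEval g (evalPoly (qO N).u p) =
      evalGen (Matrix.of fun i j => ((g.1 i j : ℝ) : ℂ)) p := by
    intro g
    exact evalGen_starAlgHom (qOEval g) (qO N).u p
  constructor
  · intro h g hg
    have h2 : ∀ i j, ((g i j).re : ℂ) = g i j := fun i j => Complex.conj_eq_iff_re.1 (hg.star_eq i j)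
    have h3 : (Matrix.of fun i j => (g i j).re) ∈ Matrix.orthogonalGroup (Fin N) ℝ := by
      rw [Matrix.mem_orthogonalGroup_iff]
      ext i j
      have := hg.row i j
      apply Complex.ofReal_injective
      rw [Matrix.mul_apply, Matrix.one_apply, Complex.ofReal_sum]
      simp only [Matrix.of_apply, Matrix.transpose_apply, Complex.ofReal_mul, h2, this]
      split_ifs <;> simp
    have h4 := h1 ⟨_, h3⟩
    rw [h, map_zero] at h4
    simp only [Matrix.of_apply, h2] at h4
    exact h4.symm
  · intro h
    refine qO_ext fun g => ?_
    rw [h1, map_zero]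
    refine h _ ⟨fun i j => by simp, fun i j => ?_, fun i j => ?_⟩
    · have := congrFun (congrFun ((Matrix.mem_orthogonalGroup_iff _ ℝ).1 g.2) i) j
      rw [Matrix.mul_apply, Matrix.one_apply] at this
      simp only [Matrix.of_apply]
      have h5 := congrArg (fun x : ℝ => (x : ℂ)) this
      simp only [Complex.ofReal_sum, Complex.ofReal_mul] at h5
      refine h5.trans ?_
      split_ifs <;> simp
    · have := congrFun (congrFun ((Matrix.mem_orthogonalGroup_iff' _ ℝ).1 g.2) i) j
      rw [Matrix.mul_apply, Matrix.one_apply] at this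
      simp only [Matrix.of_apply]
      have h5 := congrArg (fun x : ℝ => (x : ℂ)) this
      simp only [Complex.ofReal_sum, Complex.ofReal_mul] at h5
      refine h5.trans ?_
      split_ifs <;> simp

/-- A quantum subgroup of `O_N^+` with commuting coordinates is a subgroup of `O_N`. -/
theorem QMat.sub_qO_of_commute {N : ℕ} {G : QMat.{u} N} (hG : IsOrth G.u)
    (hc : ∀ i j k l, G.u i j * G.u k l = G.u k l * G.u i j) : G.Sub (qO N) := by
  rw [QMat.sub_iff]
  intro p hp
  rw [← QMat.evalGen_X_eq_zero]
  have hmc : IsMulCommutative G.coordAlg := by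
    refine StarAlgebra.isMulCommutative_adjoin ℂ ?_ ?_
    · rintro _ ⟨a, rfl⟩ _ ⟨b, rfl⟩
      exact hc _ _ _ _
    · rintro _ ⟨a, rfl⟩ _ ⟨b, rfl⟩
      simp only [hG.1]
      exact hc _ _ _ _
  refine eq_zero_of_forall_character (fun a b => hmc.is_comm.comm a b) fun χ => ?_
  rw [evalGen_starAlgHom]
  exact (evalPoly_qO_eq_zero p).1 hp _ ((QMat.orthRel_X hG).map χ)

/-! ### The model of `O_N^*` given by a unitary matrix -/

section HalfModel

variable {N : ℕ}

/-- The entry `v_ij` (for `b = false`) or its conjugate. -/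
def conjEntry (v : Matrix (Fin N) (Fin N) ℂ) (b : Bool) (i j : Fin N) : ℂ :=
  if b then star (v i j) else v i j

/-- The matrix of antidiagonal `2 × 2` matrices with entries `v_ij` and its conjugate. -/
def halfMat (v : Matrix (Fin N) (Fin N) ℂ) : Matrix (Fin N) (Fin N) (Matrix Bool Bool ℂ) :=
  Matrix.of fun i j => Matrix.of fun b b' => if b' = !b then conjEntry v b i j else 0

theorem halfMat_apply (v : Matrix (Fin N) (Fin N) ℂ) (i j : Fin N) (b b' : Bool) :
    halfMat v i j b b' = if b' = !b then conjEntry v b i j else 0 := rfl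

theorem star_halfMat (v : Matrix (Fin N) (Fin N) ℂ) (i j : Fin N) :
    star (halfMat v i j) = halfMat v i j := by
  ext b b'
  rw [Matrix.star_apply, halfMat_apply, halfMat_apply]
  cases b <;> cases b' <;> simp [conjEntry]

theorem halfMat_mul_apply (v : Matrix (Fin N) (Fin N) ℂ) (i j : Fin N) (M : Matrix Bool Bool ℂ)
    (b b' : Bool) : (halfMat v i j * M) b b' = conjEntry v b i j * M (!b) b' := by
  rw [Matrix.mul_apply, Fintype.sum_bool, halfMat_apply, halfMat_apply]
  cases b <;> simp

/-- A product of three antidiagonal entries alternates `v, v̄, v` or `v̄, v, v̄`, so the outer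
factors carry the same conjugation and can be exchanged. -/
theorem halfMat_halfCommute (v : Matrix (Fin N) (Fin N) ℂ) (i₁ j₁ i₂ j₂ i₃ j₃ : Fin N) :
    halfMat v i₁ j₁ * halfMat v i₂ j₂ * halfMat v i₃ j₃ =
      halfMat v i₃ j₃ * halfMat v i₂ j₂ * halfMat v i₁ j₁ := by
  ext b b'
  rw [mul_assoc, mul_assoc]
  simp only [halfMat_mul_apply, halfMat_apply]
  cases b <;> cases b' <;> simp [conjEntry, mul_comm, mul_left_comm]

theorem sum_conjEntry_row {v : Matrix (Fin N) (Fin N) ℂ} (hv : v ∈ Matrix.unitaryGroup (Fin N) ℂ)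
    (b : Bool) (i j : Fin N) :
    ∑ k, conjEntry v b i k * conjEntry v (!b) j k = if i = j then 1 else 0 := by
  have h : ∀ i j, ∑ k, v i k * star (v j k) = if i = j then 1 else 0 := by
    intro i j
    have := congrFun (congrFun (Matrix.mem_unitaryGroup_iff.1 hv) i) j
    rw [Matrix.mul_apply, Matrix.one_apply] at this
    exact this
  cases b
  · exact h i j
  · rw [← (h j i).trans (if_congr eq_comm rfl rfl)]
    exact Finset.sum_congr rfl fun k _ => mul_comm _ _

theorem sum_conjEntry_col {v : Matrix (Fin N) (Fin N) ℂ} (hv : v ∈ Matrix.unitaryGroup (Fin N) ℂ)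
    (b : Bool) (i j : Fin N) :
    ∑ k, conjEntry v b k i * conjEntry v (!b) k j = if i = j then 1 else 0 := by
  have h : ∀ i j, ∑ k, star (v k i) * v k j = if i = j then 1 else 0 := by
    intro i j
    have := congrFun (congrFun (Matrix.mem_unitaryGroup_iff'.1 hv) i) j
    rw [Matrix.mul_apply, Matrix.one_apply] at this
    exact this
  cases b
  · rw [← (h j i).trans (if_congr eq_comm rfl rfl)]
    exact Finset.sum_congr rfl fun k _ => mul_comm _ _
  · exact h i j

theorem orthRel_halfMat {v : Matrix (Fin N) (Fin N) ℂ} (hv : v ∈ Matrix.unitaryGroup (Fin N) ℂ) :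
    OrthRel (halfMat v) := by
  refine ⟨star_halfMat v, fun i j => ?_, fun i j => ?_⟩
  · ext b b'
    rw [Matrix.sum_apply]
    simp only [halfMat_mul_apply, halfMat_apply, mul_ite, mul_zero, Bool.not_not]
    by_cases h : b' = b
    · simp only [h, if_true, sum_conjEntry_row hv]
      split_ifs <;> simp
    · simp only [h, if_false, Finset.sum_const_zero]
      split_ifs
      · rw [Matrix.one_apply_ne (Ne.symm h)]
      · rfl
  · ext b b'
    rw [Matrix.sum_apply]
    simp only [halfMat_mul_apply, halfMat_apply, mul_ite, mul_zero, Bool.not_not]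
    by_cases h : b' = b
    · simp only [h, if_true, sum_conjEntry_col hv]
      split_ifs <;> simp
    · simp only [h, if_false, Finset.sum_const_zero]
      split_ifs
      · rw [Matrix.one_apply_ne (Ne.symm h)]
      · rfl

end HalfModel

/-! ### The relations between the coordinates of `O_N^*` -/

section HalfKernel

variable {N : ℕ}

/-- The exchange relation `hf` says that `f` has rank one: `f a b · f c c = f a c · f c b`. With `f
c c > 0`, put `v_a = f(a, c) / √f(c, c)`; the row relations then say that `v` is unitary. -/
theorem exists_unitary_of_gram (hN : 0 < N) (f : Fin N × Fin N → Fin N × Fin N → ℂ)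
    (hs : ∀ a b, star (f a b) = f b a) (hf : ∀ a b c d, f a b * f c d = f a d * f c b)
    (hrow : ∀ i j, ∑ k, f (i, k) (j, k) = if i = j then 1 else 0) :
    ∃ v ∈ Matrix.unitaryGroup (Fin N) ℂ, ∀ a b, f a b = v a.1 a.2 * star (v b.1 b.2) := by
  obtain ⟨c, hc⟩ : ∃ c, 0 < (f c c).re := by
    by_contra! h
    have h1 := congrArg Complex.re (hrow ⟨0, hN⟩ ⟨0, hN⟩)
    rw [if_pos rfl, Complex.re_sum, Complex.one_re] at h1
    have h2 := Finset.sum_nonpos fun k (_ : k ∈ Finset.univ) => h ((⟨0, hN⟩ : Fin N), k)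
    linarith
  set r := (f c c).re with hr
  have hcc : f c c = (r : ℂ) := (Complex.conj_eq_iff_re.1 (hs c c)).symm
  have hsq : ((√r : ℝ) : ℂ) * ((√r : ℝ) : ℂ) = r := by
    rw [← Complex.ofReal_mul, Real.mul_self_sqrt hc.le]
  have hr0 : (r : ℂ) ≠ 0 := by exact_mod_cast hc.ne'
  let v : Matrix (Fin N) (Fin N) ℂ := Matrix.of fun i j => f (i, j) c / ((√r : ℝ) : ℂ)
  have hv : ∀ a b, f a b = v a.1 a.2 * star (v b.1 b.2) := by
    intro a b
    have h1 : star (((√r : ℝ) : ℂ)) = ((√r : ℝ) : ℂ) := Complex.conj_ofReal _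
    simp only [v, Matrix.of_apply, star_div₀, h1, hs, Prod.mk.eta]
    rw [div_mul_div_comm, hsq, hf a c c b, hcc, mul_div_assoc, div_self hr0, mul_one]
  refine ⟨v, ?_, hv⟩
  rw [Matrix.mem_unitaryGroup_iff]
  ext i j
  rw [Matrix.mul_apply, Matrix.one_apply, ← hrow]
  exact Finset.sum_congr rfl fun k _ => (hv (i, k) (j, k)).symm

theorem OrthRel.evalGen_ι {C : Type*} [Ring C] [StarRing C] [Algebra ℂ C]
    {y : Matrix (Fin N) (Fin N) C} (hy : OrthRel y) (a : Fin N × Fin N × Bool) :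
    evalGen y (FreeAlgebra.ι ℂ a) = y a.1 a.2.1 := by
  rw [EasyQG.evalGen_ι, hy.star_eq, ite_self]

namespace QMat

/-- The `*`-algebra generated by the products of two coordinates. -/
def evenAlg (G : QMat.{u} N) : StarSubalgebra ℂ G.A :=
  StarAlgebra.adjoin ℂ (Set.range fun p : (Fin N × Fin N) × (Fin N × Fin N) =>
    G.u p.1.1 p.1.2 * G.u p.2.1 p.2.2)

/-- The product of two coordinates. -/
def evenGen (G : QMat.{u} N) (a b : Fin N × Fin N) : G.evenAlg :=
  ⟨G.u a.1 a.2 * G.u b.1 b.2, StarAlgebra.subset_adjoin ℂ _ ⟨(a, b), rfl⟩⟩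

variable {G : QMat.{u} N}

/-- Half-commutation applied twice: `(abc)d = c(bad) = cdab`. -/
theorem evenAlg_commute (hG : IsOrth G.u) (hc : HalfCommutes G.u) (a b : G.evenAlg) :
    a * b = b * a := by
  have key : ∀ a b c d : Fin N × Fin N,
      G.u a.1 a.2 * G.u b.1 b.2 * (G.u c.1 c.2 * G.u d.1 d.2) =
        G.u c.1 c.2 * G.u d.1 d.2 * (G.u a.1 a.2 * G.u b.1 b.2) := by
    intro a b c d
    rw [← mul_assoc, hc a.1 a.2, mul_assoc (G.u c.1 c.2), mul_assoc (G.u c.1 c.2), hc b.1 b.2,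
      mul_assoc, mul_assoc]
  have : IsMulCommutative G.evenAlg := by
    refine StarAlgebra.isMulCommutative_adjoin ℂ ?_ ?_
    · rintro _ ⟨⟨a, b⟩, rfl⟩ _ ⟨⟨c, d⟩, rfl⟩
      exact key _ _ _ _
    · rintro _ ⟨⟨a, b⟩, rfl⟩ _ ⟨⟨c, d⟩, rfl⟩
      simp only [star_mul, hG.1]
      exact key _ _ _ _
  exact this.is_comm.comm a b

/-- The rank one condition is the image under `χ` of `abcd = adcb`, which is half-commutation of the
last three letters. -/
theorem exists_unitary_of_character (hN : 0 < N) (hG : IsOrth G.u) (hc : HalfCommutes G.u)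
    (χ : G.evenAlg →⋆ₐ[ℂ] ℂ) : ∃ v ∈ Matrix.unitaryGroup (Fin N) ℂ,
      ∀ a b, χ (G.evenGen a b) = v a.1 a.2 * star (v b.1 b.2) := by
  have ho := isOrth_iff.1 hG
  refine exists_unitary_of_gram hN (fun a b => χ (G.evenGen a b)) ?_ ?_ ?_
  · intro a b
    rw [← map_star]
    congr 1
    refine Subtype.ext ?_
    change star (G.u a.1 a.2 * G.u b.1 b.2) = G.u b.1 b.2 * G.u a.1 a.2
    rw [star_mul, hG.1, hG.1]
  · intro a b c d
    rw [← map_mul, ← map_mul]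
    congr 1
    refine Subtype.ext ?_
    change G.u a.1 a.2 * G.u b.1 b.2 * (G.u c.1 c.2 * G.u d.1 d.2) =
      G.u a.1 a.2 * G.u d.1 d.2 * (G.u c.1 c.2 * G.u b.1 b.2)
    rw [mul_assoc, ← mul_assoc (G.u b.1 b.2), hc b.1 b.2, mul_assoc, mul_assoc]
  · intro i j
    rw [← map_sum]
    have : ∑ k, G.evenGen (i, k) (j, k) = if i = j then 1 else 0 := by
      refine Subtype.ext ?_
      rw [AddSubmonoidClass.coe_finsetSum]
      refine (ho.row i j).trans ?_
      split_ifs <;> rfl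
    rw [this]
    split_ifs <;> simp

/-- `*`-polynomials which behave as those of even degree. -/
def EvenPoly (G : QMat.{u} N) (q : StarPoly N) : Prop :=
  ∃ c : G.evenAlg, (c : G.A) = evalPoly G.u q ∧ ∀ v ∈ Matrix.unitaryGroup (Fin N) ℂ,
    (∀ b, evalGen (halfMat v) q b (!b) = 0) ∧
    ∀ χ : G.evenAlg →⋆ₐ[ℂ] ℂ, (∀ a b, χ (G.evenGen a b) = v a.1 a.2 * star (v b.1 b.2)) →
      χ c = evalGen (halfMat v) q false false

/-- `*`-polynomials which behave as those of odd degree. -/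
def OddPoly (G : QMat.{u} N) (q : StarPoly N) : Prop :=
  (∀ a, G.EvenPoly (FreeAlgebra.ι ℂ a * q)) ∧
    ∀ v ∈ Matrix.unitaryGroup (Fin N) ℂ, ∀ b, evalGen (halfMat v) q b b = 0

theorem EvenPoly.add {p q : StarPoly N} (hp : G.EvenPoly p) (hq : G.EvenPoly q) :
    G.EvenPoly (p + q) := by
  obtain ⟨c, hc, hc'⟩ := hp
  obtain ⟨d, hd, hd'⟩ := hq
  refine ⟨c + d, by rw [map_add, ← hc, ← hd]; rfl, fun v hv => ⟨fun b => ?_, fun χ hχ => ?_⟩⟩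
  · rw [map_add, Matrix.add_apply, (hc' v hv).1, (hd' v hv).1, add_zero]
  · rw [map_add, map_add, Matrix.add_apply, (hc' v hv).2 χ hχ, (hd' v hv).2 χ hχ]

theorem EvenPoly.smul {p : StarPoly N} (r : ℂ) (hp : G.EvenPoly p) : G.EvenPoly (r • p) := by
  obtain ⟨c, hc, hc'⟩ := hp
  refine ⟨r • c, by rw [map_smul, ← hc]; rfl, fun v hv => ⟨fun b => ?_, fun χ hχ => ?_⟩⟩
  · rw [map_smul, Matrix.smul_apply, (hc' v hv).1, smul_zero]
  · rw [map_smul, map_smul, Matrix.smul_apply, (hc' v hv).2 χ hχ]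

theorem EvenPoly.one : G.EvenPoly 1 := by
  refine ⟨1, by rw [map_one]; rfl, fun v hv => ⟨fun b => ?_, fun χ hχ => ?_⟩⟩
  · rw [map_one, Matrix.one_apply_ne]
    cases b <;> simp
  · rw [map_one, map_one, Matrix.one_apply_eq]

theorem EvenPoly.mul {p q : StarPoly N} (hp : G.EvenPoly p) (hq : G.EvenPoly q) :
    G.EvenPoly (p * q) := by
  obtain ⟨c, hc, hc'⟩ := hp
  obtain ⟨d, hd, hd'⟩ := hq
  refine ⟨c * d, by rw [map_mul, ← hc, ← hd]; rfl, fun v hv => ?_⟩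
  have h1 := (hc' v hv).1
  have h2 := (hd' v hv).1
  refine ⟨fun b => ?_, fun χ hχ => ?_⟩
  · rw [map_mul, Matrix.mul_apply, Fintype.sum_bool]
    cases b
    · have h3 := h1 false
      have h4 := h2 false
      rw [Bool.not_false] at h3 h4 ⊢
      rw [h3, h4, zero_mul, mul_zero, add_zero]
    · have h3 := h1 true
      have h4 := h2 true
      rw [Bool.not_true] at h3 h4 ⊢
      rw [h3, h4, zero_mul, mul_zero, add_zero]
  · rw [map_mul, map_mul, Matrix.mul_apply, Fintype.sum_bool, (hc' v hv).2 χ hχ,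
      (hd' v hv).2 χ hχ, show evalGen (halfMat v) p false true = 0 from h1 false, zero_mul,
      zero_add]

theorem EvenPoly.letters (hG : IsOrth G.u) (a b : Fin N × Fin N × Bool) :
    G.EvenPoly (FreeAlgebra.ι ℂ a * FreeAlgebra.ι ℂ b) := by
  refine ⟨G.evenGen (a.1, a.2.1) (b.1, b.2.1), ?_, fun v hv => ?_⟩
  · rw [evalPoly_eq_evalGen, map_mul, (isOrth_iff.1 hG).evalGen_ι, (isOrth_iff.1 hG).evalGen_ι]
    rfl
  · rw [map_mul, (orthRel_halfMat hv).evalGen_ι, (orthRel_halfMat hv).evalGen_ι]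
    refine ⟨fun c => ?_, fun χ hχ => ?_⟩
    · rw [halfMat_mul_apply, halfMat_apply]
      cases c <;> simp
    · rw [hχ, halfMat_mul_apply, halfMat_apply]
      simp [conjEntry]

theorem OddPoly.add {p q : StarPoly N} (hp : G.OddPoly p) (hq : G.OddPoly q) :
    G.OddPoly (p + q) := by
  refine ⟨fun a => ?_, fun v hv b => ?_⟩
  · rw [mul_add]
    exact (hp.1 a).add (hq.1 a)
  · rw [map_add, Matrix.add_apply, hp.2 v hv, hq.2 v hv, add_zero]

theorem OddPoly.smul {p : StarPoly N} (r : ℂ) (hp : G.OddPoly p) : G.OddPoly (r • p) := by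
  refine ⟨fun a => ?_, fun v hv b => ?_⟩
  · rw [mul_smul_comm]
    exact (hp.1 a).smul r
  · rw [map_smul, Matrix.smul_apply, hp.2 v hv, smul_zero]

theorem evenPoly_or_oddPoly_word (hG : IsOrth G.u) (l : List (Fin N × Fin N × Bool)) :
    G.EvenPoly (l.map (FreeAlgebra.ι ℂ)).prod ∨ G.OddPoly (l.map (FreeAlgebra.ι ℂ)).prod := by
  induction l with
  | nil => exact Or.inl (by simpa using EvenPoly.one)
  | cons a l ih =>
    rw [List.map_cons, List.prod_cons]
    rcases ih with h | h
    · refine Or.inr ⟨fun c => ?_, fun v hv b => ?_⟩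
      · rw [← mul_assoc]
        exact (EvenPoly.letters hG c a).mul h
      · obtain ⟨c, -, hc⟩ := h
        rw [map_mul, (orthRel_halfMat hv).evalGen_ι, halfMat_mul_apply]
        have := (hc v hv).1 (!b)
        rw [Bool.not_not] at this
        rw [this, mul_zero]
    · exact Or.inl (h.1 a)

theorem exists_evenPoly_add_oddPoly (hG : IsOrth G.u) (p : StarPoly N) :
    ∃ q r, G.EvenPoly q ∧ G.OddPoly r ∧ p = q + r := by
  have h0 : G.EvenPoly 0 := by simpa using EvenPoly.one.smul (G := G) 0
  have h0' : G.OddPoly 0 := ⟨fun a => by rwa [mul_zero], fun v _ b => by rw [map_zero]; rfl⟩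
  refine Submodule.span_induction (p := fun p _ => ∃ q r, G.EvenPoly q ∧ G.OddPoly r ∧ p = q + r)
    ?_ ⟨0, 0, h0, h0', by simp⟩ ?_ ?_ (mem_span_wordPoly p)
  · rintro _ ⟨t, rfl⟩
    have h1 : wordPoly t.1.2 t.2.1 t.2.2 = ((List.ofFn fun a =>
        (t.2.1 a, t.2.2 a, t.1.2 a)).map (FreeAlgebra.ι ℂ)).prod := by
      rw [wordPoly, List.map_ofFn]
      rfl
    rcases evenPoly_or_oddPoly_word hG (List.ofFn fun a => (t.2.1 a, t.2.2 a, t.1.2 a)) with h | h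
    · exact ⟨_, 0, h, h0', by rw [add_zero, ← h1]⟩
    · exact ⟨0, _, h0, h, by rw [zero_add, ← h1]⟩
  · rintro x y _ _ ⟨q, r, hq, hr, rfl⟩ ⟨q', r', hq', hr', rfl⟩
    exact ⟨q + q', r + r', hq.add hq', hr.add hr', by abel⟩
  · rintro c x _ ⟨q, r, hq, hr, rfl⟩
    exact ⟨c • q, c • r, hq.smul c, hr.smul c, smul_add _ _ _⟩

/-- Characters separate the points of the commutative even algebra, and each of them reads a
diagonal entry of some `halfMat v`. -/
theorem EvenPoly.eval_eq_zero (hN : 0 < N) (hG : IsOrth G.u) (hc : HalfCommutes G.u)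
    {q : StarPoly N} (hq : G.EvenPoly q) (h : ∀ v ∈ Matrix.unitaryGroup (Fin N) ℂ,
      evalGen (halfMat v) q false false = 0) : evalPoly G.u q = 0 := by
  obtain ⟨c, h1, h2⟩ := hq
  rw [← h1, ZeroMemClass.coe_eq_zero]
  refine eq_zero_of_forall_character (evenAlg_commute hG hc) fun χ => ?_
  obtain ⟨v, hv, hχ⟩ := exists_unitary_of_character hN hG hc χ
  rw [(h2 v hv).2 χ hχ, h v hv]

/-- The models given by the unitary matrices detect all the `*`-polynomials in half-commuting
orthogonal coordinates. -/
theorem evalPoly_eq_zero_of_halfMat (hN : 0 < N) (hG : IsOrth G.u) (hc : HalfCommutes G.u)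
    {p : StarPoly N} (h : ∀ v ∈ Matrix.unitaryGroup (Fin N) ℂ, evalGen (halfMat v) p = 0) :
    evalPoly G.u p = 0 := by
  -- In the models, even polynomials are diagonal and odd ones antidiagonal, so the vanishing of `p`
  -- gives the vanishing of each part separately.
  obtain ⟨q, r, hq, hr, rfl⟩ := exists_evenPoly_add_oddPoly hG p
  have h1 : evalPoly G.u q = 0 := hq.eval_eq_zero hN hG hc fun v hv => by
    have := congrFun (congrFun (h v hv) false) false
    rwa [map_add, Matrix.add_apply, hr.2 v hv, add_zero] at this
  have h2 : ∀ a, evalPoly G.u (FreeAlgebra.ι ℂ a * r) = 0 := fun a =>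
    (hr.1 a).eval_eq_zero hN hG hc fun v hv => by
      obtain ⟨c, -, hc⟩ := hq
      have := congrFun (congrFun (h v hv) true) false
      rw [map_add, Matrix.add_apply, show evalGen (halfMat v) q true false = 0 from
        (hc v hv).1 true, zero_add] at this
      rw [map_mul, (orthRel_halfMat hv).evalGen_ι, halfMat_mul_apply, Bool.not_false, this]
      exact mul_zero _
  -- The odd part is reduced to even ones by multiplying by coordinates, and is recovered from `∑_k
  -- u_kz² = 1`.
  have h3 : evalPoly G.u r = 0 := by
    let z : Fin N := ⟨0, hN⟩
    have h4 : ∀ k, G.u k z * evalPoly G.u r = 0 := fun k => by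
      have := h2 (k, z, false)
      rwa [evalPoly_eq_evalGen, map_mul, (isOrth_iff.1 hG).evalGen_ι] at this
    have h5 := (isOrth_iff.1 hG).col z z
    rw [if_pos rfl] at h5
    rw [← one_mul (evalPoly G.u r), ← h5, Finset.sum_mul]
    exact Finset.sum_eq_zero fun k _ => by rw [mul_assoc, h4, mul_zero]
  rw [map_add, h1, h3, add_zero]

end QMat

end HalfKernel

/-! ### Relations as vanishing of `*`-polynomials -/

section Relations

variable {N : ℕ} {C : Type*} [Ring C] [StarRing C] [Algebra ℂ C]

open FreeAlgebra in
theorem orthRel_iff (y : Matrix (Fin N) (Fin N) C) : OrthRel y ↔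
    (∀ i j, evalGen y (ι ℂ (i, j, true) - ι ℂ (i, j, false)) = 0) ∧
    (∀ i j, evalGen y (∑ k, ι ℂ (i, k, false) * ι ℂ (j, k, false) - if i = j then 1 else 0) = 0) ∧
    ∀ i j, evalGen y (∑ k, ι ℂ (k, i, false) * ι ℂ (k, j, false) - if i = j then 1 else 0) = 0 := by
  have h : ∀ i j : Fin N, evalGen y (if i = j then 1 else 0) = if i = j then 1 else 0 := by
    intro i j
    split_ifs <;> simp
  simp only [map_sub, map_sum, map_mul, evalGen_ι, h, sub_eq_zero, if_true, Bool.false_eq_true,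
    if_false]
  exact ⟨fun h => ⟨h.1, h.2, h.3⟩, fun h => ⟨h.1, h.2.1, h.2.2⟩⟩

/-- The half-commutation relations, for matrices over arbitrary rings. -/
def HalfRel {C : Type*} [Ring C] (y : Matrix (Fin N) (Fin N) C) : Prop :=
  ∀ i₁ j₁ i₂ j₂ i₃ j₃, y i₁ j₁ * y i₂ j₂ * y i₃ j₃ = y i₃ j₃ * y i₂ j₂ * y i₁ j₁

open FreeAlgebra in
theorem halfRel_iff (y : Matrix (Fin N) (Fin N) C) : HalfRel y ↔
    ∀ i₁ j₁ i₂ j₂ i₃ j₃, evalGen y (ι ℂ (i₁, j₁, false) * ι ℂ (i₂, j₂, false) *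
      ι ℂ (i₃, j₃, false) - ι ℂ (i₃, j₃, false) * ι ℂ (i₂, j₂, false) * ι ℂ (i₁, j₁, false)) =
        0 := by
  simp only [map_sub, map_mul, evalGen_ι, sub_eq_zero, Bool.false_eq_true, if_false]
  rfl

theorem QMat.Sub.isOrth {G : QMat.{u} N} {H : QMat.{v} N} (h : G.Sub H) (hH : IsOrth H.u) :
    IsOrth G.u := by
  rw [isOrth_iff, orthRel_iff] at hH ⊢
  have h' := QMat.sub_iff.1 h
  exact ⟨fun i j => h' _ (hH.1 i j), fun i j => h' _ (hH.2.1 i j), fun i j => h' _ (hH.2.2 i j)⟩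

theorem isOrth_universalQ {R : MatRel N} (h : ∀ M : Model R, IsOrth M.w) :
    IsOrth (universalQ R).u := by
  rw [isOrth_iff, orthRel_iff]
  have h' := fun M => (orthRel_iff _).1 (isOrth_iff.1 (h M))
  exact ⟨fun i j => (evalPoly_universalQ_eq_zero _).2 fun M => (h' M).1 i j,
    fun i j => (evalPoly_universalQ_eq_zero _).2 fun M => (h' M).2.1 i j,
    fun i j => (evalPoly_universalQ_eq_zero _).2 fun M => (h' M).2.2 i j⟩

theorem halfCommutes_universalQ {R : MatRel N} (h : ∀ M : Model R, HalfCommutes M.w) :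
    HalfCommutes (universalQ R).u := by
  refine (halfRel_iff _).2 fun i₁ j₁ i₂ j₂ i₃ j₃ => (evalPoly_universalQ_eq_zero _).2 fun M => ?_
  exact (halfRel_iff M.w).1 (h M) i₁ j₁ i₂ j₂ i₃ j₃

theorem isOrth_qOplus : IsOrth (qOplus N).u := isOrth_universalQ fun M => M.rel

theorem isOrth_qOstar : IsOrth (qOstar N).u := isOrth_universalQ fun M => M.rel.1

theorem halfCommutes_qOstar : HalfCommutes (qOstar N).u := halfCommutes_universalQ fun M => M.rel.2

theorem isOrth_qO : IsOrth (qO N).u := by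
  rw [isOrth_iff, orthRel_iff]
  have h' := fun (g : Matrix (Fin N) (Fin N) ℂ) (hg : OrthRel g) => (orthRel_iff g).1 hg
  exact ⟨fun i j => (evalPoly_qO_eq_zero _).2 fun g hg => (h' g hg).1 i j,
    fun i j => (evalPoly_qO_eq_zero _).2 fun g hg => (h' g hg).2.1 i j,
    fun i j => (evalPoly_qO_eq_zero _).2 fun g hg => (h' g hg).2.2 i j⟩

theorem qO_commute (i j k l : Fin N) :
    (qO N).u i j * (qO N).u k l = (qO N).u k l * (qO N).u i j :=
  mul_comm (G := C(Matrix.orthogonalGroup (Fin N) ℝ, ℂ)) _ _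

end Relations

/-! ### Finite-dimensional models -/

section Models

variable {N : ℕ} {n : Type} [Fintype n] [DecidableEq n] [Nonempty n]

open scoped Matrix.Norms.L2Operator in
/-- A matrix with entries in a matrix algebra. -/
noncomputable def QMat.ofMatrix (y : Matrix (Fin N) (Fin N) (Matrix n n ℂ)) : QMat.{0} N where
  A := Matrix n n ℂ
  u := y

theorem QMat.isOrth_ofMatrix {y : Matrix (Fin N) (Fin N) (Matrix n n ℂ)} (hy : OrthRel y) :
    IsOrth (QMat.ofMatrix y).u := isOrth_iff.2 ⟨hy.1, hy.2, hy.3⟩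

theorem evalGen_eq_zero_of_qOplus {y : Matrix (Fin N) (Fin N) (Matrix n n ℂ)} (hy : OrthRel y)
    {p : StarPoly N} (hp : evalPoly (qOplus N).u p = 0) : evalGen y p = 0 := by
  have ho := QMat.isOrth_ofMatrix hy
  exact (evalPoly_universalQ_eq_zero p).1 hp
    { B := (QMat.ofMatrix y).A
      nontriv := inferInstanceAs (Nontrivial (Matrix n n ℂ))
      w := (QMat.ofMatrix y).u
      contr := ho.norm_le
      rel := ho }

theorem evalGen_eq_zero_of_qOstar {y : Matrix (Fin N) (Fin N) (Matrix n n ℂ)} (hy : OrthRel y)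
    (hh : HalfRel y) {p : StarPoly N} (hp : evalPoly (qOstar N).u p = 0) : evalGen y p = 0 := by
  have ho := QMat.isOrth_ofMatrix hy
  exact (evalPoly_universalQ_eq_zero p).1 hp
    { B := (QMat.ofMatrix y).A
      nontriv := inferInstanceAs (Nontrivial (Matrix n n ℂ))
      w := (QMat.ofMatrix y).u
      contr := ho.norm_le
      rel := ⟨ho, hh⟩ }

theorem evalPoly_qOstar_eq_zero (hN : 0 < N) (p : StarPoly N) :
    evalPoly (qOstar N).u p = 0 ↔
      ∀ v ∈ Matrix.unitaryGroup (Fin N) ℂ, evalGen (halfMat v) p = 0 :=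
  ⟨fun h _ hv => evalGen_eq_zero_of_qOstar (orthRel_halfMat hv) (halfMat_halfCommute _) h,
    fun h => QMat.evalPoly_eq_zero_of_halfMat hN isOrth_qOstar halfCommutes_qOstar h⟩

/-- The universal algebra only tests models in `Type`. Going through the unitary models gives the
universal property for algebras in any universe. -/
theorem QMat.sub_qOstar (hN : 0 < N) {G : QMat.{u} N} (hG : IsOrth G.u) (hc : HalfCommutes G.u) :
    G.Sub (qOstar N) :=
  QMat.sub_iff.2 fun p hp =>
    QMat.evalPoly_eq_zero_of_halfMat hN hG hc ((evalPoly_qOstar_eq_zero hN p).1 hp)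

theorem qO_sub_qOstar (hN : 0 < N) : (qO N).Sub (qOstar N) := by
  refine QMat.sub_qOstar hN isOrth_qO fun i₁ j₁ i₂ j₂ i₃ j₃ => ?_
  rw [qO_commute i₁ j₁ i₂ j₂, mul_assoc, qO_commute i₁ j₁ i₃ j₃, ← mul_assoc, qO_commute i₂ j₂]

theorem qOstar_sub_qOplus : (qOstar N).Sub (qOplus N) := by
  rw [QMat.sub_iff]
  intro p hp
  rw [qOstar, evalPoly_universalQ_eq_zero]
  intro M
  exact (evalPoly_universalQ_eq_zero p).1 hp { B := M.B, w := M.w, contr := M.contr, rel := M.rel.1 }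

end Models

/-! ### The structural maps of `O_N^*` -/

section Structure

variable {N : ℕ}

/-- Expand `z` over a basis of `W`. For `f ∈ F`, the vector obtained by applying `f` to the
coefficients is killed by `F'`, hence zero, so `f` kills each coefficient. -/
theorem tensor_eq_zero {K V W : Type*} [Field K] [AddCommGroup V] [Module K V] [AddCommGroup W]
    [Module K W] {F : Set (V →ₗ[K] K)} {F' : Set (W →ₗ[K] K)}
    (hF : ∀ x, (∀ f ∈ F, f x = 0) → x = 0) (hF' : ∀ y, (∀ f ∈ F', f y = 0) → y = 0)
    {z : V ⊗[K] W} (h : ∀ f ∈ F, ∀ g ∈ F', LinearMap.mul' K K (TensorProduct.map f g z) = 0) :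
    z = 0 := by
  classical
  let b := Module.Basis.ofVectorSpace K W
  let e := TensorProduct.equivFinsuppOfBasisRight (M := V) b
  have h1 : ∀ f : V →ₗ[K] K, ∀ z, TensorProduct.lid K W (TensorProduct.map f LinearMap.id z) =
      (e z).sum fun i x => f x • b i := by
    intro f z
    induction z using TensorProduct.induction_on with
    | zero => simp
    | tmul x y =>
      have he : e = TensorProduct.equivFinsuppOfBasisRight b := rfl
      rw [TensorProduct.map_tmul, TensorProduct.lid_tmul, he,
        TensorProduct.equivFinsuppOfBasisRight_apply_tmul, Finsupp.sum_mapRange_index (by simp)]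
      conv_lhs => rw [LinearMap.id_apply, ← b.linearCombination_repr y,
        Finsupp.linearCombination_apply, Finsupp.smul_sum]
      refine Finsupp.sum_congr fun i _ => ?_
      rw [map_smul, smul_eq_mul, mul_smul, smul_comm]
    | add x y hx hy =>
      rw [map_add, map_add, map_add, hx, hy, Finsupp.sum_add_index']
      · simp
      · intro i x y
        rw [map_add, add_smul]
  have h2 : ∀ f ∈ F, (e z).sum (fun i x => f x • b i) = 0 := by
    intro f hf
    refine hF' _ fun g hg => ?_
    rw [← h1, ← h f hf g hg]
    have : g ∘ₗ (TensorProduct.lid K W).toLinearMap ∘ₗ TensorProduct.map f LinearMap.id =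
        LinearMap.mul' K K ∘ₗ TensorProduct.map f g := by
      ext x y
      simp
    exact LinearMap.congr_fun this z
  have h3 : e z = 0 := by
    ext i
    refine hF _ fun f hf => ?_
    have h4 := h2 f hf
    have h5 : (e z).sum (fun i x => f x • b i) =
        Finsupp.linearCombination K b ((e z).mapRange f (map_zero f)) := by
      rw [Finsupp.linearCombination_apply, Finsupp.sum_mapRange_index (by simp)]
    rw [h5] at h4
    have h6 := (linearIndependent_iff.1 b.linearIndependent) _ h4
    have := DFunLike.congr_fun h6 i
    simpa using this
  simpa using h3

theorem qOstar_counit : ∃ ε : (qOstar N).coordAlg →⋆ₐ[ℂ] ℂ,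
    ∀ i j, ε ((qOstar N).x i j) = if i = j then 1 else 0 := by
  refine (qOstar N).exists_lift (Matrix.of fun i j => if i = j then (1 : ℂ) else 0) fun p hp => ?_
  refine (evalPoly_universalQ_eq_zero p).1 hp
    { B := ℂ, w := Matrix.of fun i j => if i = j then (1 : ℂ) else 0, contr := ?_, rel := ⟨?_, ?_⟩ }
  · intro i j
    rw [Matrix.of_apply]
    split_ifs <;> simp
  · rw [isOrth_iff]
    refine ⟨fun i j => ?_, fun i j => ?_, fun i j => ?_⟩
    · rw [Matrix.of_apply]
      split_ifs <;> simp
    · simp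
    · simp only [Matrix.of_apply, mul_ite, mul_one, mul_zero, Finset.sum_ite_eq',
        Finset.mem_univ, if_true]
      exact if_congr eq_comm rfl rfl
  · intro i₁ j₁ i₂ j₂ i₃ j₃
    ring

/-- The relation `abc = cba` is symmetric under reversal of products, so the transposed matrix over
the opposite algebra again satisfies the relations of `O_N^*`. -/
theorem qOstar_antipode (hN : 0 < N) :
    ∃ S : (qOstar N).coordAlg →⋆ₐ[ℂ] ((qOstar N).coordAlg)ᵐᵒᵖ,
      ∀ i j, S ((qOstar N).x i j) = MulOpposite.op (star ((qOstar N).x j i)) := by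
  have ho := isOrth_iff.1 (isOrth_qOstar (N := N))
  let G : QMat.{0} N :=
    { A := (qOstar N).Aᵐᵒᵖ, u := Matrix.of fun i j => MulOpposite.op (star ((qOstar N).u j i)) }
  have hG : IsOrth G.u := by
    rw [isOrth_iff]
    refine ⟨fun i j => ?_, fun i j => ?_, fun i j => ?_⟩
    · simp only [G, Matrix.of_apply, ho.star_eq, ← MulOpposite.op_star]
    · simp only [G, Matrix.of_apply, ho.star_eq, ← MulOpposite.op_mul]
      rw [← Finset.op_sum, ho.col]
      simp only [eq_comm]
      split_ifs <;> rfl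
    · simp only [G, Matrix.of_apply, ho.star_eq, ← MulOpposite.op_mul]
      rw [← Finset.op_sum, ho.row]
      simp only [eq_comm]
      split_ifs <;> rfl
  have hG' : HalfCommutes G.u := by
    intro i₁ j₁ i₂ j₂ i₃ j₃
    simp only [G, Matrix.of_apply, ho.star_eq, ← MulOpposite.op_mul]
    rw [← mul_assoc, ← mul_assoc, halfCommutes_qOstar]
  refine (qOstar N).exists_lift
    (Matrix.of fun i j => MulOpposite.op (star ((qOstar N).x j i))) fun p hp => ?_
  have h1 := QMat.sub_iff.1 (QMat.sub_qOstar hN hG hG') p hp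
  let φ : ((qOstar N).coordAlg)ᵐᵒᵖ →ₐ[ℂ] G.A := AlgHom.op (qOstar N).coordAlg.subtype.toAlgHom
  have h2 : φ (evalGen (Matrix.of fun i j => MulOpposite.op (star ((qOstar N).x j i))) p) =
      evalGen G.u p := evalGen_algHom φ _ _ (fun _ _ => rfl) (fun _ _ => rfl) p
  have h3 : Function.Injective φ := by
    intro a b hab
    exact MulOpposite.unop_injective (Subtype.ext (congrArg MulOpposite.unop hab))
  exact h3 (h2.trans (h1.trans (map_zero φ).symm))

theorem OrthRel.tensor {A B : Type*} [Ring A] [StarRing A] [Algebra ℂ A] [StarModule ℂ A] [Ring B]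
    [StarRing B] [Algebra ℂ B] [StarModule ℂ B] {x : Matrix (Fin N) (Fin N) A}
    {y : Matrix (Fin N) (Fin N) B} (hx : OrthRel x) (hy : OrthRel y) :
    OrthRel (Matrix.of fun i j => ∑ k, x i k ⊗ₜ[ℂ] y k j) := by
  refine ⟨fun i j => ?_, fun i j => ?_, fun i j => ?_⟩
  · simp [star_sum, TensorProduct.star_tmul, hx.star_eq, hy.star_eq]
  · simp only [Matrix.of_apply, Finset.sum_mul_sum, Algebra.TensorProduct.tmul_mul_tmul]
    rw [Finset.sum_comm]
    have : ∀ l, ∑ k, ∑ m, (x i l * x j m) ⊗ₜ[ℂ] (y l k * y m k) =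
        (x i l * x j l) ⊗ₜ[ℂ] (1 : B) := by
      intro l
      rw [Finset.sum_comm]
      refine (Finset.sum_congr rfl fun m _ => (TensorProduct.tmul_sum _ _ _).symm).trans ?_
      rw [Finset.sum_eq_single l (fun m _ hm => by rw [hy.row, if_neg hm.symm,
        TensorProduct.tmul_zero]) (by simp), hy.row, if_pos rfl]
    simp only [this, ← TensorProduct.sum_tmul, hx.row]
    split_ifs <;> simp [Algebra.TensorProduct.one_def]
  · simp only [Matrix.of_apply, Finset.sum_mul_sum, Algebra.TensorProduct.tmul_mul_tmul]
    rw [Finset.sum_comm]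
    have : ∀ l, ∑ k, ∑ m, (x k l * x k m) ⊗ₜ[ℂ] (y l i * y m j) =
        (1 : A) ⊗ₜ[ℂ] (y l i * y l j) := by
      intro l
      rw [Finset.sum_comm]
      refine (Finset.sum_congr rfl fun m _ => (TensorProduct.sum_tmul _ _ _).symm).trans ?_
      rw [Finset.sum_eq_single l (fun m _ hm => by rw [hx.col, if_neg hm.symm,
        TensorProduct.zero_tmul]) (by simp), hx.col, if_pos rfl]
    simp only [this, ← TensorProduct.tmul_sum, hy.col]
    split_ifs <;> simp [Algebra.TensorProduct.one_def]

theorem HalfRel.tensor {A B : Type*} [Ring A] [Algebra ℂ A] [Ring B] [Algebra ℂ B]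
    {x : Matrix (Fin N) (Fin N) A} {y : Matrix (Fin N) (Fin N) B} (hx : HalfRel x)
    (hy : HalfRel y) : HalfRel (Matrix.of fun i j => ∑ k, x i k ⊗ₜ[ℂ] y k j) := by
  intro i₁ j₁ i₂ j₂ i₃ j₃
  have key : ∀ i₁ j₁ i₂ j₂ i₃ j₃ : Fin N, (∑ k, x i₁ k ⊗ₜ[ℂ] y k j₁) * (∑ k, x i₂ k ⊗ₜ[ℂ] y k j₂) *
      (∑ k, x i₃ k ⊗ₜ[ℂ] y k j₃) = ∑ k, ∑ l, ∑ m, (x i₁ k * x i₂ l * x i₃ m) ⊗ₜ[ℂ]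
        (y k j₁ * y l j₂ * y m j₃) := by
    intro i₁ j₁ i₂ j₂ i₃ j₃
    rw [Finset.sum_mul_sum, Finset.sum_mul]
    refine Finset.sum_congr rfl fun k _ => ?_
    rw [Finset.sum_mul]
    refine Finset.sum_congr rfl fun l _ => ?_
    rw [Finset.mul_sum]
    simp only [Algebra.TensorProduct.tmul_mul_tmul]
  simp only [Matrix.of_apply]
  rw [key, key, Finset.sum_comm]
  refine (Finset.sum_congr rfl fun l _ => Finset.sum_comm).trans ?_
  rw [Finset.sum_comm]
  refine Finset.sum_congr rfl fun k _ => Finset.sum_congr rfl fun l _ =>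
    Finset.sum_congr rfl fun m _ => ?_
  rw [hx, hy]

/-- The representation of a tensor product defined by representations of the factors. -/
noncomputable def tensorRep {A B n : Type*} [Ring A] [Algebra ℂ A] [Ring B] [Algebra ℂ B]
    [Fintype n] [DecidableEq n] (φ : A →ₐ[ℂ] Matrix n n ℂ) (ψ : B →ₐ[ℂ] Matrix n n ℂ) :
    A ⊗[ℂ] B →ₐ[ℂ] Matrix (n × n) (n × n) ℂ :=
  ((Algebra.TensorProduct.lid ℂ ℂ).toAlgHom.mapMatrix.comp
    (Matrix.kroneckerTMulAlgEquiv n n ℂ ℂ ℂ ℂ).toAlgHom).comp (Algebra.TensorProduct.map φ ψ)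

theorem tensorRep_tmul {A B n : Type*} [Ring A] [Algebra ℂ A] [Ring B] [Algebra ℂ B]
    [Fintype n] [DecidableEq n] (φ : A →ₐ[ℂ] Matrix n n ℂ) (ψ : B →ₐ[ℂ] Matrix n n ℂ) (a : A)
    (b : B) (i j : n × n) : tensorRep φ ψ (a ⊗ₜ b) i j = φ a i.1 j.1 * ψ b i.2 j.2 := by
  simp [tensorRep, Matrix.kroneckerMap_apply]

theorem OrthRel.of_algHom {A B : Type*} [Ring A] [StarRing A] [Algebra ℂ A] [Ring B] [StarRing B]
    [Algebra ℂ B] {x : Matrix (Fin N) (Fin N) A} {y : Matrix (Fin N) (Fin N) B} (hx : OrthRel x)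
    (φ : A →ₐ[ℂ] B) (h : ∀ i j, φ (x i j) = y i j) (hy : ∀ i j, star (y i j) = y i j) :
    OrthRel y := by
  refine ⟨hy, fun i j => ?_, fun i j => ?_⟩
  · simp only [← h, ← map_mul, ← map_sum, hx.row]
    split_ifs <;> simp
  · simp only [← h, ← map_mul, ← map_sum, hx.col]
    split_ifs <;> simp

theorem HalfRel.of_algHom {A B : Type*} [Ring A] [Algebra ℂ A] [Ring B]
    [Algebra ℂ B] {x : Matrix (Fin N) (Fin N) A} {y : Matrix (Fin N) (Fin N) B} (hx : HalfRel x)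
    (φ : A →ₐ[ℂ] B) (h : ∀ i j, φ (x i j) = y i j) : HalfRel y := by
  intro i₁ j₁ i₂ j₂ i₃ j₃
  simp only [← h, ← map_mul, hx i₁ j₁]

/-- The algebraic tensor square is not a `C*`-algebra, so the relations for `∑ x_ik ⊗ x_kj` are
tested on matrix entries of pairs of unitary models. Each pair gives a half-commuting orthogonal
matrix over `4 × 4` matrices, which is a model of `O_N^*`. -/
theorem qOstar_comul (hN : 0 < N) :
    ∃ Δ : (qOstar N).coordAlg →⋆ₐ[ℂ] (qOstar N).coordAlg ⊗[ℂ] (qOstar N).coordAlg,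
      ∀ i j, Δ ((qOstar N).x i j) = ∑ k, (qOstar N).x i k ⊗ₜ[ℂ] (qOstar N).x k j := by
  have hX := QMat.orthRel_X (isOrth_qOstar (N := N))
  have hX' : HalfRel (qOstar N).X := fun i₁ j₁ i₂ j₂ i₃ j₃ =>
    Subtype.ext (halfCommutes_qOstar i₁ j₁ i₂ j₂ i₃ j₃)
  have hrep : ∀ v : Matrix.unitaryGroup (Fin N) ℂ, ∃ Φ : (qOstar N).coordAlg →⋆ₐ[ℂ]
      Matrix Bool Bool ℂ, ∀ i j, Φ ((qOstar N).x i j) = halfMat v.1 i j := fun v =>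
    (qOstar N).exists_lift (halfMat v.1) fun p hp => (evalPoly_qOstar_eq_zero hN p).1 hp v.1 v.2
  choose Φ hΦ using hrep
  have hΦ' : ∀ v p, Φ v (evalGen (qOstar N).X p) = evalGen (halfMat v.1) p := fun v p =>
    evalGen_algHom (Φ v).toAlgHom _ _ (hΦ v) (fun i j => (map_star (Φ v) _).trans
      (congrArg star (hΦ v i j))) p
  let F : Set ((qOstar N).coordAlg →ₗ[ℂ] ℂ) :=
    {f | ∃ v b c, ∀ a, f a = Φ v a b c}
  have hF : ∀ x, (∀ f ∈ F, f x = 0) → x = 0 := by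
    intro x hx
    obtain ⟨p, rfl⟩ := (qOstar N).evalGen_X_surjective x
    rw [QMat.evalGen_X_eq_zero, evalPoly_qOstar_eq_zero hN]
    intro v hv
    ext b c
    rw [← hΦ' ⟨v, hv⟩]
    exact hx ((Matrix.entryLinearMap ℂ ℂ b c).comp (Φ ⟨v, hv⟩).toAlgHom.toLinearMap)
      ⟨⟨v, hv⟩, b, c, fun a => rfl⟩
  let y : Matrix (Fin N) (Fin N) ((qOstar N).coordAlg ⊗[ℂ] (qOstar N).coordAlg) :=
    Matrix.of fun i j => ∑ k, (qOstar N).X i k ⊗ₜ[ℂ] (qOstar N).X k j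
  have hy : OrthRel y := hX.tensor hX
  have hy' : HalfRel y := hX'.tensor hX'
  refine (qOstar N).exists_lift y fun p hp => ?_
  refine tensor_eq_zero hF hF ?_
  rintro f ⟨v, b, c, hf⟩ g ⟨v', b', c', hg⟩
  let ρ := tensorRep (Φ v).toAlgHom (Φ v').toAlgHom
  have h1 : ∀ z, LinearMap.mul' ℂ ℂ (TensorProduct.map f g z) = ρ z (b, b') (c, c') := by
    intro z
    induction z using TensorProduct.induction_on with
    | zero => simp
    | tmul x y =>
      rw [tensorRep_tmul, TensorProduct.map_tmul, LinearMap.mul'_apply, hf, hg]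
      rfl
    | add x y hx hy => rw [map_add, map_add, map_add, hx, hy, Matrix.add_apply]
  let y' : Matrix (Fin N) (Fin N) (Matrix (Bool × Bool) (Bool × Bool) ℂ) :=
    Matrix.of fun i j => ρ (y i j)
  have hstar : ∀ i j, star (y' i j) = y' i j := by
    intro i j
    ext b c
    simp only [y', y, Matrix.of_apply, Matrix.star_apply, map_sum, Matrix.sum_apply, star_sum, ρ,
      tensorRep_tmul, star_mul']
    refine Finset.sum_congr rfl fun k _ => ?_
    have h2 : ∀ v i j b c, star ((Φ v).toAlgHom ((qOstar N).X i j) c b) =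
        (Φ v).toAlgHom ((qOstar N).X i j) b c := by
      intro v i j b c
      change star (Φ v ((qOstar N).x i j) c b) = Φ v ((qOstar N).x i j) b c
      rw [hΦ, ← Matrix.star_apply, star_halfMat]
    rw [h2, h2]
  have h3 : evalGen y' p = 0 := evalGen_eq_zero_of_qOstar (hy.of_algHom ρ (fun _ _ => rfl) hstar)
    (hy'.of_algHom ρ fun _ _ => rfl) hp
  rw [h1, evalGen_algHom ρ y y' (fun _ _ => rfl) (fun i j => by
    rw [hy.star_eq, hstar]
    rfl), h3]
  rfl

theorem isQuantumGroup_qOstar (hN : 0 < N) : (qOstar N).IsQuantumGroup where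
  unitary := (isOrth_qOstar.isBiunitary).1
  dense := universalQ_dense
  comul := qOstar_comul hN
  counit := qOstar_counit
  antipode := qOstar_antipode hN

end Structure

/-! ### Intertwiners of `O_N` and `O_N^*` -/

section Intertwiners

variable {N m n : ℕ}

theorem IsPairing.even {π : Part m n} (h : IsPairing π) : Even (m + n) := by
  rw [← posPart_map π] at h
  exact (isPairing_posPart_iff.1 h).even

theorem Tmap_ne_zero (hN : 0 < N) (π : Part m n) : Tmap N π ≠ 0 := by
  classical
  intro h
  have := congrFun (congrFun h fun _ => ⟨0, hN⟩) fun _ => ⟨0, hN⟩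
  rw [Tmap_apply, if_pos] at this
  · exact one_ne_zero this
  · intro a b _
    rw [Setoid.ker_def]
    rcases a with a | a <;> rcases b with b | b <;> rfl

theorem evalGen_homPoly {C : Type*} [Ring C] [StarRing C] [Algebra ℂ C]
    {y : Matrix (Fin N) (Fin N) C} (hy : OrthRel y) (k : Word m) (l : Word n)
    (T : Matrix (Fin n → Fin N) (Fin m → Fin N) ℂ) (J : Fin n → Fin N) (I : Fin m → Fin N) :
    evalGen y (QMat.homPoly k l T J I) =
      ∑ I', T J I' • (List.ofFn fun a => y (I' a) (I a)).prod -
        ∑ J', T J' I • (List.ofFn fun a => y (J a) (J' a)).prod := by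
  simp only [QMat.homPoly, map_sub, map_sum, map_smul, QMat.evalGen_wordPoly, hy.star_eq, ite_self]

theorem orthRel_iff_unitary (g : Matrix (Fin N) (Fin N) ℂ) :
    OrthRel g ↔ g ∈ Matrix.unitaryGroup (Fin N) ℂ ∧ g.map star = g := by
  constructor
  · intro h
    have h1 : g.map star = g := Matrix.ext h.star_eq
    refine ⟨?_, h1⟩
    rw [Matrix.mem_unitaryGroup_iff]
    ext i j
    rw [Matrix.mul_apply, Matrix.one_apply, ← h.row]
    simp only [Matrix.star_apply, h.star_eq]
  · rintro ⟨h, h1⟩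
    have hs : ∀ i j, star (g i j) = g i j := fun i j => congrFun (congrFun h1 i) j
    refine ⟨hs, fun i j => ?_, fun i j => ?_⟩
    · have := congrFun (congrFun (Matrix.mem_unitaryGroup_iff.1 h) i) j
      rw [Matrix.mul_apply, Matrix.one_apply] at this
      simpa only [Matrix.star_apply, hs] using this
    · have := congrFun (congrFun (Matrix.mem_unitaryGroup_iff'.1 h) i) j
      rw [Matrix.mul_apply, Matrix.one_apply] at this
      simpa only [Matrix.star_apply, hs] using this

theorem mem_Hom_qO {k : Word m} {l : Word n} {T : Matrix (Fin n → Fin N) (Fin m → Fin N) ℂ} :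
    T ∈ (qO N).Hom k l ↔ ∀ g ∈ Matrix.unitaryGroup (Fin N) ℂ, g.map star = g →
      T * tprod (fun _ : Fin m => g) = tprod (fun _ : Fin n => g) * T := by
  simp only [QMat.mem_Hom_iff, evalPoly_qO_eq_zero]
  have h : ∀ g : Matrix (Fin N) (Fin N) ℂ, OrthRel g →
      ((∀ J I, evalGen g (QMat.homPoly k l T J I) = 0) ↔
        T * tprod (fun _ : Fin m => g) = tprod (fun _ : Fin n => g) * T) := by
    intro g hg
    rw [← Matrix.ext_iff]
    refine forall₂_congr fun J I => ?_
    rw [evalGen_homPoly hg, sub_eq_zero, Matrix.mul_apply, Matrix.mul_apply]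
    simp only [List.prod_ofFn, tprod, Matrix.of_apply, smul_eq_mul, mul_comm (T _ I)]
  constructor
  · intro h' g hg hg'
    have ho := (orthRel_iff_unitary g).2 ⟨hg, hg'⟩
    exact (h g ho).1 fun J I => h' J I g ho
  · intro h' J I g hg
    have ho := (orthRel_iff_unitary g).1 hg
    exact (h g hg).2 (h' g ho.1 ho.2) J I

theorem isPairing_of_mem_Hom_qO (hN : 2 ≤ N) {k : Word m} {l : Word n} {π : Part m n}
    (h : Tmap N π ∈ (qO N).Hom k l) : IsPairing π :=
  isPairing_of_intertwines hN (mem_Hom_qO.1 h)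

/-- Each antidiagonal factor flips the row index, so a word evaluates to an alternating tensor
product of `v` and `v̄`, placed in a column given by the parity of its length. -/
theorem halfMat_word (v : Matrix (Fin N) (Fin N) ℂ) (I J : Fin m → Fin N) (b b' : Bool) :
    (List.ofFn fun a => halfMat v (I a) (J a)).prod b b' =
      if b' = xor b m.bodd then tprod (fun a : Fin m => conjIf (xor b (a : ℕ).bodd) v) I J
      else 0 := by
  induction m generalizing b with
  | zero => simp [tprod, Matrix.one_apply, eq_comm]
  | succ m ih =>
    rw [List.ofFn_succ, List.prod_cons, halfMat_mul_apply, ih]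
    have h1 : xor (!b) m.bodd = xor b (m + 1).bodd := by
      rw [Nat.bodd_succ]; cases b <;> cases m.bodd <;> rfl
    have h2 : ∀ a : Fin m, xor (!b) (a : ℕ).bodd = xor b (a.succ : ℕ).bodd := by
      intro a
      rw [Fin.val_succ, Nat.bodd_succ]; cases b <;> cases (a : ℕ).bodd <;> rfl
    simp only [h1, h2, mul_ite, mul_zero]
    congr 1
    simp only [tprod, Matrix.of_apply, Fin.prod_univ_succ]
    congr 1
    cases b <;> simp [conjEntry, conjIf]

/-- The alternating coloring of the points, in clockwise order. -/
def altColor (p : Fin m ⊕ Fin n) : Bool := !(cpos p).bodd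

theorem mem_Hom_qOstar_iff (hN : 0 < N) {k : Word m} {l : Word n}
    {T : Matrix (Fin n → Fin N) (Fin m → Fin N) ℂ} :
    T ∈ (qOstar N).Hom k l ↔ ∀ v ∈ Matrix.unitaryGroup (Fin N) ℂ, ∀ b b',
      (if b' = xor b m.bodd then
        T * tprod (fun a : Fin m => conjIf (xor b (a : ℕ).bodd) v) else 0) =
      if b' = xor b n.bodd then
        tprod (fun a : Fin n => conjIf (xor b (a : ℕ).bodd) v) * T else 0 := by
  simp only [QMat.mem_Hom_iff, evalPoly_qOstar_eq_zero hN]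
  have h : ∀ v ∈ Matrix.unitaryGroup (Fin N) ℂ, ∀ J I,
      evalGen (halfMat v) (QMat.homPoly k l T J I) = 0 ↔ ∀ b b',
      (if b' = xor b m.bodd then
        T * tprod (fun a : Fin m => conjIf (xor b (a : ℕ).bodd) v) else 0) J I =
      (if b' = xor b n.bodd then
        tprod (fun a : Fin n => conjIf (xor b (a : ℕ).bodd) v) * T else 0) J I := by
    intro v hv J I
    rw [evalGen_homPoly (orthRel_halfMat hv), sub_eq_zero, ← Matrix.ext_iff]
    refine forall₂_congr fun b b' => ?_
    rw [Matrix.sum_apply, Matrix.sum_apply]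
    simp only [Matrix.smul_apply, halfMat_word, smul_eq_mul, mul_ite, mul_zero]
    have h1 : ∀ (c : Prop) [Decidable c] (M : Matrix (Fin n → Fin N) (Fin m → Fin N) ℂ),
        (if c then M else 0) J I = if c then M J I else 0 := by
      intro c _ M
      split_ifs <;> rfl
    rw [h1, h1, Matrix.mul_apply, Matrix.mul_apply]
    simp only [mul_comm (T _ I)]
    split_ifs <;> simp
  constructor
  · intro h' v hv b b'
    ext J I
    exact (h v hv J I).1 (h' J I v hv) b b'
  · intro h' J I v hv
    exact (h v hv J I).2 fun b b' => by rw [h' v hv b b']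

/-- When `m + n` is even, a lower point `j` has clockwise position `m + n - 1 - j`, of parity
opposite to `j`. Both rows therefore alternate from left to right, starting with `v`. -/
theorem intertwines_altColor_iff (hmn : m.bodd = n.bodd)
    (T : Matrix (Fin n → Fin N) (Fin m → Fin N) ℂ) (v : Matrix (Fin N) (Fin N) ℂ) :
    Intertwines altColor T v ↔ T * tprod (fun a : Fin m => conjIf (a : ℕ).bodd v) =
      tprod (fun a : Fin n => conjIf (a : ℕ).bodd v) * T := by
  have h1 : ∀ i : Fin m, (!altColor (Sum.inl i : Fin m ⊕ Fin n)) = (i : ℕ).bodd := by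
    intro i
    simp [altColor]
  have h2 : ∀ j : Fin n, altColor (Sum.inr j : Fin m ⊕ Fin n) = (j : ℕ).bodd := by
    intro j
    have h3 : (m + (n - (j + 1)) + (j + 1)).bodd = (m + n).bodd := by
      congr 1
      omega
    rw [Nat.bodd_add, Nat.bodd_succ, Nat.bodd_add m n, hmn] at h3
    rw [altColor, cpos_inr]
    revert h3
    cases (m + (n - ((j : ℕ) + 1))).bodd <;> cases (j : ℕ).bodd <;> cases n.bodd <;> decide
  simp only [Intertwines, h1, h2]

theorem mem_Hom_qOstar_of_bodd_eq (hN : 0 < N) (hmn : m.bodd = n.bodd) {k : Word m} {l : Word n}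
    {T : Matrix (Fin n → Fin N) (Fin m → Fin N) ℂ} :
    T ∈ (qOstar N).Hom k l ↔ ∀ v ∈ Matrix.unitaryGroup (Fin N) ℂ, Intertwines altColor T v := by
  rw [mem_Hom_qOstar_iff hN]
  simp only [intertwines_altColor_iff hmn, hmn]
  constructor
  · intro h v hv
    simpa using h v hv false n.bodd
  · intro h v hv b b'
    split_ifs
    · cases b
      · simpa using h v hv
      -- The other row of the model carries the same condition for the conjugate unitary.
      · have h1 : ∀ c, conjIf c (v.map star) = conjIf (xor true c) v := by
          intro c
          cases c
          · rfl
          · ext; simp [conjIf]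
        simpa only [h1] using h _ (map_star_mem_unitaryGroup hv)
    · rfl

theorem eq_zero_of_mem_Hom_qOstar (hN : 0 < N) (hmn : m.bodd ≠ n.bodd) {k : Word m} {l : Word n}
    {T : Matrix (Fin n → Fin N) (Fin m → Fin N) ℂ} (hT : T ∈ (qOstar N).Hom k l) : T = 0 := by
  -- At `v = 1`, in this column only the left side is present, and it equals `T`.
  have h := (mem_Hom_qOstar_iff hN).1 hT 1 (one_mem _) false m.bodd
  have h1 : ∀ c, conjIf c (1 : Matrix (Fin N) (Fin N) ℂ) = 1 := by
    intro c
    cases c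
    · rfl
    · exact Matrix.map_one _ (star_zero _) (star_one _)
  simpa [h1, hmn, tprod_one] using h

theorem mem_P2star_iff_altColor {k : Word m} {l : Word n} {π : Part m n} :
    π ∈ P2star m n k l ↔ IsPairing π ∧ ∀ a b, a ≠ b → π a b → altColor a ≠ altColor b := by
  have h : ∀ a b : Fin m ⊕ Fin n, altColor a ≠ altColor b ↔ Odd (cpos a + cpos b) := by
    intro a b
    rw [altColor, altColor, Nat.odd_add, ← Nat.not_even_iff_odd, Nat.even_iff, Nat.even_iff,
      Nat.mod_two_of_bodd, Nat.mod_two_of_bodd]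
    cases (cpos a).bodd <;> cases (cpos b).bodd <;> simp
  simp only [h]
  rfl

theorem exists_altColor_equiv {h : ℕ} (hmn : m + n = h + h) : ∃ e : Fin h ⊕ Fin h ≃ Fin m ⊕ Fin n,
    (∀ a, altColor (e (Sum.inl a)) = true) ∧ ∀ a, altColor (e (Sum.inr a)) = false := by
  have h1 : ∀ a : Fin h, ∃ p : Fin m ⊕ Fin n, cpos p = 2 * a := fun a => exists_cpos (by omega)
  have h2 : ∀ a : Fin h, ∃ p : Fin m ⊕ Fin n, cpos p = 2 * a + 1 := fun a => exists_cpos (by omega)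
  choose f hf using h1
  choose g hg using h2
  have hinj : Function.Injective (Sum.elim f g) := by
    rintro (a | a) (b | b) hab
    · have := congrArg cpos hab
      simp only [Sum.elim_inl, hf] at this
      exact congrArg Sum.inl (Fin.ext (by omega))
    · have := congrArg cpos hab
      simp only [Sum.elim_inl, Sum.elim_inr, hf, hg] at this
      omega
    · have := congrArg cpos hab
      simp only [Sum.elim_inl, Sum.elim_inr, hf, hg] at this
      omega
    · have := congrArg cpos hab
      simp only [Sum.elim_inr, hg] at this
      exact congrArg Sum.inr (Fin.ext (by omega))
  have hbij : Function.Bijective (Sum.elim f g) :=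
    (Fintype.bijective_iff_injective_and_card _).2 ⟨hinj, by simp [hmn]⟩
  refine ⟨Equiv.ofBijective _ hbij, fun a => ?_, fun a => ?_⟩
  · simp [altColor, hf]
  · simp [altColor, hg]

theorem Hom_qOstar (hN : 0 < N) (k : Word m) (l : Word n) :
    (qOstar N).Hom k l = (Submodule.span ℂ (Tmap N '' P2star m n k l) : Set _) := by
  apply Set.Subset.antisymm
  · intro T hT
    by_cases hmn : m.bodd = n.bodd
    · obtain ⟨h, hh⟩ : Even (m + n) := by
        rw [Nat.even_iff, Nat.mod_two_of_bodd, Nat.bodd_add, hmn, Bool.xor_self]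
        rfl
      obtain ⟨e, h₁, h₂⟩ := exists_altColor_equiv hh
      have := mem_span_of_intertwines e h₁ h₂ ((mem_Hom_qOstar_of_bodd_eq hN hmn).1 hT)
      refine Submodule.span_mono (Set.image_mono fun π hπ => ?_) this
      exact mem_P2star_iff_altColor.2 hπ
    · rw [eq_zero_of_mem_Hom_qOstar hN hmn hT]
      exact zero_mem _
  · refine QMat.span_Tmap_subset_Hom fun π hπ => ?_
    obtain ⟨h1, h2⟩ := mem_P2star_iff_altColor.1 hπ
    have hmn : m.bodd = n.bodd := by
      have := h1.even
      rw [Nat.even_iff, Nat.mod_two_of_bodd, Nat.bodd_add] at this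
      revert this
      cases m.bodd <;> cases n.bodd <;> simp
    exact (mem_Hom_qOstar_of_bodd_eq hN hmn).2 fun v hv => Tmap_intertwines h1 h2 hv

/-- For `N ≥ 2` the test matrices above detect both the pairing property and the coloring, so the
partition is recovered from its linear map. -/
theorem homFam_qOstar (hN : 2 ≤ N) : (qOstar N).homFam = P2star := by
  have hN' : 0 < N := by omega
  funext m n k l
  refine Set.Subset.antisymm (fun π hπ => ?_) fun π hπ => ?_
  · have hπ' : Tmap N π ∈ (qOstar N).Hom k l := hπ
    by_cases hmn : m.bodd = n.bodd
    · have h1 := isPairing_of_mem_Hom_qO hN ((qO_sub_qOstar hN').Hom_subset k l hπ')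
      exact mem_P2star_iff_altColor.2 ⟨h1, color_ne_of_intertwines hN h1
        ((mem_Hom_qOstar_of_bodd_eq hN' hmn).1 hπ')⟩
    · exact absurd (eq_zero_of_mem_Hom_qOstar hN' hmn hπ') (Tmap_ne_zero hN' π)
  · change Tmap N π ∈ (qOstar N).Hom k l
    rw [Hom_qOstar hN']
    exact Submodule.subset_span ⟨π, hπ, rfl⟩

theorem isCategory_P2star : IsCategory P2star := by
  rw [← homFam_qOstar le_rfl]
  exact QMat.isCategory_homFam (by norm_num) isOrth_qOstar.isBiunitary

end Intertwiners

/-! ### The categories `NC₂ ⊂ P₂* ⊂ P₂` -/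

section Categories

theorem isPairing_revPart (s : ℕ) : IsPairing (revPart s) := by
  rintro (i | j)
  · refine ⟨Sum.inr i.rev, ⟨by simp, by simp [Setoid.ker_def]⟩, ?_⟩
    rintro (i' | j') ⟨h1, h2⟩
    · exact absurd (congrArg Sum.inl (show i' = i from (Eq.symm h2))) h1
    · have h3 : i = Fin.rev j' := h2
      rw [h3, Fin.rev_rev]
  · refine ⟨Sum.inl j.rev, ⟨by simp, by simp [Setoid.ker_def]⟩, ?_⟩
    rintro (i' | j') ⟨h1, h2⟩
    · have h3 : Fin.rev j = i' := h2
      rw [h3]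
    · have h3 : Fin.rev j = Fin.rev j' := h2
      exact absurd (congrArg Sum.inr (Fin.rev_injective h3.symm)) h1

theorem cpos_add_of_revPart {s : ℕ} {a b : Fin s ⊕ Fin s} (hab : a ≠ b) (h : revPart s a b) :
    ∃ i, cpos a + cpos b = 2 * i + s := by
  rcases a with i | i <;> rcases b with j | j
  · exact absurd (congrArg Sum.inl (show i = j from h)) hab
  · have h1 : i = Fin.rev j := h
    refine ⟨i, ?_⟩
    simp only [cpos, Sum.elim_inl, Sum.elim_inr, ← h1]
    omega
  · have h1 : Fin.rev i = j := h
    refine ⟨j, ?_⟩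
    simp only [cpos, Sum.elim_inl, Sum.elim_inr, h1]
    omega
  · exact absurd (congrArg Sum.inr (Fin.rev_injective (show Fin.rev i = Fin.rev j from h))) hab

theorem revPart_three_mem_P2star (k l : Word 3) : revPart 3 ∈ P2star 3 3 k l := by
  refine ⟨isPairing_revPart 3, fun a b hab h => ?_⟩
  obtain ⟨i, hi⟩ := cpos_add_of_revPart hab h
  exact ⟨i + 1, by omega⟩

theorem P2star_le_P2 : P2star ≤ P2 := fun _ _ _ _ _ h => h.1

theorem idPart_mem_NC2 (c c' : Bool) : Part.idPart 1 ∈ NC2 1 1 ![c] ![c'] := by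
  refine ⟨(isCategory_P2star.one ![c]).1, fun a b c d hab hbc hcd => ?_⟩
  have := cpos_lt d
  omega

theorem NC2_le_P2star : NC2 ≤ P2star :=
  NC2_le isCategory_P2star P2star_le_P2 fun c _ => isCategory_P2star.one ![c]

theorem NC2_lt_P2star : NC2 < P2star := by
  refine lt_of_le_not_ge NC2_le_P2star fun h => ?_
  have h1 := (h 3 3 (fun _ => false) (fun _ => false) (revPart_three_mem_P2star _ _)).2
    (Sum.inl 0) (Sum.inl 1) (Sum.inr 2) (Sum.inr 1)
  exact h1 (by decide) (by decide) (by decide) ⟨rfl, rfl⟩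

theorem P2star_lt_P2 : P2star < P2 := by
  refine lt_of_le_not_ge P2star_le_P2 fun h => ?_
  have h1 := (h 2 2 (fun _ => false) (fun _ => false) (isPairing_revPart 2)).2
    (Sum.inl 0) (Sum.inr 1) (by simp) rfl
  revert h1
  decide

theorem eq_P2star {D : PartFamily} (hD : IsCategory D) (h₁ : NC2 < D) (h₂ : D < P2) :
    D = P2star := by
  rcases eq_NC2_or_eq_P2star_or_eq_P2 hD h₂.le (fun c c' => h₁.le 1 1 _ _ (idPart_mem_NC2 c c'))
    with h | h | h
  · exact absurd h h₁.ne'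
  · exact h
  · exact absurd h h₂.ne

theorem not_stableUnderBlockRemoval_P2star : ¬ StableUnderBlockRemoval P2star := by
  intro h
  -- Removing the middle string of the half-liberated crossing leaves the ordinary crossing.
  have h1 := @h 3 3 2 2 (fun _ => false) (fun _ => false) (revPart 3)
    (revPart_three_mem_P2star _ _) (Sum.inl 1) ![0, 2] ![0, 2] (by decide) (by decide) (by
      ext b
      rcases b with i | i
      · simp only [Set.mem_range, Set.mem_ofPred_eq, Sum.exists, Sum.map_inl, Sum.map_inr,
          reduceCtorEq, exists_false, or_false, Sum.inl.injEq, Setoid.ker_def, Sum.elim_inl, id]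
        revert i
        decide
      · simp only [Set.mem_range, Set.mem_ofPred_eq, Sum.exists, Sum.map_inl, Sum.map_inr,
          reduceCtorEq, exists_false, false_or, Sum.inr.injEq, Setoid.ker_def, Sum.elim_inl,
          Sum.elim_inr, id]
        revert i
        decide)
  have h2 := h1.2 (Sum.inl 0) (Sum.inr 1) (by simp) rfl
  revert h2
  decide

theorem eq_idPart_one {π : Part 1 1} (hπ : IsPairing π) : π = Part.idPart 1 := by
  have h1 : π (Sum.inl 0) (Sum.inr 0) := by
    obtain ⟨b, ⟨hb, hab⟩, -⟩ := hπ (Sum.inl 0)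
    rcases b with j | j
    · exact absurd (congrArg Sum.inl (Subsingleton.elim j 0)) hb
    · rwa [Subsingleton.elim j 0] at hab
  refine (IsPairing.eq_of_le hπ (isCategory_P2star.one (fun _ : Fin 1 => false)).1 ?_).symm
  rintro (i | i) (j | j) -
  · rw [Subsingleton.elim i j]
  · rw [Subsingleton.elim i 0, Subsingleton.elim j 0]; exact h1
  · rw [Subsingleton.elim i 0, Subsingleton.elim j 0]; exact π.symm' h1
  · rw [Subsingleton.elim i j]

end Categories

/-! ### Commutation of the coordinates -/

section Commutation

variable {N : ℕ}

/-- The coordinates commute. -/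
def QMat.Commutes (G : QMat.{u} N) : Prop :=
  ∀ i j k l, G.u i j * G.u k l = G.u k l * G.u i j

open FreeAlgebra in
theorem QMat.commutes_iff (G : QMat.{u} N) : G.Commutes ↔ ∀ i j k l, evalPoly G.u
    (ι ℂ (i, j, false) * ι ℂ (k, l, false) - ι ℂ (k, l, false) * ι ℂ (i, j, false)) = 0 := by
  simp only [evalPoly_eq_evalGen, map_sub, map_mul, evalGen_ι, sub_eq_zero, Bool.false_eq_true,
    if_false]
  rfl

theorem QMat.Sub.commutes {G : QMat.{u} N} {H : QMat.{v} N} (h : G.Sub H) (hH : H.Commutes) :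
    G.Commutes := by
  rw [QMat.commutes_iff] at *
  exact fun i j k l => QMat.sub_iff.1 h _ (hH i j k l)

theorem commutes_universalQ {R : MatRel N}
    (h : ∀ M : Model R, ∀ i j k l, M.w i j * M.w k l = M.w k l * M.w i j) :
    (universalQ R).Commutes := by
  rw [QMat.commutes_iff]
  intro i j k l
  rw [evalPoly_universalQ_eq_zero]
  intro M
  exact (QMat.commutes_iff (⟨M.B, M.w⟩ : QMat N)).1 (h M) i j k l

/-- In the model of `diag(i, 1, …)`, the two products of the first two diagonal coordinates have the
entries `i` and `-i`. -/
theorem not_commutes_qOstar (hN : 2 ≤ N) : ¬ (qOstar N).Commutes := by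
  intro h
  let i₀ : Fin N := ⟨0, by omega⟩
  let i₁ : Fin N := ⟨1, by omega⟩
  have h01 : i₁ ≠ i₀ := by simp [i₀, i₁]
  let d : Fin N → ℂ := fun i => if i = i₀ then Complex.I else 1
  have hv : Matrix.diagonal d ∈ Matrix.unitaryGroup (Fin N) ℂ := by
    rw [Matrix.mem_unitaryGroup_iff, Matrix.star_eq_conjTranspose, Matrix.diagonal_conjTranspose,
      Matrix.diagonal_mul_diagonal, ← Matrix.diagonal_one]
    congr 1
    funext i
    simp only [d, Pi.star_apply]
    split_ifs <;> simp
  have h1 := (evalPoly_qOstar_eq_zero (by omega) _).1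
    ((QMat.commutes_iff _).1 h i₀ i₀ i₁ i₁) _ hv
  rw [map_sub, map_mul, map_mul, (orthRel_halfMat hv).evalGen_ι, (orthRel_halfMat hv).evalGen_ι,
    sub_eq_zero] at h1
  have h2 := congrFun (congrFun h1 false) false
  rw [halfMat_mul_apply, halfMat_mul_apply, halfMat_apply, halfMat_apply] at h2
  simp [conjEntry, d, h01] at h2
  have h3 := congrArg Complex.im h2
  norm_num at h3

theorem OrthRel.diagonal {C : Type*} [Ring C] [StarRing C] {d : Fin N → C}
    (hs : ∀ i, star (d i) = d i) (hd : ∀ i, d i * d i = 1) : OrthRel (Matrix.diagonal d) := by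
  have ht : ∀ i j, Matrix.diagonal d i j = Matrix.diagonal d j i := fun i j =>
    congrFun (congrFun (Matrix.diagonal_transpose d) j) i
  refine ⟨fun i j => ?_, fun i j => ?_, fun i j => ?_⟩
  · rw [Matrix.diagonal_apply]
    split_ifs
    · exact hs i
    · exact star_zero C
  · have := congrFun (congrFun (Matrix.diagonal_mul_diagonal d d) i) j
    rw [Matrix.mul_apply] at this
    simp only [hd, Matrix.diagonal_one, Matrix.one_apply] at this
    rw [← this]
    refine Finset.sum_congr rfl fun k _ => ?_
    rw [ht j k]
  · have := congrFun (congrFun (Matrix.diagonal_mul_diagonal d d) i) j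
    rw [Matrix.mul_apply] at this
    simp only [hd, Matrix.diagonal_one, Matrix.one_apply] at this
    rw [← this]
    refine Finset.sum_congr rfl fun k _ => ?_
    rw [ht k i]

/-- The Pauli matrices are self-adjoint with square 1, but `XYZ = i` while `ZYX = -i`. Three
diagonal slots are needed. -/
theorem not_qOplus_sub_qOstar (hN : 3 ≤ N) : ¬ (qOplus N).Sub (qOstar N) := by
  intro h
  let i₀ : Fin N := ⟨0, by omega⟩
  let i₁ : Fin N := ⟨1, by omega⟩
  let i₂ : Fin N := ⟨2, by omega⟩
  let X : Matrix (Fin 2) (Fin 2) ℂ := !![0, 1; 1, 0]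
  let Y : Matrix (Fin 2) (Fin 2) ℂ := !![0, -Complex.I; Complex.I, 0]
  let Z : Matrix (Fin 2) (Fin 2) ℂ := !![1, 0; 0, -1]
  let d : Fin N → Matrix (Fin 2) (Fin 2) ℂ := fun i =>
    if i = i₀ then X else if i = i₁ then Y else if i = i₂ then Z else 1
  have hd : OrthRel (Matrix.diagonal d) := by
    refine OrthRel.diagonal (fun i => ?_) fun i => ?_
    · simp only [d]
      split_ifs
      · ext a b; fin_cases a <;> fin_cases b <;> simp [X, Matrix.star_apply]
      · ext a b; fin_cases a <;> fin_cases b <;> simp [Y, Matrix.star_apply]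
      · ext a b; fin_cases a <;> fin_cases b <;> simp [Z, Matrix.star_apply]
      · exact star_one _
    · simp only [d]
      split_ifs
      · ext a b; fin_cases a <;> fin_cases b <;> simp [X, Matrix.mul_apply]
      · ext a b; fin_cases a <;> fin_cases b <;> simp [Y, Matrix.mul_apply]
      · ext a b; fin_cases a <;> fin_cases b <;> simp [Z, Matrix.mul_apply]
      · exact one_mul _
  have h1 : HalfRel (Matrix.diagonal d) := (halfRel_iff _).2 fun i₁ j₁ i₂ j₂ i₃ j₃ =>
    evalGen_eq_zero_of_qOplus hd
      (QMat.sub_iff.1 h _ ((halfRel_iff _).1 halfCommutes_qOstar i₁ j₁ i₂ j₂ i₃ j₃))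
  have h2 := h1 i₀ i₀ i₁ i₁ i₂ i₂
  simp only [Matrix.diagonal_apply_eq] at h2
  have e0 : d i₀ = X := if_pos rfl
  have e1 : d i₁ = Y := by simp [d, i₀, i₁]
  have e2 : d i₂ = Z := by simp [d, i₀, i₁, i₂]
  rw [e0, e1, e2] at h2
  have h3 := congrFun (congrFun h2 0) 0
  simp [X, Y, Z, Matrix.mul_apply, Fin.sum_univ_two] at h3
  have h4 := congrArg Complex.im h3
  norm_num at h4

end Commutation

/-! ### Non-uniformity -/

/-- Half-commutation with the corner entry 1 as third letter is commutation. -/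
theorem commutes_interU_qOstar (N : ℕ) : (interU (qOstar (N + 1))).Commutes := by
  refine commutes_universalQ fun M i j k l => ?_
  have h1 : HalfRel (diagOne M.w) := (halfRel_iff _).2 fun i₁ j₁ i₂ j₂ i₃ j₃ =>
    M.rel.2 _ ((halfRel_iff _).1 halfCommutes_qOstar i₁ j₁ i₂ j₂ i₃ j₃)
  have h2 : ∀ i j, diagOne M.w (finSumFinEquiv (Sum.inl i)) (finSumFinEquiv (Sum.inl j)) =
      M.w i j := fun i j => by
    rw [diagOne, Matrix.reindex_apply, Matrix.submatrix_apply, Equiv.symm_apply_apply,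
      Equiv.symm_apply_apply, Matrix.fromBlocks_apply₁₁]
  have h3 : diagOne M.w (finSumFinEquiv (Sum.inr 0)) (finSumFinEquiv (Sum.inr 0)) = 1 := by
    rw [diagOne, Matrix.reindex_apply, Matrix.submatrix_apply, Equiv.symm_apply_apply,
      Matrix.fromBlocks_apply₂₂, Matrix.one_apply_eq]
  have := h1 (finSumFinEquiv (Sum.inl i)) (finSumFinEquiv (Sum.inl j)) (finSumFinEquiv (Sum.inl k))
    (finSumFinEquiv (Sum.inl l)) (finSumFinEquiv (Sum.inr 0)) (finSumFinEquiv (Sum.inr 0))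
  rwa [h2, h2, h3, mul_one, one_mul] at this

theorem not_isUniform_qOstar : ¬ IsUniform qOstar := fun h =>
  not_commutes_qOstar le_rfl ((h 2 (by norm_num)).sub.commutes (commutes_interU_qOstar 2))

/-! ### Classification of the intermediate easy quantum groups -/

section Uniqueness

variable {N : ℕ}

theorem Tmap_revPart_apply (s : ℕ) (J I : Fin s → Fin N) :
    Tmap N (revPart s) J I = if J = I ∘ Fin.rev then 1 else 0 := by
  classical
  rw [Tmap_apply]
  congr 1
  rw [eq_iff_iff]
  constructor
  · intro h
    funext j
    exact @h (Sum.inr j) (Sum.inl j.rev) rfl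
  · rintro rfl a b hab
    have h1 : ∀ a : Fin s ⊕ Fin s, Sum.elim I (I ∘ Fin.rev) a = I (Sum.elim id Fin.rev a) := by
      rintro (a | a) <;> rfl
    rw [Setoid.ker_def, h1, h1]
    exact congrArg I hab

theorem QMat.commutes_of_revPart_mem {G : QMat.{u} N}
    (h : Tmap N (revPart 2) ∈ G.Hom (fun _ => false) fun _ => false) : G.Commutes := by
  intro i j k l
  have h1 := QMat.mem_Hom_entry.1 h ![k, i] ![j, l]
  rw [Finset.sum_eq_single ![i, k], Finset.sum_eq_single ![l, j]] at h1
  · have e1 : (![k, i] : Fin 2 → Fin N) = ![i, k] ∘ Fin.rev := by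
      funext a; fin_cases a <;> rfl
    have e2 : (![l, j] : Fin 2 → Fin N) = ![j, l] ∘ Fin.rev := by
      funext a; fin_cases a <;> rfl
    rw [Tmap_revPart_apply, Tmap_revPart_apply, if_pos e1, if_pos e2, map_one, one_mul,
      mul_one] at h1
    simpa [QMat.tensorPow] using h1
  · intro J _ hJ
    rw [Tmap_revPart_apply, if_neg, map_zero, mul_zero]
    rintro rfl
    apply hJ
    funext a; fin_cases a <;> rfl
  · simp
  · intro I _ hI
    rw [Tmap_revPart_apply, if_neg, map_zero, zero_mul]
    intro e
    apply hI
    have : I = ![k, i] ∘ Fin.rev := by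
      rw [e]
      funext a; simp
    rw [this]
    funext a; fin_cases a <;> rfl
  · simp

theorem QMat.Commutes.same_qO {G : QMat.{u} N} (hc : G.Commutes) (ho : IsOrth G.u)
    (h : (qO N).Sub G) : G.Same (qO N) :=
  QMat.same_of_sub_of_sub (QMat.sub_qO_of_commute ho hc) h

theorem idPart_mem_Hom {G : QMat.{u} N} (ho : IsOrth G.u) (c c' : Bool) :
    Tmap N (Part.idPart 1) ∈ G.Hom ![c] ![c'] := by
  rw [ho.Hom_eq ![c] ![c] ![c'] ![c], Tmap_idPart, QMat.mem_Hom, Matrix.map_one _ (map_zero _)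
    (map_one _), Matrix.one_mul, Matrix.mul_one]

/-- Only this inclusion for `O_N^+` is needed: it already gives `O_N^+ ⊂ G` when `G` comes from
`NC2`. -/
theorem NC2_le_homFam_qOplus (hN : 2 ≤ N) : NC2 ≤ (qOplus N).homFam := by
  refine NC2_le (QMat.isCategory_homFam (by omega) isOrth_qOplus.isBiunitary) ?_
    (idPart_mem_Hom isOrth_qOplus)
  intro m n k l π hπ
  have h1 : Tmap N π ∈ (qOstar N).Hom k l := qOstar_sub_qOplus.Hom_subset k l hπ
  exact isPairing_of_mem_Hom_qO hN ((qO_sub_qOstar (by omega)).Hom_subset k l h1)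

theorem QMat.IsQuantumGroup.same_qOstar (hN : 0 < N) {G : QMat.{u} N} (hG : G.IsQuantumGroup)
    (he : G.IsEasy) (h₁ : (qO N).Sub G) (h₂ : G.Sub (qOplus N)) (hO : ¬ G.Same (qO N))
    (hO' : ¬ G.Same (qOplus N)) : G.Same (qOstar N) := by
  have ho : IsOrth G.u := h₂.isOrth isOrth_qOplus
  obtain ⟨D, hD, hHom⟩ := he
  rcases Nat.lt_or_ge N 2 with h2 | h2
  · obtain rfl : N = 1 := by omega
    refine absurd (QMat.Commutes.same_qO (fun i j k l => ?_) ho h₁) hO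
    rw [Subsingleton.elim i k, Subsingleton.elim j l]
  have hP : D ≤ P2 := fun m n k l π hπ =>
    isPairing_of_mem_Hom_qO h2 (h₁.Hom_subset k l (by
      rw [hHom]
      exact Submodule.subset_span ⟨π, hπ, rfl⟩))
  have hid : ∀ c c', Part.idPart 1 ∈ D 1 1 ![c] ![c'] := by
    intro c c'
    -- The identity matrix is a nonzero intertwiner between any two colors, so this component of `D`
    -- is nonempty, and the only pairing of two facing points is the identity string.
    by_contra hne
    have h3 : D 1 1 ![c] ![c'] = ∅ := by
      refine Set.eq_empty_of_forall_notMem fun π hπ => hne ?_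
      rwa [← eq_idPart_one (hP _ _ _ _ hπ)]
    have h4 := idPart_mem_Hom ho c c'
    rw [hHom, h3, Set.image_empty, Submodule.span_empty] at h4
    exact Tmap_ne_zero hN _ h4
  rcases eq_NC2_or_eq_P2star_or_eq_P2 hD hP hid with rfl | rfl | rfl
  · refine absurd (QMat.same_of_sub_of_sub h₂ (hG.sub_of_Hom_subset fun {m n} k l => ?_)) hO'
    rw [hHom]
    exact QMat.span_Tmap_subset_Hom (NC2_le_homFam_qOplus h2 m n k l)
  · have h3 : ∀ {m n : ℕ} (k : Word m) (l : Word n), G.Hom k l = (qOstar N).Hom k l :=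
      fun {m n} k l => by rw [hHom, Hom_qOstar hN]
    exact QMat.same_of_sub_of_sub
      ((isQuantumGroup_qOstar hN).sub_of_Hom_subset fun k l => (h3 k l).ge)
      (hG.sub_of_Hom_subset fun k l => (h3 k l).le)
  · refine absurd (QMat.Commutes.same_qO (QMat.commutes_of_revPart_mem ?_) ho h₁) hO
    rw [hHom]
    exact Submodule.subset_span ⟨revPart 2, isPairing_revPart 2, rfl⟩

end Uniqueness

end EasyQG

theorem theorem11p13 :
    -- the categories of pairings between `NC₂` and `P₂`
    ((EasyQG.IsCategory EasyQG.P2star ∧ EasyQG.NC2 < EasyQG.P2star ∧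
        EasyQG.P2star < EasyQG.P2) ∧
      ∀ D : EasyQG.PartFamily, EasyQG.IsCategory D → EasyQG.NC2 < D → D < EasyQG.P2 →
        D = EasyQG.P2star) ∧
    -- `O_N^*` is an intermediate easy quantum group, which is proper for `N ≥ 3`
    (∀ N : ℕ, 0 < N →
      (EasyQG.qOstar N).IsQuantumGroup ∧ (EasyQG.qOstar N).IsEasyFrom EasyQG.P2star ∧
        (EasyQG.qO N).Sub (EasyQG.qOstar N) ∧ (EasyQG.qOstar N).Sub (EasyQG.qOplus N)) ∧
    (∀ N : ℕ, 3 ≤ N →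
      ¬ (EasyQG.qOstar N).Same (EasyQG.qO N) ∧ ¬ (EasyQG.qOstar N).Same (EasyQG.qOplus N)) ∧
    -- there is no other one
    (∀ (N : ℕ), 0 < N → ∀ G : EasyQG.QMat.{u} N, G.IsQuantumGroup → G.IsEasy →
      (EasyQG.qO N).Sub G → G.Sub (EasyQG.qOplus N) →
      ¬ G.Same (EasyQG.qO N) → ¬ G.Same (EasyQG.qOplus N) → G.Same (EasyQG.qOstar N)) ∧
    -- `O_N^*` is not uniform, at the level of quantum groups and at the level of categories
    ¬ EasyQG.IsUniform EasyQG.qOstar ∧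
    ¬ EasyQG.StableUnderBlockRemoval EasyQG.P2star :=
  ⟨⟨⟨EasyQG.isCategory_P2star, EasyQG.NC2_lt_P2star, EasyQG.P2star_lt_P2⟩,
      fun _ => EasyQG.eq_P2star⟩,
    fun _ hN => ⟨EasyQG.isQuantumGroup_qOstar hN,
      ⟨EasyQG.isCategory_P2star, fun _ _ => EasyQG.Hom_qOstar hN⟩,
      EasyQG.qO_sub_qOstar hN, EasyQG.qOstar_sub_qOplus⟩,
    fun _ hN => ⟨fun h => EasyQG.not_commutes_qOstar (by omega)
        (h.sub.commutes EasyQG.qO_commute),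
      fun h => EasyQG.not_qOplus_sub_qOstar hN h.sub'⟩,
    fun _ hN _ hG => hG.same_qOstar hN,
    EasyQG.not_isUniform_qOstar, EasyQG.not_stableUnderBlockRemoval_P2star⟩
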